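/- Let $C=[-\tfrac12,\tfrac12]^4\subset\mathbb{R}^4$ be the unit 4-cube, and let $U$ be a random point, uniformly distributed on the unit sphere $S^3\subset\mathbb{R}^4$. Let $Q$ be the orthogonal projection of $C$ onto the random three-dimensional subspace $U^\perp$, and let $vl$, $ar$ and $mw$ be the volume, the surface area and the mean width of the convex body $Q$ in the three-dimensional Euclidean space $U^\perp$ (the mean width is the average, over uniformly distributed unit vectors $v\in U^\perp$, of the distance between the two supporting planes of $Q$ orthogonal to $v$). Then $vl$, $ar$ and $mw$ are square integrable random variables and $$\mathbb{E}(vl\cdot ar)=6\Bigl(1+\frac4\pi\Bigr),\qquad \mathbb{E}(vl\cdot mw)=\frac94+\frac2\pi,\qquad \mathbb{E}(ar\cdot mw)=\frac{3(5+2G)}{\pi}+\frac{9\pi}{4},$$ where $G=\sum_{k=0}^{\infty}\frac{(-1)^k}{(2k+1)^2}$ is Catalan's constant. Moreover, the correlation coefficients have the decimal expansions $$\mathrm{corr}(vl,ar)=0.945\ldots,\qquad \mathrm{corr}(vl,mw)=0.870\ldots,\qquad \mathrm{corr}(ar,mw)=0.973\ldots,$$ that is, they lie in $[0.945,0.946)$,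 $[0.870,0.871)$ and $[0.973,0.974)$ respectively, where $\mathrm{corr}(X,Y)=\mathrm{Cov}(X,Y)/\sqrt{\mathrm{Var}(X)\,\mathrm{Var}(Y)}$. -/

import Mathlib

open MeasureTheory ProbabilityTheory

namespace CubeShadow

section Convex

variable (V : Type*) [NormedAddCommGroup V] [InnerProductSpace ℝ V] [FiniteDimensional ℝ V]
  [MeasurableSpace V] [BorelSpace V]

/-- The uniform probability measure on the unit sphere of a finite-dimensional Euclidean space:
the surface measure induced by Lebesgue measure, normalised to total mass `1`. -/
noncomputable def uniformSphere : Measure (Metric.sphere (0 : V) 1) :=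
  ((volume : Measure V).toSphere Set.univ)⁻¹ • (volume : Measure V).toSphere

variable {V}

/-- The volume of a set, as a real number, with respect to the Lebesgue measure of the
Euclidean space `V` (unit cubes on orthonormal bases have volume `1`). -/
noncomputable def vol (K : Set V) : ℝ := (volume : Measure V).real K

/-- The surface area of a body `K` in a three-dimensional Euclidean space `V`: the
two-dimensional Hausdorff measure of its boundary, normalised so as to agree with
Lebesgue measure on planes. -/
noncomputable def surfaceArea (K : Set V) : ℝ := (μHE[2] : Measure V).real (frontier K)

/-- The width of `K` in the direction `v`: the distance between the two supporting hyperplanes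
orthogonal to the unit vector `v`. -/
noncomputable def width (K : Set V) (v : V) : ℝ :=
  sSup ((fun p => inner ℝ v p) '' K) - sInf ((fun p => inner ℝ v p) '' K)

/-- The mean width: the average of the width over uniformly distributed unit directions. -/
noncomputable def meanWidth (K : Set V) : ℝ := ∫ v, width K (v : V) ∂(uniformSphere V)

end Convex

/-- The unit 4-cube centred at the origin. -/
def cube : Set (EuclideanSpace ℝ (Fin 4)) := {x | ∀ i, |x i| ≤ 1 / 2}

/-- The orthogonal projection of the cube onto the hyperplane orthogonal to `u`, as a subset of
that (three-dimensional, if `u ≠ 0`) Euclidean space. -/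
noncomputable def shadow (u : EuclideanSpace ℝ (Fin 4)) :
    Set (Submodule.span ℝ {u})ᗮ :=
  (Submodule.span ℝ {u})ᗮ.orthogonalProjectionOnto '' cube

/-- The volume of the projection along `u`. -/
noncomputable def vl (u : EuclideanSpace ℝ (Fin 4)) : ℝ := vol (shadow u)

/-- The surface area of the projection along `u`. -/
noncomputable def ar (u : EuclideanSpace ℝ (Fin 4)) : ℝ := surfaceArea (shadow u)

/-- The mean width of the projection along `u`. -/
noncomputable def mw (u : EuclideanSpace ℝ (Fin 4)) : ℝ := meanWidth (shadow u)

/-- The (Pearson) correlation coefficient of two real random variables. -/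
noncomputable def correlation {Ω : Type*} [MeasurableSpace Ω] (X Y : Ω → ℝ) (P : Measure Ω) : ℝ :=
  cov[X, Y; P] / (Real.sqrt (Var[X; P]) * Real.sqrt (Var[Y; P]))

/-- Catalan's constant (the series converges absolutely). -/
noncomputable def catalanConst : ℝ := ∑' k : ℕ, (-1 : ℝ) ^ k / (2 * (k : ℝ) + 1) ^ 2

end CubeShadow

/-! The proof has two independent halves: exact formulas for the three characteristics of the
projection along a unit vector `u`, and the computation of their mixed moments over the sphere.

Geometry. Assume no coordinate of `u` vanishes, which excludes only a null set. Every line parallel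
to `u` that meets the cube leaves it through one of the four facets facing `u`, so the shadow is the
union of four projected facets with null overlaps. A projected facet has volume `|u i|`, hence `vl =
∑ |u i|` (`vl_eq`). The line projects to a frontier point exactly when it enters and leaves the cube
at the same point. That point then lies on an exit facet `k` and an entry facet `l`, so the frontier
is the union of twelve projected 2-faces of area `√(u k ^ 2 + u l ^ 2)` (`frontier_shadow`,
`ar_eq`). The areas come from one Gram determinant (`normDet_proj_extendZero`). The width of the
shadow in direction `v ⊥ u` is `∑ |v i|`. Averaging over the 2-sphere gives half the length of each
projected basis vector, so `mw = ∑ √(1 - u i ^ 2) / 2` (`mw_eq`).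

Moments. Invariance under coordinate permutations reduces every product moment to a few
representative pairs. Most of these separate in iterated spherical coordinates. Two of them,
involving `√(u 0 ^ 2 + u 1 ^ 2)`, use coordinates adapted to a pair of orthogonal planes; one of the
two leads to `∫ x / sin x` and so to Catalan's constant
(`sphereMean_sqrt_add_mul_sqrt_one_sub_self`).

Correlations. The variances of `ar` and `mw` involve means of `√(1 - u 0 ^ 2) * √(1 - u 1 ^ 2)` on
the 2-sphere and the 3-sphere, which are enclosed numerically rather than evaluated. Replacing each
root by a Taylor polynomial `T` in `x y = x T(b) + y T(a) - T(a) T(b) + (T(a) - x)(T(b) - y)`, with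
`x = √(1 - a)` and `y = √(1 - b)`, leaves closed-form moments and a tiny nonnegative error
(`sphereMean_sqrt_mul_sqrt_mem`). Rational bounds for `π` and Catalan's constant finish the
estimates. -/

open scoped MeasureTheory Pointwise

namespace CubeShadow

/-! ### Planar polar coordinates between weighted product measures -/

/-- Radial part `r ^ k dr` on the positive half-line of Lebesgue measure in polar coordinates. -/
noncomputable def radial (k : ℕ) : Measure ℝ :=
  volume.withDensity ((Set.Ioi 0).indicator fun r => ENNReal.ofReal (r ^ k))

/-- The measure with density `w` on the interval `(a, b)`. -/
noncomputable def weighted (a b : ℝ) (w : ℝ → ℝ) : Measure ℝ :=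
  volume.withDensity ((Set.Ioo a b).indicator fun t => ENNReal.ofReal (w t))

lemma measurable_radial_density (k : ℕ) :
    Measurable ((Set.Ioi (0 : ℝ)).indicator fun r => ENNReal.ofReal (r ^ k)) :=
  Measurable.indicator (by fun_prop) measurableSet_Ioi

lemma measurable_weighted_density (a b : ℝ) {w : ℝ → ℝ} (hw : Continuous w) :
    Measurable ((Set.Ioo a b).indicator fun t => ENNReal.ofReal (w t)) :=
  Measurable.indicator (by fun_prop) measurableSet_Ioo

instance (k : ℕ) : SFinite (radial k) := by unfold radial; infer_instance
instance (a b : ℝ) (w : ℝ → ℝ) : SFinite (weighted a b w) := by unfold weighted; infer_instance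

/-- Polar coordinates as a map of products. -/
noncomputable def polarMap (p : ℝ × ℝ) : ℝ × ℝ := (p.1 * Real.cos p.2, p.1 * Real.sin p.2)

lemma continuous_polarMap : Continuous polarMap := by unfold polarMap; fun_prop

lemma lintegral_polarMap {F g : ℝ × ℝ → ENNReal}
    (hF : ∀ p : ℝ × ℝ, F p = polarCoord.target.indicator
      (fun p => ENNReal.ofReal p.1 * g (polarMap p)) p) :
    ∫⁻ p, F p = ∫⁻ p, g p := by
  rw [← lintegral_comp_polarCoord_symm g, ← lintegral_indicator polarCoord.open_target.measurableSet]
  refine lintegral_congr fun p => ?_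
  rw [hF]
  rfl

/-- The Jacobian of polar coordinates is `r`, so measure preservation between measures with
densities reduces to a pointwise identity. The source density must vanish off the target of
`polarCoord`; this lets one lemma serve the plane, the half-plane and the quarter-plane. -/
lemma measurePreserving_polarMap_of_density {μ ν : Measure (ℝ × ℝ)} {F g : ℝ × ℝ → ENNReal}
    (hμ : μ = volume.withDensity F) (hν : ν = volume.withDensity g)
    (hFm : Measurable F) (hgm : Measurable g)
    (h : ∀ p : ℝ × ℝ, F p = polarCoord.target.indicator
      (fun p => ENNReal.ofReal p.1 * g (polarMap p)) p) :
    MeasurePreserving polarMap μ ν := by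
  refine ⟨continuous_polarMap.measurable, Measure.ext_of_lintegral _ fun f hf => ?_⟩
  rw [lintegral_map hf continuous_polarMap.measurable, hμ, hν]
  change ∫⁻ p, (f ∘ polarMap) p ∂_ = _
  rw [lintegral_withDensity_eq_lintegral_mul _ hFm (hf.comp continuous_polarMap.measurable),
    lintegral_withDensity_eq_lintegral_mul _ hgm hf]
  refine lintegral_polarMap fun p => ?_
  simp only [Pi.mul_apply, h p]
  by_cases hp : p ∈ polarCoord.target
  · simp only [Set.indicator_of_mem hp, Function.comp, mul_assoc]
  · simp only [Set.indicator_of_notMem hp, zero_mul]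

lemma prod_withDensity_volume {f g : ℝ → ENNReal} (hf : Measurable f) (hg : Measurable g) :
    ((volume : Measure ℝ).withDensity f).prod ((volume : Measure ℝ).withDensity g) =
      (volume : Measure (ℝ × ℝ)).withDensity fun z => f z.1 * g z.2 := by
  rw [prod_withDensity hf hg]; rfl

/-- Polar coordinates in the plane. -/
lemma measurePreserving_polarMap_plane :
    MeasurePreserving polarMap ((radial 1).prod (weighted (-Real.pi) Real.pi fun _ => 1))
      (volume : Measure (ℝ × ℝ)) := by
  refine measurePreserving_polarMap_of_density (g := 1)
    (prod_withDensity_volume (measurable_radial_density 1)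
      (measurable_weighted_density _ _ continuous_const)) (by simp)
    (((measurable_radial_density 1).comp measurable_fst).mul
      ((measurable_weighted_density _ _ continuous_const).comp measurable_snd))
    measurable_one fun p => ?_
  by_cases h1 : p.1 ∈ Set.Ioi (0 : ℝ) <;> by_cases h2 : p.2 ∈ Set.Ioo (-Real.pi) Real.pi <;>
    simp only [polarCoord_target, Set.indicator, Set.mem_prod, h1, h2] <;> simp

/-- Polar coordinates in the upper half-plane. -/
lemma measurePreserving_polarMap_halfPlane (k : ℕ) :
    MeasurePreserving polarMap
      ((radial (k + 1)).prod (weighted 0 Real.pi fun t => Real.sin t ^ k))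
      ((volume : Measure ℝ).prod (radial k)) := by
  have hr := measurable_radial_density (k + 1)
  have hs := measurable_weighted_density 0 Real.pi (w := fun t => Real.sin t ^ k) (by fun_prop)
  have hr' := (measurable_radial_density k)
  refine measurePreserving_polarMap_of_density
    (g := fun z => 1 * (Set.Ioi (0 : ℝ)).indicator (fun r => ENNReal.ofReal (r ^ k)) z.2)
    (prod_withDensity_volume hr hs)
    (by simpa [radial] using prod_withDensity_volume measurable_one hr')
    ((hr.comp measurable_fst).mul (hs.comp measurable_snd))
    (measurable_const.mul (hr'.comp measurable_snd)) fun p => ?_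
  obtain ⟨r, θ⟩ := p
  by_cases h1 : 0 < r
  · by_cases h3 : θ ∈ Set.Ioo 0 Real.pi
    · have hs : 0 < Real.sin θ := Real.sin_pos_of_mem_Ioo h3
      have h2 : θ ∈ Set.Ioo (-Real.pi) Real.pi := ⟨by linarith [h3.1, Real.pi_pos], h3.2⟩
      simp only [polarCoord_target, Set.indicator, Set.mem_prod, Set.mem_Ioi, h1, h2, h3, polarMap,
        mul_pos h1 hs, and_self, if_true, one_mul]
      rw [← ENNReal.ofReal_mul (by positivity), ← ENNReal.ofReal_mul (by positivity)]
      congr 1; ring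
    -- Angles in `(-π, 0]` land where the second coordinate is nonpositive, and there the radial
    -- density is zero.
    · by_cases h2 : θ ∈ Set.Ioo (-Real.pi) Real.pi
      · have hs : Real.sin θ ≤ 0 := by
          apply Real.sin_nonpos_of_nonpos_of_neg_pi_le _ h2.1.le
          by_contra h; exact h3 ⟨not_le.1 h, h2.2⟩
        have : ¬ 0 < r * Real.sin θ := by nlinarith
        simp [polarCoord_target, Set.indicator, h1, h3, polarMap, this]
      · simp only [polarCoord_target, Set.indicator, Set.mem_prod, h2, h3]; simp
  · simp only [polarCoord_target, Set.indicator, Set.mem_prod, Set.mem_Ioi, h1]; simp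

/-- Polar coordinates in the quarter-plane, for a product of planar radial measures. -/
lemma measurePreserving_polarMap_quarterPlane :
    MeasurePreserving polarMap
      ((radial 3).prod (weighted 0 (Real.pi / 2) fun t => Real.cos t * Real.sin t))
      ((radial 1).prod (radial 1)) := by
  have hr := measurable_radial_density 3
  have hs := measurable_weighted_density 0 (Real.pi / 2) (w := fun t => Real.cos t * Real.sin t)
    (by fun_prop)
  have hr' := (measurable_radial_density 1)
  refine measurePreserving_polarMap_of_density
    (g := fun z => (Set.Ioi (0 : ℝ)).indicator (fun r => ENNReal.ofReal (r ^ 1)) z.1 *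
      (Set.Ioi (0 : ℝ)).indicator (fun r => ENNReal.ofReal (r ^ 1)) z.2)
    (prod_withDensity_volume hr hs)
    (prod_withDensity_volume hr' hr')
    ((hr.comp measurable_fst).mul (hs.comp measurable_snd))
    ((hr'.comp measurable_fst).mul (hr'.comp measurable_snd)) fun p => ?_
  obtain ⟨r, θ⟩ := p
  have hpi := Real.pi_pos
  by_cases h1 : 0 < r
  · by_cases h3 : θ ∈ Set.Ioo 0 (Real.pi / 2)
    · have hs : 0 < Real.sin θ := Real.sin_pos_of_mem_Ioo ⟨h3.1, by linarith [h3.2]⟩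
      have hc : 0 < Real.cos θ := Real.cos_pos_of_mem_Ioo ⟨by linarith [h3.1], h3.2⟩
      have h2 : θ ∈ Set.Ioo (-Real.pi) Real.pi := ⟨by linarith [h3.1], by linarith [h3.2]⟩
      simp only [polarCoord_target, Set.indicator, Set.mem_prod, Set.mem_Ioi, h1, h2, h3, polarMap,
        mul_pos h1 hs, mul_pos h1 hc, and_self, if_true]
      rw [← ENNReal.ofReal_mul (by positivity), ← ENNReal.ofReal_mul (by positivity),
        ← ENNReal.ofReal_mul (by positivity)]
      congr 1; ring
    · by_cases h2 : θ ∈ Set.Ioo (-Real.pi) Real.pi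
      · have hs : ¬ 0 < r * Real.cos θ ∨ ¬ 0 < r * Real.sin θ := by
          by_contra! h
          have hc := pos_of_mul_pos_right h.1 h1.le
          have hs := pos_of_mul_pos_right h.2 h1.le
          refine h3 ⟨?_, ?_⟩
          · by_contra h'
            exact absurd (Real.sin_nonpos_of_nonpos_of_neg_pi_le (not_lt.1 h') h2.1.le)
              (not_le.2 hs)
          · by_contra h'
            exact absurd (Real.cos_nonpos_of_pi_div_two_le_of_le (not_lt.1 h') (by linarith [h2.2]))
              (not_le.2 hc)
        rcases hs with hs | hs <;> simp [polarCoord_target, Set.indicator, h3, polarMap, hs]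
      · simp only [polarCoord_target, Set.indicator, Set.mem_prod, h2, h3]; simp
  · simp only [polarCoord_target, Set.indicator, Set.mem_prod, Set.mem_Ioi, h1]; simp

lemma ae_radial_pos (k : ℕ) : ∀ᵐ r ∂radial k, 0 < r := by
  rw [radial, ae_withDensity_iff (measurable_radial_density k)]
  refine Filter.Eventually.of_forall fun r hr => ?_
  by_contra h
  exact hr (Set.indicator_of_notMem (s := Set.Ioi (0 : ℝ)) h _)

/-- This mass is the reciprocal of the dimension `k + 1`, and cancels the dimension factor in the
definition of `toSphere`. -/
lemma radial_Ioo_zero_one (k : ℕ) : radial k (Set.Ioo 0 1) = ((k + 1 : ℕ) : ENNReal)⁻¹ := by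
  have hsub : Set.Ioo (0 : ℝ) 1 ⊆ Set.Ioi 0 := fun x hx => hx.1
  rw [radial, withDensity_apply _ measurableSet_Ioo, setLIntegral_indicator measurableSet_Ioi,
    Set.inter_eq_self_of_subset_right hsub, ← ofReal_integral_eq_lintegral_ofReal]
  · rw [← integral_Ioc_eq_integral_Ioo, ← intervalIntegral.integral_of_le zero_le_one, integral_pow]
    rw [← ENNReal.ofReal_natCast, ← ENNReal.ofReal_inv_of_pos (by positivity)]
    simp
  · exact ((continuous_pow k).integrableOn_Icc (a := 0) (b := 1)).mono_set Set.Ioo_subset_Icc_self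
  · filter_upwards [ae_restrict_mem measurableSet_Ioo] with x hx
    exact pow_nonneg hx.1.le _

/-! ### The surface measure of a sphere through polar parametrisations -/

section Sphere

variable {E : Type*} [NormedAddCommGroup E] [InnerProductSpace ℝ E] [FiniteDimensional ℝ E]
  [MeasurableSpace E] [BorelSpace E]

/-- `Measure.toSphere` measures a set on the sphere by the volume of the truncated cone over it;
here the cone becomes an explicit condition on `x`. -/
lemma Ioo_smul_sphere_inter {E : Type*} [NormedAddCommGroup E] [InnerProductSpace ℝ E] (s : Set E) :
    Set.Ioo (0 : ℝ) 1 • ((↑) '' ((↑) ⁻¹' s : Set (Metric.sphere (0 : E) 1)) : Set E) =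
      {x | 0 < ‖x‖ ∧ ‖x‖ < 1 ∧ ‖x‖⁻¹ • x ∈ s} := by
  ext x
  simp only [Set.mem_smul, Set.mem_image, Set.mem_preimage, Set.mem_ofPred_eq]
  constructor
  · rintro ⟨r, ⟨hr0, hr1⟩, _, ⟨y, hy, rfl⟩, rfl⟩
    have : ‖(y : E)‖ = 1 := by simp
    rw [norm_smul, this, Real.norm_of_nonneg hr0.le, mul_one, smul_smul, inv_mul_cancel₀ hr0.ne',
      one_smul]
    exact ⟨hr0, hr1, hy⟩
  · rintro ⟨h0, h1, h⟩
    refine ⟨‖x‖, ⟨h0, h1⟩, ‖x‖⁻¹ • x, ⟨⟨‖x‖⁻¹ • x, ?_⟩, h, rfl⟩, ?_⟩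
    · simp [norm_smul, h0.ne']
    · rw [smul_smul, mul_inv_cancel₀ h0.ne', one_smul]

lemma measurableSet_cone {s : Set E} (hs : MeasurableSet s) :
    MeasurableSet {x : E | 0 < ‖x‖ ∧ ‖x‖ < 1 ∧ ‖x‖⁻¹ • x ∈ s} := by
  refine (measurableSet_lt measurable_const measurable_norm).inter
    ((measurableSet_lt measurable_norm measurable_const).inter ?_)
  have : Measurable fun x : E => ‖x‖⁻¹ • x := by fun_prop
  exact this hs

/-- The surface measure of the sphere, as a measure on the ambient space. -/
lemma map_coe_toSphere_apply {s : Set E} (hs : MeasurableSet s) :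
    (volume : Measure E).toSphere.map (↑) s =
      Module.finrank ℝ E * (volume : Measure E) {x | 0 < ‖x‖ ∧ ‖x‖ < 1 ∧ ‖x‖⁻¹ • x ∈ s} := by
  rw [Measure.map_apply measurable_subtype_coe hs,
    Measure.toSphere_apply' _ (measurable_subtype_coe hs), Ioo_smul_sphere_inter]

/-- If `(r, ω) ↦ r • Ψ ω` are polar coordinates for Lebesgue measure, then `Ψ` parametrises the
surface measure of the sphere. -/
theorem map_coe_toSphere_eq {Θ : Type*} [MeasurableSpace Θ] {μ : Measure Θ} [SFinite μ]
    {Ψ : Θ → E} (hΨ : Measurable Ψ) (hn : ∀ ω, ‖Ψ ω‖ = 1) {k : ℕ}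
    (hk : Module.finrank ℝ E = k + 1)
    (hp : MeasurePreserving (fun p : ℝ × Θ => p.1 • Ψ p.2) ((radial k).prod μ) volume) :
    (volume : Measure E).toSphere.map (↑) = μ.map Ψ := by
  ext s hs
  rw [map_coe_toSphere_apply hs, Measure.map_apply hΨ hs,
    ← hp.measure_preimage (measurableSet_cone hs).nullMeasurableSet,
    Measure.prod_apply (hp.measurable (measurableSet_cone hs))]
  -- By Fubini it suffices to slice the cone at fixed radius: the slice is `Ψ ⁻¹' s` for `0 < r < 1`
  -- and empty for `r ≥ 1`.
  have : ∀ᵐ r ∂radial k, μ (Prod.mk r ⁻¹' ((fun p : ℝ × Θ => p.1 • Ψ p.2) ⁻¹'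
      {x | 0 < ‖x‖ ∧ ‖x‖ < 1 ∧ ‖x‖⁻¹ • x ∈ s})) =
      (Set.Ioo (0 : ℝ) 1).indicator (fun _ => μ (Ψ ⁻¹' s)) r := by
    filter_upwards [ae_radial_pos k] with r hr
    by_cases h1 : r < 1
    · rw [Set.indicator_of_mem (show r ∈ Set.Ioo (0 : ℝ) 1 from ⟨hr, h1⟩)]
      congr 1
      ext ω
      have h0 : Ψ ω ≠ 0 := fun h => by simpa [h] using hn ω
      simp [norm_smul, hn, abs_of_pos hr, h1, smul_smul, hr.ne', h0]
    · rw [Set.indicator_of_notMem (fun h => h1 h.2)]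
      convert measure_empty (μ := μ)
      ext ω
      simp [norm_smul, hn, abs_of_pos hr, h1]
  rw [lintegral_congr_ae this, lintegral_indicator measurableSet_Ioo, setLIntegral_const,
    radial_Ioo_zero_one, hk, mul_comm (μ _), ← mul_assoc,
    ENNReal.mul_inv_cancel (by simp) (by simp), one_mul]

lemma integral_uniformSphere_eq_toSphere {F : E → ℝ} :
    ∫ v, F (v : E) ∂(uniformSphere E) =
      ((volume : Measure E).toSphere.real Set.univ)⁻¹ *
        ∫ v, F (v : E) ∂(volume : Measure E).toSphere := by
  rw [uniformSphere, integral_smul_measure, ENNReal.toReal_inv, smul_eq_mul]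
  rfl

/-- Integration over the uniform measure in polar coordinates. -/
theorem integral_uniformSphere_eq {Θ : Type*} [MeasurableSpace Θ] {μ : Measure Θ} [SFinite μ]
    {Ψ : Θ → E} (hΨ : Measurable Ψ) (hn : ∀ ω, ‖Ψ ω‖ = 1) {k : ℕ}
    (hk : Module.finrank ℝ E = k + 1)
    (hp : MeasurePreserving (fun p : ℝ × Θ => p.1 • Ψ p.2) ((radial k).prod μ) volume)
    {F : E → ℝ} (hF : Measurable F) :
    ∫ v, F (v : E) ∂(uniformSphere E) = (μ.real Set.univ)⁻¹ * ∫ ω, F (Ψ ω) ∂μ := by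
  have key := map_coe_toSphere_eq hΨ hn hk hp
  rw [integral_uniformSphere_eq_toSphere, ← integral_map (φ := fun v : Metric.sphere (0 : E) 1 =>
    (v : E)) measurable_subtype_coe.aemeasurable hF.aestronglyMeasurable, key,
    integral_map hΨ.aemeasurable hF.aestronglyMeasurable]
  congr 2
  have := congrArg (fun m => m Set.univ) key
  simp only [Measure.map_apply measurable_subtype_coe MeasurableSet.univ,
    Measure.map_apply hΨ MeasurableSet.univ, Set.preimage_univ] at this
  rw [Measure.real, this]; rfl

instance [Nontrivial E] : IsProbabilityMeasure (uniformSphere E) := by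
  constructor
  rw [uniformSphere, Measure.smul_apply, smul_eq_mul, ENNReal.inv_mul_cancel]
  · rw [Ne, Measure.measure_univ_eq_zero]
    exact Measure.toSphere_ne_zero _
  · exact measure_ne_top _ _

/-- The uniform measure is invariant under linear isometries. -/
theorem integral_uniformSphere_comp {E' : Type*} [NormedAddCommGroup E'] [InnerProductSpace ℝ E']
    [FiniteDimensional ℝ E'] [MeasurableSpace E'] [BorelSpace E'] (e : E ≃ₗᵢ[ℝ] E')
    {F : E' → ℝ} (hF : Measurable F) :
    ∫ v, F (e v) ∂(uniformSphere E) = ∫ v, F (v : E') ∂(uniformSphere E') := by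
  -- An isometry preserves Lebesgue measure and carries truncated cones to truncated cones.
  have key : ((volume : Measure E).toSphere.map (↑)).map e =
      (volume : Measure E').toSphere.map (↑) := by
    ext s hs
    rw [Measure.map_apply e.continuous.measurable hs,
      map_coe_toSphere_apply (e.continuous.measurable hs), map_coe_toSphere_apply hs,
      e.toLinearEquiv.finrank_eq,
      ← e.measurePreserving.measure_preimage (measurableSet_cone hs).nullMeasurableSet]
    congr 2
    ext x; simp
  have hme := e.continuous.measurable
  rw [integral_uniformSphere_eq_toSphere (F := fun v => F (e v)),
    integral_uniformSphere_eq_toSphere,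
    ← integral_map (φ := fun v : Metric.sphere (0 : E) 1 => (v : E)) (f := fun x => F (e x))
      measurable_subtype_coe.aemeasurable (hF.comp hme).aestronglyMeasurable,
    ← integral_map (f := F) hme.aemeasurable hF.aestronglyMeasurable,
    key, integral_map measurable_subtype_coe.aemeasurable hF.aestronglyMeasurable]
  congr 2
  have := congrArg (fun m => m Set.univ) key
  simp only [Measure.map_apply hme MeasurableSet.univ,
    Measure.map_apply measurable_subtype_coe MeasurableSet.univ, Set.preimage_univ] at this
  rw [Measure.real, this]; rfl

end Sphere

/-! ### Polar coordinates in higher dimension by composition of planar ones -/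

section Coordinates

variable {V Θ : Type*} [NormedAddCommGroup V] [NormedSpace ℝ V] [MeasureSpace V]
  [MeasurableSpace Θ]

/-- Adding one coordinate to a system of polar coordinates. -/
theorem measurePreserving_polar_succ {μ : Measure Θ} [SFinite μ] {Ψ : Θ → V} {k : ℕ}
    (hp : MeasurePreserving (fun p : ℝ × Θ => p.1 • Ψ p.2) ((radial k).prod μ) volume) :
    MeasurePreserving
      (fun p : ℝ × (ℝ × Θ) => p.1 • (Real.cos p.2.1, Real.sin p.2.1 • Ψ p.2.2))
      ((radial (k + 1)).prod ((weighted 0 Real.pi fun t => Real.sin t ^ k).prod μ))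
      (volume : Measure (ℝ × V)) := by
  -- The radius and new angle are turned into a first coordinate and a smaller radius, which is then
  -- combined with the old angles by `hp`.
  have h1 := (measurePreserving_prodAssoc (radial (k + 1))
    (weighted 0 Real.pi fun t => Real.sin t ^ k) μ).symm
  have h2 := (measurePreserving_polarMap_halfPlane k).prod (MeasurePreserving.id μ)
  have h3 := measurePreserving_prodAssoc (volume : Measure ℝ) (radial k) μ
  have h4 := (MeasurePreserving.id (volume : Measure ℝ)).prod hp
  have h := h4.comp (h3.comp (h2.comp h1))
  refine (congrArg (fun f => MeasurePreserving f _ (volume.prod volume)) ?_).mp h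
  ext p <;> simp [polarMap, MeasurableEquiv.prodAssoc, smul_smul]

/-- Polar coordinates on a product of two planes. -/
theorem measurePreserving_polar_two_planes :
    MeasurePreserving
      (fun p : ℝ × (ℝ × (ℝ × ℝ)) => p.1 •
        ((Real.cos p.2.1 * Real.cos p.2.2.1, Real.cos p.2.1 * Real.sin p.2.2.1),
         (Real.sin p.2.1 * Real.cos p.2.2.2, Real.sin p.2.1 * Real.sin p.2.2.2)))
      ((radial 3).prod ((weighted 0 (Real.pi / 2) fun t => Real.cos t * Real.sin t).prod
        ((weighted (-Real.pi) Real.pi fun _ => 1).prod (weighted (-Real.pi) Real.pi fun _ => 1))))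
      (volume : Measure ((ℝ × ℝ) × (ℝ × ℝ))) := by
  set A := weighted (-Real.pi) Real.pi fun _ => 1
  set Q := weighted 0 (Real.pi / 2) fun t => Real.cos t * Real.sin t
  have h1 := (measurePreserving_prodAssoc (radial 3) Q (A.prod A)).symm
  have h2 := measurePreserving_polarMap_quarterPlane.prod (MeasurePreserving.id (A.prod A))
  have h3 := measurePreserving_prodAssoc (radial 1) (radial 1) (A.prod A)
  have h4 := (MeasurePreserving.id (radial 1)).prod
    (measurePreserving_prodAssoc (radial 1) A A).symm
  have h5 := (MeasurePreserving.id (radial 1)).prod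
    ((measurePreserving_polarMap_plane).prod (MeasurePreserving.id A))
  have h6 := (MeasurePreserving.id (radial 1)).prod
    (Measure.measurePreserving_swap (μ := (volume : Measure (ℝ × ℝ))) (ν := A))
  have h7 := (measurePreserving_prodAssoc (radial 1) A (volume : Measure (ℝ × ℝ))).symm
  have h8 := (measurePreserving_polarMap_plane).prod
    (MeasurePreserving.id (volume : Measure (ℝ × ℝ)))
  have h9 := Measure.measurePreserving_swap (μ := (volume : Measure (ℝ × ℝ)))
    (ν := (volume : Measure (ℝ × ℝ)))
  have h := h8.comp (h7.comp (h6.comp (h5.comp (h4.comp (h3.comp (h2.comp h1))))))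
  -- The chain above attaches the radius `r cos α` to the last angle; swapping the two angles
  -- beforehand restores the stated order.
  have hs := (MeasurePreserving.id (radial 3)).prod ((MeasurePreserving.id Q).prod
    (Measure.measurePreserving_swap (μ := A) (ν := A)))
  refine (congrArg (fun f => MeasurePreserving f _ (volume.prod volume)) ?_).mp (h.comp hs)
  ext p <;> simp [polarMap, MeasurableEquiv.prodAssoc, mul_assoc]

end Coordinates

lemma integral_weighted {a b : ℝ} (hab : a ≤ b) {w : ℝ → ℝ} (hw : Continuous w)
    (hpos : ∀ t ∈ Set.Ioo a b, 0 ≤ w t) (f : ℝ → ℝ) :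
    ∫ t, f t ∂(weighted a b w) = ∫ t in a..b, w t * f t := by
  rw [weighted, integral_withDensity_eq_integral_toReal_smul (measurable_weighted_density a b hw)]
  · rw [intervalIntegral.integral_of_le hab, integral_Ioc_eq_integral_Ioo,
      ← integral_indicator measurableSet_Ioo]
    congr 1
    ext t
    by_cases ht : t ∈ Set.Ioo a b
    · simp [ht, ENNReal.toReal_ofReal (hpos t ht)]
    · simp [ht]
  · refine Filter.Eventually.of_forall fun t => ?_
    by_cases ht : t ∈ Set.Ioo a b <;> simp [ht]

/-! ### Explicit parametrisations of the unit spheres in dimensions 3 and 4 -/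

/-- The equivalence between iterated products and Euclidean space. -/
noncomputable def vec3 (p : ℝ × (ℝ × ℝ)) : EuclideanSpace ℝ (Fin 3) := !₂[p.1, p.2.1, p.2.2]

noncomputable def vec4 (p : ℝ × (ℝ × (ℝ × ℝ))) : EuclideanSpace ℝ (Fin 4) :=
  !₂[p.1, p.2.1, p.2.2.1, p.2.2.2]

lemma measurePreserving_fin_cons (n : ℕ) :
    MeasurePreserving (fun p : ℝ × (Fin n → ℝ) => (Fin.cons p.1 p.2 : Fin (n + 1) → ℝ)) := by
  convert (volume_preserving_piFinSuccAbove (fun _ : Fin (n + 1) => ℝ) 0).symm using 1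
  ext p i
  simp [MeasurableEquiv.piFinSuccAbove]

lemma measurePreserving_vec3 : MeasurePreserving vec3 := by
  have h1 := (MeasurePreserving.id (volume : Measure ℝ)).prod
    (volume_preserving_finTwoArrow ℝ).symm
  have h2 := (EuclideanSpace.volume_preserving_symm_measurableEquiv_toLp (Fin 3)).symm
  refine (congrArg (fun f => MeasurePreserving f _ volume) ?_).mp
    (h2.comp ((measurePreserving_fin_cons 2).comp h1))
  ext p i; fin_cases i <;> rfl

lemma measurePreserving_vec4 : MeasurePreserving vec4 := by
  have h0 := (volume_preserving_finTwoArrow ℝ).symm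
  have h1 := (MeasurePreserving.id (volume : Measure ℝ)).prod h0
  have h3 := (MeasurePreserving.id (volume : Measure ℝ)).prod
    ((measurePreserving_fin_cons 2).comp h1)
  have h2 := (EuclideanSpace.volume_preserving_symm_measurableEquiv_toLp (Fin 4)).symm
  refine (congrArg (fun f => MeasurePreserving f _ volume) ?_).mp
    (h2.comp ((measurePreserving_fin_cons 3).comp h3))
  ext p i; fin_cases i <;> rfl

/-- The measure `dφ` on `(-π, π)`. -/
noncomputable abbrev arc : Measure ℝ := weighted (-Real.pi) Real.pi fun _ => 1

/-- Iterated spherical coordinates on the unit sphere of `ℝ³`. -/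
noncomputable def spherical3 (ω : ℝ × ℝ) : EuclideanSpace ℝ (Fin 3) :=
  vec3 (Real.cos ω.1, Real.sin ω.1 • (Real.cos ω.2, Real.sin ω.2))

/-- Iterated spherical coordinates on the unit sphere of `ℝ⁴`. -/
noncomputable def spherical4 (ω : ℝ × (ℝ × ℝ)) : EuclideanSpace ℝ (Fin 4) :=
  vec4 (Real.cos ω.1, Real.sin ω.1 • (Real.cos ω.2.1, Real.sin ω.2.1 •
    (Real.cos ω.2.2, Real.sin ω.2.2)))

/-- Coordinates on the unit sphere of `ℝ⁴` adapted to two orthogonal planes. -/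
noncomputable def hopf (ω : ℝ × (ℝ × ℝ)) : EuclideanSpace ℝ (Fin 4) :=
  vec4 (Real.cos ω.1 * Real.cos ω.2.1, Real.cos ω.1 * Real.sin ω.2.1,
    Real.sin ω.1 * Real.cos ω.2.2, Real.sin ω.1 * Real.sin ω.2.2)

lemma vec3_smul (r : ℝ) (p : ℝ × (ℝ × ℝ)) : vec3 (r • p) = r • vec3 p := by
  ext i; fin_cases i <;> simp [vec3]

lemma vec4_smul (r : ℝ) (p : ℝ × (ℝ × (ℝ × ℝ))) : vec4 (r • p) = r • vec4 p := by
  ext i; fin_cases i <;> simp [vec4]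

lemma continuous_vec3 : Continuous vec3 := by unfold vec3; fun_prop

lemma continuous_vec4 : Continuous vec4 := by unfold vec4; fun_prop

lemma continuous_spherical3 : Continuous spherical3 :=
  continuous_vec3.comp (by fun_prop)

lemma continuous_spherical4 : Continuous spherical4 :=
  continuous_vec4.comp (by fun_prop)

lemma continuous_hopf : Continuous hopf :=
  continuous_vec4.comp (by fun_prop)

lemma norm_spherical3 (ω : ℝ × ℝ) : ‖spherical3 ω‖ = 1 := by
  rw [EuclideanSpace.norm_eq, Real.sqrt_eq_one]
  simp only [Fin.sum_univ_three, spherical3, vec3, Real.norm_eq_abs, sq_abs]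
  simp
  nlinarith [Real.sin_sq_add_cos_sq ω.1, Real.sin_sq_add_cos_sq ω.2]

lemma norm_spherical4 (ω : ℝ × (ℝ × ℝ)) : ‖spherical4 ω‖ = 1 := by
  rw [EuclideanSpace.norm_eq, Real.sqrt_eq_one]
  simp only [Fin.sum_univ_four, spherical4, vec4, Real.norm_eq_abs, sq_abs]
  simp
  linear_combination Real.sin_sq_add_cos_sq ω.1 + Real.sin ω.1 ^ 2 *
    Real.sin_sq_add_cos_sq ω.2.1 + Real.sin ω.1 ^ 2 * Real.sin ω.2.1 ^ 2 *
    Real.sin_sq_add_cos_sq ω.2.2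

lemma norm_hopf (ω : ℝ × (ℝ × ℝ)) : ‖hopf ω‖ = 1 := by
  rw [EuclideanSpace.norm_eq, Real.sqrt_eq_one]
  simp only [Fin.sum_univ_four, hopf, vec4, Real.norm_eq_abs, sq_abs]
  simp
  linear_combination Real.sin_sq_add_cos_sq ω.1 + Real.cos ω.1 ^ 2 *
    Real.sin_sq_add_cos_sq ω.2.1 + Real.sin ω.1 ^ 2 * Real.sin_sq_add_cos_sq ω.2.2

lemma measurePreserving_polar_plane :
    MeasurePreserving (fun p : ℝ × ℝ => p.1 • (Real.cos p.2, Real.sin p.2))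
      ((radial 1).prod arc) (volume : Measure (ℝ × ℝ)) := by
  refine (congrArg (fun f => MeasurePreserving f _ volume) ?_).mp measurePreserving_polarMap_plane
  ext p <;> simp [polarMap]

lemma measurePreserving_polar_space :
    MeasurePreserving (fun p : ℝ × (ℝ × ℝ) =>
        p.1 • (Real.cos p.2.1, Real.sin p.2.1 • (Real.cos p.2.2, Real.sin p.2.2)))
      ((radial 2).prod ((weighted 0 Real.pi fun t => Real.sin t ^ 1).prod arc))
      (volume : Measure (ℝ × (ℝ × ℝ))) :=
  measurePreserving_polar_succ (Ψ := fun t : ℝ => (Real.cos t, Real.sin t))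
    measurePreserving_polar_plane

lemma measurePreserving_spherical3 :
    MeasurePreserving (fun p : ℝ × (ℝ × ℝ) => p.1 • spherical3 p.2)
      ((radial 2).prod ((weighted 0 Real.pi fun t => Real.sin t ^ 1).prod arc)) volume := by
  refine (congrArg (fun f => MeasurePreserving f _ volume) ?_).mp
    (measurePreserving_vec3.comp measurePreserving_polar_space)
  ext1 p
  simp only [spherical3, Function.comp, ← vec3_smul]

lemma measurePreserving_spherical4 :
    MeasurePreserving (fun p : ℝ × (ℝ × (ℝ × ℝ)) => p.1 • spherical4 p.2)
      ((radial 3).prod ((weighted 0 Real.pi fun t => Real.sin t ^ 2).prod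
        ((weighted 0 Real.pi fun t => Real.sin t ^ 1).prod arc))) volume := by
  refine (congrArg (fun f => MeasurePreserving f _ volume) ?_).mp
    (measurePreserving_vec4.comp (measurePreserving_polar_succ (Ψ := fun ω : ℝ × ℝ =>
      (Real.cos ω.1, Real.sin ω.1 • (Real.cos ω.2, Real.sin ω.2)))
      measurePreserving_polar_space))
  ext1 p
  simp only [spherical4, Function.comp, ← vec4_smul]

lemma measurePreserving_hopf :
    MeasurePreserving (fun p : ℝ × (ℝ × (ℝ × ℝ)) => p.1 • hopf p.2)
      ((radial 3).prod ((weighted 0 (Real.pi / 2) fun t => Real.cos t * Real.sin t).prod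
        (arc.prod arc))) volume := by
  have h1 : MeasurePreserving (MeasurableEquiv.prodAssoc : (ℝ × ℝ) × (ℝ × ℝ) ≃ᵐ _) volume volume :=
    measurePreserving_prodAssoc _ _ _
  refine (congrArg (fun f => MeasurePreserving f _ volume) ?_).mp
    (measurePreserving_vec4.comp (h1.comp measurePreserving_polar_two_planes))
  ext1 p
  simp only [hopf, Function.comp, ← vec4_smul]
  rfl

lemma arc_real_univ : arc.real Set.univ = 2 * Real.pi := by
  have h := integral_weighted (a := -Real.pi) (b := Real.pi) (by linarith [Real.pi_pos])
    (w := fun _ => 1) continuous_const (by simp) fun _ => 1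
  simp only [integral_const, mul_one, smul_eq_mul, intervalIntegral.integral_const] at h
  rw [h]; ring

lemma integral_arc (f : ℝ → ℝ) : ∫ t, f t ∂arc = ∫ t in (-Real.pi)..Real.pi, f t := by
  simpa using integral_weighted (a := -Real.pi) (b := Real.pi) (by linarith [Real.pi_pos])
    (w := fun _ => 1) continuous_const (by simp) f

lemma integral_sinPow (k : ℕ) (f : ℝ → ℝ) :
    ∫ t, f t ∂(weighted 0 Real.pi fun t => Real.sin t ^ k) =
      ∫ t in (0)..Real.pi, Real.sin t ^ k * f t :=
  integral_weighted Real.pi_pos.le (by fun_prop)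
    (fun _ ht => pow_nonneg (Real.sin_pos_of_mem_Ioo ht).le _) f

lemma integral_quarter (f : ℝ → ℝ) :
    ∫ t, f t ∂(weighted 0 (Real.pi / 2) fun t => Real.cos t * Real.sin t) =
      ∫ t in (0)..(Real.pi / 2), Real.cos t * Real.sin t * f t :=
  integral_weighted (by linarith [Real.pi_pos]) (by fun_prop)
    (fun t ht => mul_nonneg
      (Real.cos_pos_of_mem_Ioo ⟨by linarith [Real.pi_pos, ht.1], ht.2⟩).le
      (Real.sin_pos_of_mem_Ioo ⟨ht.1, by linarith [Real.pi_pos, ht.2]⟩).le) f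

lemma real_univ_eq_integral {Θ : Type*} [MeasurableSpace Θ] (μ : Measure Θ) :
    μ.real Set.univ = ∫ _, (1 : ℝ) ∂μ := by simp

lemma ae_weighted_mem (a b : ℝ) {w : ℝ → ℝ} (hw : Continuous w) :
    ∀ᵐ t ∂weighted a b w, t ∈ Set.Ioo a b := by
  rw [weighted, ae_withDensity_iff (measurable_weighted_density a b hw)]
  refine Filter.Eventually.of_forall fun r hr => ?_
  by_contra h
  exact hr (Set.indicator_of_notMem (s := Set.Ioo a b) h _)

/-- The mean of a function over the unit sphere of `ℝⁿ`. -/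
noncomputable def sphereMean {n : ℕ} (F : EuclideanSpace ℝ (Fin n) → ℝ) : ℝ :=
  ∫ v, F (v : EuclideanSpace ℝ (Fin n)) ∂(uniformSphere (EuclideanSpace ℝ (Fin n)))

/-! ### Sphere means of functions with separated variables -/

section ProductFormulas

lemma finrank_three : Module.finrank ℝ (EuclideanSpace ℝ (Fin 3)) = 2 + 1 := by simp
lemma finrank_four : Module.finrank ℝ (EuclideanSpace ℝ (Fin 4)) = 3 + 1 := by simp

lemma integral_sin_pow_one : ∫ t in (0)..Real.pi, Real.sin t ^ 1 * 1 = 2 := by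
  simp only [pow_one, mul_one, integral_sin, Real.cos_zero, Real.cos_pi]; norm_num

lemma integral_sin_pow_two : ∫ t in (0)..Real.pi, Real.sin t ^ 2 * 1 = Real.pi / 2 := by
  simp [integral_sin_sq]

lemma integral_cos_mul_sin_quarter :
    ∫ t in (0)..(Real.pi / 2), Real.cos t * Real.sin t * 1 = 1 / 2 := by
  have := integral_sin_mul_cos₁ (a := 0) (b := Real.pi / 2)
  simp only [mul_one]
  simp_rw [mul_comm (Real.cos _)]
  rw [this]; simp

lemma mass_spherical3 :
    ((weighted 0 Real.pi fun t => Real.sin t ^ 1).prod arc).real Set.univ = 4 * Real.pi := by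
  rw [measureReal_def, ← Set.univ_prod_univ, Measure.prod_prod, ENNReal.toReal_mul,
    ← measureReal_def, ← measureReal_def, arc_real_univ, real_univ_eq_integral, integral_sinPow,
    integral_sin_pow_one]
  ring

lemma mass_spherical4 :
    ((weighted 0 Real.pi fun t => Real.sin t ^ 2).prod
      ((weighted 0 Real.pi fun t => Real.sin t ^ 1).prod arc)).real Set.univ =
      2 * Real.pi ^ 2 := by
  rw [measureReal_def, ← Set.univ_prod_univ, Measure.prod_prod, ENNReal.toReal_mul,
    ← measureReal_def, ← measureReal_def, mass_spherical3, real_univ_eq_integral, integral_sinPow,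
    integral_sin_pow_two]
  ring

lemma mass_hopf :
    ((weighted 0 (Real.pi / 2) fun t => Real.cos t * Real.sin t).prod
      (arc.prod arc)).real Set.univ = 2 * Real.pi ^ 2 := by
  rw [measureReal_def, ← Set.univ_prod_univ, Measure.prod_prod, ← Set.univ_prod_univ,
    Measure.prod_prod, ENNReal.toReal_mul, ENNReal.toReal_mul,
    ← measureReal_def, ← measureReal_def, arc_real_univ, real_univ_eq_integral, integral_quarter,
    integral_cos_mul_sin_quarter]
  ring

/-- Expectation over the unit sphere of `ℝ³` of a function with separated variables. -/
theorem integral_sphere3_of_prod {F : EuclideanSpace ℝ (Fin 3) → ℝ} (hF : Measurable F)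
    {B C : ℝ → ℝ} (h : ∀ θ ∈ Set.Ioo 0 Real.pi, ∀ φ, F (spherical3 (θ, φ)) = B θ * C φ) :
    sphereMean F =
      (4 * Real.pi)⁻¹ * ((∫ θ in (0)..Real.pi, Real.sin θ ^ 1 * B θ) *
        ∫ φ in (-Real.pi)..Real.pi, C φ) := by
  rw [sphereMean, integral_uniformSphere_eq continuous_spherical3.measurable norm_spherical3 finrank_three
    measurePreserving_spherical3 hF, mass_spherical3, ← integral_sinPow, ← integral_arc,
    ← integral_prod_mul]
  congr 1
  refine integral_congr_ae ?_
  filter_upwards [Measure.quasiMeasurePreserving_fst.ae (ae_weighted_mem 0 Real.pi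
    (w := fun t => Real.sin t ^ 1) (by fun_prop))] with p hp
  exact h p.1 hp p.2

/-- Expectation over the unit sphere of `ℝ⁴` of a function with separated variables. -/
theorem integral_sphere4_of_prod {F : EuclideanSpace ℝ (Fin 4) → ℝ} (hF : Measurable F)
    {A B C : ℝ → ℝ} (h : ∀ χ ∈ Set.Ioo 0 Real.pi, ∀ θ ∈ Set.Ioo 0 Real.pi, ∀ φ,
      F (spherical4 (χ, θ, φ)) = A χ * (B θ * C φ)) :
    sphereMean F =
      (2 * Real.pi ^ 2)⁻¹ * ((∫ χ in (0)..Real.pi, Real.sin χ ^ 2 * A χ) *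
        ((∫ θ in (0)..Real.pi, Real.sin θ ^ 1 * B θ) * ∫ φ in (-Real.pi)..Real.pi, C φ)) := by
  rw [sphereMean, integral_uniformSphere_eq continuous_spherical4.measurable norm_spherical4 finrank_four
    measurePreserving_spherical4 hF, mass_spherical4, ← integral_sinPow, ← integral_sinPow,
    ← integral_arc, ← integral_prod_mul, ← integral_prod_mul]
  congr 1
  refine integral_congr_ae ?_
  filter_upwards [Measure.quasiMeasurePreserving_fst.ae (ae_weighted_mem 0 Real.pi
    (w := fun t => Real.sin t ^ 2) (by fun_prop)),
    Measure.quasiMeasurePreserving_snd.ae (Measure.quasiMeasurePreserving_fst.ae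
      (ae_weighted_mem 0 Real.pi (w := fun t => Real.sin t ^ 1) (by fun_prop)))] with p hp hp'
  exact h p.1 hp p.2.1 hp' p.2.2

/-- Reduction of an expectation over the unit sphere of `ℝ⁴` to one over that of `ℝ³`. -/
theorem integral_sphere4_of_sphere3 {F : EuclideanSpace ℝ (Fin 4) → ℝ} (hF : Measurable F)
    {A : ℝ → ℝ} {G : EuclideanSpace ℝ (Fin 3) → ℝ} (hG : Measurable G)
    (h : ∀ χ ∈ Set.Ioo 0 Real.pi, ∀ ω, F (spherical4 (χ, ω)) = A χ * G (spherical3 ω)) :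
    sphereMean F =
      2 / Real.pi * ((∫ χ in (0)..Real.pi, Real.sin χ ^ 2 * A χ) *
        sphereMean G) := by
  rw [sphereMean, integral_uniformSphere_eq continuous_spherical4.measurable norm_spherical4 finrank_four
    measurePreserving_spherical4 hF, mass_spherical4,
    sphereMean, integral_uniformSphere_eq continuous_spherical3.measurable norm_spherical3 finrank_three
    measurePreserving_spherical3 hG, mass_spherical3, ← integral_sinPow]
  have : ∫ ω, F (spherical4 ω) ∂((weighted 0 Real.pi fun t => Real.sin t ^ 2).prod
      ((weighted 0 Real.pi fun t => Real.sin t ^ 1).prod arc)) =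
      (∫ χ, A χ ∂(weighted 0 Real.pi fun t => Real.sin t ^ 2)) *
        ∫ ω, G (spherical3 ω) ∂((weighted 0 Real.pi fun t => Real.sin t ^ 1).prod arc) := by
    rw [← integral_prod_mul]
    refine integral_congr_ae ?_
    filter_upwards [Measure.quasiMeasurePreserving_fst.ae (ae_weighted_mem 0 Real.pi
      (w := fun t => Real.sin t ^ 2) (by fun_prop))] with p hp
    exact h p.1 hp p.2
  rw [this]
  field_simp
  ring

end ProductFormulas

/-! ### Trigonometric integrals -/

section Trig

lemma integral_zero_pi_symm {g : ℝ → ℝ} (hg : Continuous g) (hs : ∀ t, g (Real.pi - t) = g t) :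
    ∫ t in (0)..Real.pi, g t = 2 * ∫ t in (0)..(Real.pi / 2), g t := by
  rw [← intervalIntegral.integral_add_adjacent_intervals (b := Real.pi / 2)
    (hg.intervalIntegrable _ _) (hg.intervalIntegrable _ _)]
  have : ∫ t in (Real.pi / 2)..Real.pi, g t = ∫ t in (0)..(Real.pi / 2), g t := by
    have h := intervalIntegral.integral_comp_sub_left g (a := 0) (b := Real.pi / 2) Real.pi
    rw [sub_zero, sub_half] at h
    rw [← h]
    simp only [hs]
  rw [this]; ring

lemma integral_neg_pi_pi_symm {g : ℝ → ℝ} (hg : Continuous g) (hn : ∀ t, g (-t) = g t)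
    (hs : ∀ t, g (Real.pi - t) = g t) :
    ∫ t in (-Real.pi)..Real.pi, g t = 4 * ∫ t in (0)..(Real.pi / 2), g t := by
  rw [← intervalIntegral.integral_add_adjacent_intervals (b := 0)
    (hg.intervalIntegrable _ _) (hg.intervalIntegrable _ _)]
  have : ∫ t in (-Real.pi)..0, g t = ∫ t in (0)..Real.pi, g t := by
    have h := intervalIntegral.integral_comp_neg g (a := 0) (b := Real.pi)
    rw [neg_zero] at h
    rw [← h]
    simp only [hn]
  rw [this, integral_zero_pi_symm hg hs]; ring

lemma integral_sin_pow_mul_abs_cos (n : ℕ) :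
    ∫ t in (0)..Real.pi, Real.sin t ^ n * |Real.cos t| = 2 / (n + 1) := by
  rw [integral_zero_pi_symm (by fun_prop) (by simp)]
  have : ∫ t in (0)..(Real.pi / 2), Real.sin t ^ n * |Real.cos t| =
      -- The exponent `1` is written as `2 * 0 + 1` to match the formula for odd powers of the
      -- cosine.
      ∫ t in (0)..(Real.pi / 2), Real.sin t ^ n * Real.cos t ^ (2 * 0 + 1) := by
    refine intervalIntegral.integral_congr fun t ht => ?_
    rw [Set.uIcc_of_le (by positivity)] at ht
    simp only [mul_zero, zero_add, pow_one]
    rw [abs_of_nonneg (Real.cos_nonneg_of_mem_Icc ⟨by linarith [ht.1, Real.pi_pos], ht.2⟩)]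
  rw [this, integral_sin_pow_mul_cos_pow_odd]
  simp
  ring

lemma integral_abs_cos : ∫ t in (-Real.pi)..Real.pi, |Real.cos t| = 4 := by
  rw [integral_neg_pi_pi_symm (by fun_prop) (by simp) (by simp)]
  have h := integral_sin_pow_mul_abs_cos 0
  rw [integral_zero_pi_symm (by fun_prop) (by simp)] at h
  simp only [pow_zero, one_mul] at h
  norm_num at h
  linarith

/-- `∫₀^π sin^(2m) cos^(2k) / π`. -/
def evenMoment (m k : ℕ) : ℚ :=
  (∏ i ∈ Finset.range m, (2 * i + 1 : ℚ)) * (∏ i ∈ Finset.range k, (2 * i + 1 : ℚ)) /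
    ∏ i ∈ Finset.range (m + k), (2 * i + 2 : ℚ)

/-- `∫₀^π sin^(2m+1) cos^(2k)`. -/
def oddMoment (m k : ℕ) : ℚ :=
  2 * (∏ i ∈ Finset.range m, (2 * i + 2 : ℚ)) / ∏ i ∈ Finset.range (m + 1), (2 * k + 2 * i + 1 : ℚ)

/-- This mirrors `cos² = 1 - sin²` under the integral, and is the induction step for
`integral_sin_even_cos_even`, which starts from the Wallis formula. -/
lemma evenMoment_succ (m k : ℕ) :
    evenMoment m (k + 1) = evenMoment m k - evenMoment (m + 1) k := by
  unfold evenMoment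
  have h : ∏ i ∈ Finset.range (m + k), (2 * i + 2 : ℚ) ≠ 0 :=
    Finset.prod_ne_zero_iff.2 fun i _ => by positivity
  rw [show m + (k + 1) = m + k + 1 by ring, show m + 1 + k = m + k + 1 by ring]
  simp only [Finset.prod_range_succ]
  field_simp
  push_cast
  ring

/-- The counterpart for `sin² = 1 - cos²`, used to lower the odd power of the sine. -/
lemma oddMoment_succ (m k : ℕ) :
    oddMoment (m + 1) k = oddMoment m k - oddMoment m (k + 1) := by
  unfold oddMoment
  have h : ∏ i ∈ Finset.range m, (2 * k + 2 * (i + 1 : ℕ) + 1 : ℚ) ≠ 0 :=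
    Finset.prod_ne_zero_iff.2 fun i _ => by positivity
  have e : ∀ n : ℕ, ∏ i ∈ Finset.range n, (2 * (k + 1 : ℕ) + 2 * i + 1 : ℚ) =
      ∏ i ∈ Finset.range n, (2 * k + 2 * (i + 1 : ℕ) + 1 : ℚ) := fun n =>
    Finset.prod_congr rfl fun i _ => by push_cast; ring
  rw [e (m + 1), Finset.prod_range_succ' (fun i : ℕ => (2 * k + 2 * i + 1 : ℚ)) (m + 1),
    Finset.prod_range_succ' (fun i : ℕ => (2 * k + 2 * i + 1 : ℚ)) m]
  simp only [Finset.prod_range_succ]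
  field_simp
  push_cast
  ring

lemma integral_sin_even_cos_even (m k : ℕ) :
    ∫ t in (0)..Real.pi, Real.sin t ^ (2 * m) * Real.cos t ^ (2 * k) =
      Real.pi * (evenMoment m k : ℝ) := by
  induction k generalizing m with
  | zero =>
    simp only [mul_zero, pow_zero, mul_one, integral_sin_pow_even, evenMoment]
    push_cast
    simp [Finset.prod_div_distrib]
  | succ k ih =>
    rw [evenMoment_succ]
    push_cast
    rw [mul_sub, ← ih, ← ih, ← intervalIntegral.integral_sub
      (Continuous.intervalIntegrable (by fun_prop) _ _)
      (Continuous.intervalIntegrable (by fun_prop) _ _)]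
    refine intervalIntegral.integral_congr fun t _ => ?_
    have := Real.sin_sq_add_cos_sq t
    simp only [mul_add, mul_one, pow_add]
    rw [Real.cos_sq']
    ring

lemma integral_sin_odd_cos_even (m k : ℕ) :
    ∫ t in (0)..Real.pi, Real.sin t ^ (2 * m + 1) * Real.cos t ^ (2 * k) = (oddMoment m k : ℝ) := by
  induction m generalizing k with
  | zero =>
    rw [integral_sin_pow_odd_mul_cos_pow]
    simp only [oddMoment, Finset.prod_range_zero, zero_add, Finset.prod_range_one, pow_zero, mul_one,
      Real.cos_pi, Real.cos_zero, integral_pow]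
    push_cast
    rw [Odd.neg_one_pow ⟨k, rfl⟩]
    simp
    norm_num
  | succ m ih =>
    rw [oddMoment_succ]
    push_cast
    rw [← ih, ← ih, ← intervalIntegral.integral_sub
      (Continuous.intervalIntegrable (by fun_prop) _ _)
      (Continuous.intervalIntegrable (by fun_prop) _ _)]
    refine intervalIntegral.integral_congr fun t _ => ?_
    simp only [mul_add, mul_one, pow_add]
    rw [Real.sin_sq]
    ring

lemma integral_cos_even (k : ℕ) :
    ∫ t in (-Real.pi)..Real.pi, Real.cos t ^ (2 * k) = 2 * Real.pi * (evenMoment 0 k : ℝ) := by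
  have h := integral_sin_even_cos_even 0 k
  have hs : ∀ t, Real.cos (Real.pi - t) ^ (2 * k) = Real.cos t ^ (2 * k) := fun t => by
    rw [Real.cos_pi_sub, Even.neg_pow ⟨k, by ring⟩]
  simp only [mul_zero, pow_zero, one_mul] at h
  rw [integral_zero_pi_symm (by fun_prop) hs] at h
  rw [integral_neg_pi_pi_symm (by fun_prop) (by simp) hs]
  linarith

end Trig

/-! ### Closed-form moments on the spheres -/

/-- Invariance under permutations of the coordinates. -/
lemma sphereMean_perm {n : ℕ} (σ : Equiv.Perm (Fin n)) {F : EuclideanSpace ℝ (Fin n) → ℝ}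
    (hF : Measurable F) :
    sphereMean (fun u => F (WithLp.toLp 2 fun i => u (σ i))) = sphereMean F := by
  have h := integral_uniformSphere_comp (E := EuclideanSpace ℝ (Fin n))
    (E' := EuclideanSpace ℝ (Fin n)) (LinearIsometryEquiv.piLpCongrLeft 2 ℝ ℝ σ.symm) hF
  refine Eq.trans ?_ h
  unfold sphereMean
  congr 1

section Moments

lemma spherical4_zero (χ θ φ : ℝ) : spherical4 (χ, θ, φ) 0 = Real.cos χ := rfl
lemma spherical4_one (χ θ φ : ℝ) : spherical4 (χ, θ, φ) 1 = Real.sin χ * Real.cos θ := rfl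
lemma spherical4_two (χ θ φ : ℝ) :
    spherical4 (χ, θ, φ) 2 = Real.sin χ * (Real.sin θ * Real.cos φ) := rfl
lemma spherical4_three (χ θ φ : ℝ) :
    spherical4 (χ, θ, φ) 3 = Real.sin χ * (Real.sin θ * Real.sin φ) := rfl
lemma spherical3_zero (θ φ : ℝ) : spherical3 (θ, φ) 0 = Real.cos θ := rfl
lemma spherical3_one (θ φ : ℝ) : spherical3 (θ, φ) 1 = Real.sin θ * Real.cos φ := rfl

lemma sqrt_one_sub_cos_sq {χ : ℝ} (h : χ ∈ Set.Ioo 0 Real.pi) :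
    √(1 - Real.cos χ ^ 2) = Real.sin χ := by
  rw [← Real.sin_sq, Real.sqrt_sq (Real.sin_pos_of_mem_Ioo h).le]

/-- Iterated spherical coordinates make the roots for the pair `{2, 3}` and for the single index `0`
monomials in sines. These indices are therefore the representatives in the moments below; all others
follow by permutation. -/
lemma sqrt_spherical4_two_three {χ θ : ℝ} (h : χ ∈ Set.Ioo 0 Real.pi) (h' : θ ∈ Set.Ioo 0 Real.pi)
    (φ : ℝ) : √(spherical4 (χ, θ, φ) 2 ^ 2 + spherical4 (χ, θ, φ) 3 ^ 2) =
      Real.sin χ * Real.sin θ := by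
  rw [spherical4_two, spherical4_three, show (Real.sin χ * (Real.sin θ * Real.cos φ)) ^ 2 +
    (Real.sin χ * (Real.sin θ * Real.sin φ)) ^ 2 = (Real.sin χ * Real.sin θ) ^ 2 by
      linear_combination (Real.sin χ * Real.sin θ) ^ 2 * Real.sin_sq_add_cos_sq φ]
  exact Real.sqrt_sq (mul_nonneg (Real.sin_pos_of_mem_Ioo h).le (Real.sin_pos_of_mem_Ioo h').le)

lemma integral_sin_pow_three' : ∫ t in (0)..Real.pi, Real.sin t ^ 3 = 4 / 3 := by
  rw [integral_sin_pow_three]; norm_num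

lemma integral_sin_pow_four : ∫ t in (0)..Real.pi, Real.sin t ^ 4 = 3 * Real.pi / 8 := by
  have := integral_sin_pow_even 2
  norm_num [Finset.prod_range_succ] at this
  rw [this]; ring

lemma integral_one_arc : ∫ _ in (-Real.pi)..Real.pi, (1 : ℝ) = 2 * Real.pi := by
  simp; ring

lemma sphereMean_abs : sphereMean (fun u : EuclideanSpace ℝ (Fin 4) => |u 0|) =
    4 / (3 * Real.pi) := by
  refine (integral_sphere4_of_prod (A := fun t => |Real.cos t|) (B := fun _ => 1)
    (C := fun _ => 1) (by fun_prop) (by intro χ hχ θ hθ φ; simp [spherical4_zero])).trans ?_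
  rw [integral_sin_pow_mul_abs_cos, integral_sin_pow_one, integral_one_arc]
  have := Real.pi_pos; field_simp; norm_num

lemma sphereMean_abs_mul_abs : sphereMean (fun u : EuclideanSpace ℝ (Fin 4) => |u 0| * |u 1|) =
    1 / (2 * Real.pi) := by
  refine (integral_sphere4_of_prod (A := fun t => Real.sin t * |Real.cos t|)
    (B := fun t => |Real.cos t|) (C := fun _ => 1) (by fun_prop) (by
      intro χ hχ θ hθ φ
      rw [spherical4_zero, spherical4_one, abs_mul, abs_of_pos (Real.sin_pos_of_mem_Ioo hχ)]
      ring)).trans ?_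
  simp only [← mul_assoc, ← pow_succ, integral_sin_pow_mul_abs_cos, integral_one_arc]
  have := Real.pi_pos; field_simp; norm_num

lemma sphereMean_sqrt_add : sphereMean (fun u : EuclideanSpace ℝ (Fin 4) =>
    √(u 2 ^ 2 + u 3 ^ 2)) = 2 / 3 := by
  refine (integral_sphere4_of_prod (A := fun t => Real.sin t)
    (B := fun t => Real.sin t) (C := fun _ => 1) (by fun_prop) (by
      intro χ hχ θ hθ φ
      rw [sqrt_spherical4_two_three hχ hθ]
      ring)).trans ?_
  simp only [← pow_succ, integral_sin_pow_three', integral_one_arc, Nat.reduceAdd, integral_sin_sq]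
  have := Real.pi_pos; simp; field_simp; norm_num

lemma sphereMean_sqrt_one_sub : sphereMean (fun u : EuclideanSpace ℝ (Fin 4) =>
    √(1 - u 0 ^ 2)) = 8 / (3 * Real.pi) := by
  refine (integral_sphere4_of_prod (A := fun t => Real.sin t)
    (B := fun t => 1) (C := fun _ => 1) (by fun_prop) (by
      intro χ hχ θ hθ φ
      rw [spherical4_zero, sqrt_one_sub_cos_sq hχ]
      ring)).trans ?_
  rw [integral_sin_pow_one]
  simp only [← pow_succ, integral_sin_pow_three', integral_one_arc, Nat.reduceAdd]
  have := Real.pi_pos; field_simp; norm_num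

lemma sphereMean_abs_mul_sqrt_add_self : sphereMean (fun u : EuclideanSpace ℝ (Fin 4) =>
    |u 2| * √(u 2 ^ 2 + u 3 ^ 2)) = 1 / Real.pi := by
  refine (integral_sphere4_of_prod (A := fun t => Real.sin t ^ 2)
    (B := fun t => Real.sin t ^ 2) (C := fun t => |Real.cos t|) (by fun_prop) (by
      intro χ hχ θ hθ φ
      rw [sqrt_spherical4_two_three hχ hθ, spherical4_two, abs_mul, abs_mul,
        abs_of_pos (Real.sin_pos_of_mem_Ioo hχ), abs_of_pos (Real.sin_pos_of_mem_Ioo hθ)]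
      ring)).trans ?_
  simp only [← pow_add, integral_sin_pow_three', integral_sin_pow_four, integral_abs_cos,
    Nat.reduceAdd]
  have := Real.pi_pos; field_simp; norm_num

lemma sphereMean_abs_mul_sqrt_add : sphereMean (fun u : EuclideanSpace ℝ (Fin 4) =>
    |u 0| * √(u 2 ^ 2 + u 3 ^ 2)) = 1 / 4 := by
  refine (integral_sphere4_of_prod (A := fun t => Real.sin t * |Real.cos t|)
    (B := fun t => Real.sin t) (C := fun t => 1) (by fun_prop) (by
      intro χ hχ θ hθ φ
      rw [sqrt_spherical4_two_three hχ hθ, spherical4_zero]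
      ring)).trans ?_
  simp only [← mul_assoc, ← pow_succ, integral_sin_pow_mul_abs_cos, integral_one_arc,
    Nat.reduceAdd, integral_sin_sq]
  have := Real.pi_pos; simp; field_simp; norm_num

lemma sphereMean_abs_mul_sqrt_one_sub_self : sphereMean (fun u : EuclideanSpace ℝ (Fin 4) =>
    |u 0| * √(1 - u 0 ^ 2)) = 1 / Real.pi := by
  refine (integral_sphere4_of_prod (A := fun t => Real.sin t * |Real.cos t|)
    (B := fun t => 1) (C := fun t => 1) (by fun_prop) (by
      intro χ hχ θ hθ φ
      rw [spherical4_zero, sqrt_one_sub_cos_sq hχ]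
      ring)).trans ?_
  rw [integral_sin_pow_one]
  simp only [← mul_assoc, ← pow_succ, integral_sin_pow_mul_abs_cos, integral_one_arc]
  have := Real.pi_pos; field_simp; norm_num

lemma sphereMean_abs_mul_sqrt_one_sub : sphereMean (fun u : EuclideanSpace ℝ (Fin 4) =>
    |u 1| * √(1 - u 0 ^ 2)) = 3 / 8 := by
  refine (integral_sphere4_of_prod (A := fun t => Real.sin t ^ 2)
    (B := fun t => |Real.cos t|) (C := fun t => 1) (by fun_prop) (by
      intro χ hχ θ hθ φ
      rw [spherical4_zero, sqrt_one_sub_cos_sq hχ, spherical4_one, abs_mul,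
        abs_of_pos (Real.sin_pos_of_mem_Ioo hχ)]
      ring)).trans ?_
  simp only [← pow_add, integral_sin_pow_mul_abs_cos, integral_one_arc, integral_sin_pow_four,
    Nat.reduceAdd]
  have := Real.pi_pos; field_simp; norm_num

lemma sphereMean_sqrt_add_mul_sqrt_one_sub : sphereMean (fun u : EuclideanSpace ℝ (Fin 4) =>
    √(u 2 ^ 2 + u 3 ^ 2) * √(1 - u 0 ^ 2)) = 3 * Real.pi / 16 := by
  refine (integral_sphere4_of_prod (A := fun t => Real.sin t ^ 2)
    (B := fun t => Real.sin t) (C := fun t => 1) (by fun_prop) (by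
      intro χ hχ θ hθ φ
      rw [sqrt_spherical4_two_three hχ hθ, spherical4_zero, sqrt_one_sub_cos_sq hχ]
      ring)).trans ?_
  simp only [← pow_add, ← pow_succ, integral_one_arc, integral_sin_pow_four,
    Nat.reduceAdd, integral_sin_sq]
  have := Real.pi_pos; simp; field_simp; norm_num

/-- Together with `sphereMean_sqrt_one_sub_mul_even` and the two analogues on the 2-sphere, this
supplies every moment needed for the Taylor enclosure. The values are rational up to a power of `π`.
-/
lemma sphereMean_even_mul_even (k l : ℕ) : sphereMean (fun u : EuclideanSpace ℝ (Fin 4) =>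
    u 0 ^ (2 * k) * u 1 ^ (2 * l)) = (evenMoment (l + 1) k * (2 / (2 * l + 1)) : ℚ) := by
  refine (integral_sphere4_of_prod
    (A := fun t => Real.sin t ^ (2 * l) * Real.cos t ^ (2 * k))
    (B := fun t => Real.cos t ^ (2 * l)) (C := fun t => 1) (by fun_prop) (by
      intro χ hχ θ hθ φ
      rw [spherical4_zero, spherical4_one]
      ring)).trans ?_
  rw [integral_one_arc]
  have h := integral_sin_odd_cos_even 0 l
  rw [mul_zero, zero_add] at h
  simp only [← mul_assoc, ← pow_add, h]
  rw [show 2 + 2 * l = 2 * (l + 1) by ring, integral_sin_even_cos_even]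
  have := Real.pi_pos
  have e : oddMoment 0 l = 2 / (2 * l + 1) := by simp [oddMoment]
  rw [e]; push_cast; field_simp

lemma sphereMean_sqrt_one_sub_mul_even (k : ℕ) : sphereMean (fun u : EuclideanSpace ℝ (Fin 4) =>
    √(1 - u 0 ^ 2) * u 1 ^ (2 * k)) =
      (oddMoment (k + 1) 0 * (2 / (2 * k + 1)) : ℚ) / Real.pi := by
  refine (integral_sphere4_of_prod
    -- The trivial factor `cos ^ (2 * 0)` puts the integrand in the form of
    -- `integral_sin_odd_cos_even`.
    (A := fun t => Real.sin t ^ (2 * k + 1) * Real.cos t ^ (2 * 0))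
    (B := fun t => Real.cos t ^ (2 * k)) (C := fun t => 1) (by fun_prop) (by
      intro χ hχ θ hθ φ
      rw [spherical4_zero, spherical4_one, sqrt_one_sub_cos_sq hχ]
      ring)).trans ?_
  rw [integral_one_arc]
  have h := integral_sin_odd_cos_even 0 k
  rw [mul_zero, zero_add] at h
  rw [h]
  simp only [← mul_assoc, ← pow_add]
  rw [show 2 + (2 * k + 1) = 2 * (k + 1) + 1 by ring, integral_sin_odd_cos_even]
  have := Real.pi_pos
  have e : oddMoment 0 k = 2 / (2 * k + 1) := by simp [oddMoment]
  rw [e]; push_cast; field_simp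

lemma sphereMean3_even_mul_even (k l : ℕ) : sphereMean (fun u : EuclideanSpace ℝ (Fin 3) =>
    u 0 ^ (2 * k) * u 1 ^ (2 * l)) = (oddMoment l k * evenMoment 0 l / 2 : ℚ) := by
  refine (integral_sphere3_of_prod
    (B := fun t => Real.sin t ^ (2 * l) * Real.cos t ^ (2 * k))
    (C := fun t => Real.cos t ^ (2 * l)) (by fun_prop) (by
      intro θ hθ φ
      rw [spherical3_zero, spherical3_one]
      ring)).trans ?_
  rw [integral_cos_even]
  simp only [← mul_assoc, ← pow_add]
  rw [show 1 + 2 * l = 2 * l + 1 by ring, integral_sin_odd_cos_even]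
  have := Real.pi_pos
  push_cast; field_simp; norm_num [mul_comm]

lemma sphereMean3_sqrt_one_sub_mul_even (k : ℕ) : sphereMean (fun u : EuclideanSpace ℝ (Fin 3) =>
    √(1 - u 0 ^ 2) * u 1 ^ (2 * k)) =
      (evenMoment (k + 1) 0 * evenMoment 0 k / 2 : ℚ) * Real.pi := by
  refine (integral_sphere3_of_prod
    (B := fun t => Real.sin t ^ (2 * k + 1) * Real.cos t ^ (2 * 0))
    (C := fun t => Real.cos t ^ (2 * k)) (by fun_prop) (by
      intro θ hθ φ
      rw [spherical3_zero, spherical3_one, sqrt_one_sub_cos_sq hθ]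
      ring)).trans ?_
  rw [integral_cos_even]
  simp only [← mul_assoc, ← pow_add]
  rw [show 1 + (2 * k + 1) = 2 * (k + 1) by ring, integral_sin_even_cos_even]
  have := Real.pi_pos
  push_cast; field_simp; norm_num [mul_comm]

end Moments

/-! ### Catalan's constant as an integral -/

section Catalan

lemma integral_Ioo_pow (n : ℕ) : ∫ t in Set.Ioo (0 : ℝ) 1, t ^ n = 1 / (n + 1) := by
  rw [← integral_Ioc_eq_integral_Ioo, ← intervalIntegral.integral_of_le zero_le_one, integral_pow]
  simp

lemma summable_one_div_odd_sq : Summable fun k : ℕ => 1 / (2 * (k : ℝ) + 1) ^ 2 := by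
  have h := (Real.summable_one_div_nat_pow (p := 2)).2 one_lt_two
  have h2 : Function.Injective fun k : ℕ => 2 * k + 1 := fun a b hab => by simpa using hab
  refine (h.comp_injective h2).congr fun k => ?_
  simp

/-- The arctangent series divided by `t` is integrated term by term; the `L¹` norms of the terms are
`1 / (2k + 1)²`, hence summable. -/
lemma integral_arctan_div : ∫ t in Set.Ioo (0 : ℝ) 1, Real.arctan t / t = catalanConst := by
  have hint : ∀ k : ℕ, IntegrableOn (fun t : ℝ => (-1 : ℝ) ^ k * t ^ (2 * k) / (2 * k + 1))
      (Set.Ioo 0 1) := fun k =>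
    (Continuous.integrableOn_Icc (a := 0) (b := 1) (by fun_prop)).mono_set Set.Ioo_subset_Icc_self
  have hval : ∀ k : ℕ, ∫ t in Set.Ioo (0 : ℝ) 1, (-1 : ℝ) ^ k * t ^ (2 * k) / (2 * k + 1) =
      (-1 : ℝ) ^ k / (2 * (k : ℝ) + 1) ^ 2 := fun k => by
    have e : ∀ t : ℝ, (-1 : ℝ) ^ k * t ^ (2 * k) / (2 * k + 1) =
      ((-1 : ℝ) ^ k / (2 * k + 1)) * t ^ (2 * k) := fun t => by ring
    simp_rw [e]
    rw [integral_const_mul, integral_Ioo_pow]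
    push_cast
    field_simp
  have hnorm : ∀ k : ℕ, ∫ t in Set.Ioo (0 : ℝ) 1, ‖(-1 : ℝ) ^ k * t ^ (2 * k) / (2 * k + 1)‖ =
      1 / (2 * (k : ℝ) + 1) ^ 2 := fun k => by
    have e : ∀ t : ℝ, ‖(-1 : ℝ) ^ k * t ^ (2 * k) / (2 * k + 1)‖ =
      (1 / (2 * k + 1)) * t ^ (2 * k) := fun t => by
      rw [norm_div, norm_mul, norm_pow, norm_neg, norm_one, one_pow, one_mul, Real.norm_eq_abs,
        Real.norm_eq_abs, abs_of_nonneg (by rw [pow_mul]; positivity),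
        abs_of_pos (by positivity : (0 : ℝ) < 2 * k + 1)]
      ring
    simp_rw [e]
    rw [integral_const_mul, integral_Ioo_pow]
    push_cast
    field_simp
  have h := hasSum_integral_of_summable_integral_norm hint
    (by simp_rw [hnorm]; exact summable_one_div_odd_sq)
  simp_rw [hval] at h
  rw [catalanConst, h.tsum_eq]
  refine setIntegral_congr_fun measurableSet_Ioo fun t ht => ?_
  have ha := (Real.hasSum_arctan (x := t) (by rw [Real.norm_of_nonneg ht.1.le]; exact ht.2)).div_const t
  rw [← ha.tsum_eq]
  refine tsum_congr fun k => ?_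
  have := ht.1.ne'
  push_cast
  field_simp
  ring

lemma image_two_arctan : (fun t => 2 * Real.arctan t) '' Set.Ioo 0 1 = Set.Ioo 0 (Real.pi / 2) := by
  ext x
  constructor
  · rintro ⟨t, ht, rfl⟩
    have h1 := Real.arctan_strictMono ht.1
    have h2 := Real.arctan_strictMono ht.2
    rw [Real.arctan_zero] at h1
    rw [Real.arctan_one] at h2
    exact ⟨by simp only; linarith, by simp only; linarith⟩
  · intro hx
    refine ⟨Real.tan (x / 2), ⟨Real.tan_pos_of_pos_of_lt_pi_div_two (by linarith [hx.1])
      (by linarith [hx.2, Real.pi_pos]), ?_⟩, ?_⟩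
    · rw [← Real.tan_pi_div_four]
      exact Real.tan_lt_tan_of_lt_of_lt_pi_div_two (by linarith [hx.1, Real.pi_pos])
        (by linarith [Real.pi_pos]) (by linarith [hx.2])
    · simp only
      rw [Real.arctan_tan (by linarith [hx.1, Real.pi_pos]) (by linarith [hx.2, Real.pi_pos])]
      ring

/-- The substitution `x = 2 arctan t` turns `x / sin x dx` into `2 arctan t / t dt`. Writing the
integrand with `sinc` keeps it continuous at `0`. -/
lemma integral_inv_sinc : ∫ x in (0)..(Real.pi / 2), (Real.sinc x)⁻¹ = 2 * catalanConst := by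
  rw [intervalIntegral.integral_of_le (by positivity), integral_Ioc_eq_integral_Ioo,
    ← image_two_arctan, integral_image_eq_integral_abs_deriv_smul (f' := fun t => 2 * (1 / (1 + t ^ 2)))
      measurableSet_Ioo (fun x _ => ((Real.hasDerivAt_arctan x).const_mul 2).hasDerivWithinAt)
      (fun a _ b _ hab => Real.arctan_injective (by simpa using hab)),
    ← integral_arctan_div, ← integral_const_mul]
  refine setIntegral_congr_fun measurableSet_Ioo fun t ht => ?_
  have h0 := ht.1.ne'
  have h1 : Real.arctan t ≠ 0 := by simpa using h0
  have hs : Real.sin (2 * Real.arctan t) = 2 * t / (1 + t ^ 2) := by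
    rw [Real.sin_two_mul, Real.sin_arctan, Real.cos_arctan]
    have := Real.sq_sqrt (show 0 ≤ 1 + t ^ 2 by positivity)
    have h2 : 0 < √(1 + t ^ 2) := Real.sqrt_pos.2 (by positivity)
    field_simp
    rw [this]
  simp only [smul_eq_mul]
  rw [Real.sinc_of_ne_zero (by simpa using h0), hs, abs_of_pos (by positivity)]
  field_simp

/-- `∫₀^x sin² cos²`. -/
noncomputable def quarticPrimitive (x : ℝ) : ℝ := x / 8 - Real.sin (4 * x) / 32

lemma hasDerivAt_quarticPrimitive (x : ℝ) :
    HasDerivAt quarticPrimitive (Real.sin x ^ 2 * Real.cos x ^ 2) x := by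
  have h := ((hasDerivAt_id x).div_const 8).sub
    ((((hasDerivAt_id x).const_mul 4).sin).div_const 32)
  refine h.congr_deriv ?_
  have h1 : Real.cos (4 * x) = 2 * (2 * Real.cos x ^ 2 - 1) ^ 2 - 1 := by
    rw [show 4 * x = 2 * (2 * x) by ring, Real.cos_two_mul, Real.cos_two_mul]
  simp only [id, h1, Real.sin_sq]
  ring

/-- The inner integral, as a function of the remaining angle. -/
noncomputable def innerIntegral (φ : ℝ) : ℝ :=
  ∫ α in (0)..(Real.pi / 2), Real.cos α * Real.sin α *
    (Real.cos α * √(1 - Real.cos α ^ 2 * Real.sin φ ^ 2))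

lemma continuous_innerIntegral : Continuous innerIntegral :=
  intervalIntegral.continuous_parametric_intervalIntegral_of_continuous' (by fun_prop) _ _

/-- The substitution `sin y = cos α sin φ` reduces the integral to `∫₀^φ sin² y cos² y dy / sin³ φ`.
Since `0 < sin φ < 1`, the argument of `arcsin` stays inside `(-1, 1)`, where it is differentiable.
-/
lemma innerIntegral_eq {φ : ℝ} (h : φ ∈ Set.Ioo 0 (Real.pi / 2)) :
    innerIntegral φ = quarticPrimitive φ / Real.sin φ ^ 3 := by
  have hs : 0 < Real.sin φ := Real.sin_pos_of_mem_Ioo ⟨h.1, by linarith [h.2, Real.pi_pos]⟩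
  have hs1 : Real.sin φ < 1 := by
    rw [← Real.sin_pi_div_two]
    exact Real.sin_lt_sin_of_lt_of_le_pi_div_two (by linarith [h.1, Real.pi_pos]) le_rfl h.2
  have hder : ∀ α ∈ Set.uIcc 0 (Real.pi / 2), HasDerivAt
      (fun α => -(quarticPrimitive (Real.arcsin (Real.cos α * Real.sin φ)) / Real.sin φ ^ 3))
      (Real.cos α * Real.sin α * (Real.cos α * √(1 - Real.cos α ^ 2 * Real.sin φ ^ 2))) α := by
    intro α _
    have hlt : |Real.cos α * Real.sin φ| < 1 := by
      rw [abs_mul, abs_of_pos hs]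
      nlinarith [Real.abs_cos_le_one α, abs_nonneg (Real.cos α)]
    obtain ⟨h1, h2⟩ := abs_lt.1 hlt
    have hd := ((((hasDerivAt_quarticPrimitive _).comp _
      (Real.hasDerivAt_arcsin h1.ne' h2.ne)).comp α
        ((Real.hasDerivAt_cos α).mul_const (Real.sin φ))).div_const (Real.sin φ ^ 3)).neg
    refine hd.congr_deriv ?_
    rw [Real.sin_arcsin h1.le h2.le, Real.cos_arcsin]
    have hpos : 0 < 1 - (Real.cos α * Real.sin φ) ^ 2 := by nlinarith
    have hq := Real.sqrt_pos.2 hpos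
    have hq2 := Real.sq_sqrt hpos.le
    rw [show Real.cos α ^ 2 * Real.sin φ ^ 2 = (Real.cos α * Real.sin φ) ^ 2 by ring]
    field_simp
  rw [innerIntegral, intervalIntegral.integral_eq_sub_of_hasDerivAt hder
    (Continuous.intervalIntegrable (by fun_prop) _ _)]
  rw [Real.cos_pi_div_two, Real.cos_zero, zero_mul, one_mul, Real.arcsin_zero,
    Real.arcsin_sin (by linarith [h.1, Real.pi_pos]) h.2.le]
  simp [quarticPrimitive]

/-- The elementary part of a primitive of `innerIntegral`. -/
noncomputable def elementaryPart (φ : ℝ) : ℝ :=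
  (Real.sin φ - φ * Real.cos φ) / (16 * Real.sin φ ^ 2) + Real.sin φ / 4

/-- Removing `(φ / sin φ) / 16` from the inner integral leaves an elementary derivative; only the
removed term produces Catalan's constant. -/
lemma hasDerivAt_elementaryPart {φ : ℝ} (h : φ ∈ Set.Ioo 0 (Real.pi / 2)) :
    HasDerivAt elementaryPart (innerIntegral φ - (Real.sinc φ)⁻¹ / 16) φ := by
  have hs : 0 < Real.sin φ := Real.sin_pos_of_mem_Ioo ⟨h.1, by linarith [h.2, Real.pi_pos]⟩
  have hd := (((Real.hasDerivAt_sin φ).sub ((hasDerivAt_id φ).mul (Real.hasDerivAt_cos φ))).div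
    (((Real.hasDerivAt_sin φ).pow 2).const_mul 16) (mul_pos (by norm_num) (pow_pos hs 2)).ne').add
    ((Real.hasDerivAt_sin φ).div_const 4)
  refine hd.congr_deriv ?_
  have h4 : Real.sin (4 * φ) = 4 * Real.sin φ * Real.cos φ * (1 - 2 * Real.sin φ ^ 2) := by
    rw [show 4 * φ = 2 * (2 * φ) by ring, Real.sin_two_mul, Real.sin_two_mul, Real.cos_two_mul,
      Real.cos_sq']
    ring
  rw [innerIntegral_eq h, Real.sinc_of_ne_zero h.1.ne', quarticPrimitive, h4]
  have hc := Real.cos_sq' φ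
  have h0 := h.1.ne'
  simp only [id, Pi.mul_apply, Pi.pow_apply, Pi.sub_apply]
  field_simp
  simp only [Nat.reduceSub, pow_one]
  push_cast
  linear_combination (2048 * φ * Real.sin φ) * hc

lemma continuousOn_inv_sinc : ContinuousOn (fun x => (Real.sinc x)⁻¹) (Set.uIcc 0 (Real.pi / 2)) := by
  refine Real.continuous_sinc.continuousOn.inv₀ fun x hx => ?_
  rw [Set.uIcc_of_le (by positivity)] at hx
  rcases hx.1.eq_or_lt with rfl | h
  · simp
  · rw [Real.sinc_of_ne_zero h.ne']
    exact (div_pos (Real.sin_pos_of_pos_of_lt_pi h (by linarith [hx.2, Real.pi_pos])) h).ne'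

lemma tendsto_elementaryPart_zero :
    Filter.Tendsto elementaryPart (nhdsWithin 0 (Set.Ioi 0)) (nhds 0) := by
  have hpi := Real.pi_pos
  -- The majorant comes from `sin x - x cos x ≤ x³ / 2` and Jordan's inequality `sin x ≥ 2x / π`:
  -- indeed `(x³ / 2) / (16 (2x / π)²) = x π² / 128`. The lower bound `0` rests on `x ≤ tan x`.
  have hq : Filter.Tendsto (fun x : ℝ => x * (Real.pi ^ 2 / 128) + Real.sin x / 4)
      (nhdsWithin 0 (Set.Ioi 0)) (nhds 0) := by
    have : Continuous fun x : ℝ => x * (Real.pi ^ 2 / 128) + Real.sin x / 4 := by fun_prop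
    simpa using (this.tendsto 0).mono_left nhdsWithin_le_nhds
  have hmem : Set.Ioo (0 : ℝ) (Real.pi / 2) ∈ nhdsWithin 0 (Set.Ioi 0) :=
    Ioo_mem_nhdsGT (by positivity)
  refine tendsto_of_tendsto_of_tendsto_of_le_of_le' tendsto_const_nhds hq ?_ ?_
  · filter_upwards [hmem] with x hx
    have hs : 0 < Real.sin x := Real.sin_pos_of_mem_Ioo ⟨hx.1, by linarith [hx.2]⟩
    have hc : 0 < Real.cos x := Real.cos_pos_of_mem_Ioo ⟨by linarith [hx.1], hx.2⟩
    have ht := Real.le_tan hx.1.le hx.2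
    rw [Real.tan_eq_sin_div_cos, le_div_iff₀ hc] at ht
    exact add_nonneg (div_nonneg (by linarith) (by positivity)) (by positivity)
  · filter_upwards [hmem] with x hx
    have hs : 0 < Real.sin x := Real.sin_pos_of_mem_Ioo ⟨hx.1, by linarith [hx.2]⟩
    have h1 := Real.mul_le_sin hx.1.le hx.2.le
    have h2 := Real.one_sub_sq_div_two_le_cos (x := x)
    have h3 := Real.sin_le hx.1.le
    have h4 : (2 / Real.pi * x) ^ 2 ≤ Real.sin x ^ 2 :=
      pow_le_pow_left₀ (by have := hx.1; positivity) h1 2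
    refine add_le_add ?_ le_rfl
    rw [div_le_iff₀ (by positivity)]
    have h5 : Real.sin x - x * Real.cos x ≤ x ^ 3 / 2 := by nlinarith [hx.1]
    have h6 : x ^ 3 / 2 = x * (Real.pi ^ 2 / 128) * (16 * (2 / Real.pi * x) ^ 2) := by
      field_simp; ring
    rw [h6] at h5
    refine h5.trans ?_
    have := hx.1
    gcongr

/-- The boundary term at `π / 2` is `1/16 + 1/4 = 5/16`, the one at `0` vanishes, and the `sinc`
term adds `2G / 16`. -/
lemma integral_innerIntegral :
    ∫ φ in (0)..(Real.pi / 2), innerIntegral φ = (5 + 2 * catalanConst) / 16 := by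
  have hpi := Real.pi_pos
  have hi1 := continuous_innerIntegral.intervalIntegrable (μ := volume) 0 (Real.pi / 2)
  have hi2 := continuousOn_inv_sinc.intervalIntegrable (μ := volume)
  have h := intervalIntegral.integral_eq_sub_of_hasDerivAt_of_tendsto (by positivity)
    (fun x hx => hasDerivAt_elementaryPart hx) (hi1.sub (hi2.div_const 16))
    tendsto_elementaryPart_zero (fb := 5 / 16) (by
      have hc : ContinuousAt elementaryPart (Real.pi / 2) := by
        unfold elementaryPart
        refine ContinuousAt.add (ContinuousAt.div (by fun_prop) (by fun_prop) ?_) (by fun_prop)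
        simp
      have e : elementaryPart (Real.pi / 2) = 5 / 16 := by
        simp [elementaryPart]; norm_num
      rw [← e]
      exact hc.tendsto.mono_left nhdsWithin_le_nhds)
  rw [intervalIntegral.integral_sub hi1 (hi2.div_const 16), intervalIntegral.integral_div,
    integral_inv_sinc] at h
  linarith

end Catalan

/-! ### Moments in coordinates adapted to two orthogonal planes -/

section Hopf

lemma isFiniteMeasure_weighted (a b : ℝ) {w : ℝ → ℝ} (hw : Continuous w) :
    IsFiniteMeasure (weighted a b w) := by
  constructor
  rw [weighted, withDensity_apply _ MeasurableSet.univ, Measure.restrict_univ,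
    lintegral_indicator measurableSet_Ioo]
  exact (hw.integrableOn_Icc.mono_set Set.Ioo_subset_Icc_self).lintegral_lt_top

/-- Expectation over the unit sphere of `ℝ⁴` of a function of the first plane only. -/
theorem sphereMean_of_hopf {F : EuclideanSpace ℝ (Fin 4) → ℝ} (hF : Measurable F)
    {G : ℝ × ℝ → ℝ} (hG : Continuous G) {M : ℝ} (hM : ∀ p, |G p| ≤ M)
    (h : ∀ α ∈ Set.Ioo 0 (Real.pi / 2), ∀ φ ψ, F (hopf (α, φ, ψ)) = G (α, φ)) :
    sphereMean F = 1 / Real.pi * ∫ φ in (-Real.pi)..Real.pi,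
      ∫ α in (0)..(Real.pi / 2), Real.cos α * Real.sin α * G (α, φ) := by
  rw [sphereMean, integral_uniformSphere_eq continuous_hopf.measurable norm_hopf finrank_four
    measurePreserving_hopf hF, mass_hopf]
  set Q := weighted 0 (Real.pi / 2) fun t => Real.cos t * Real.sin t with hQ
  have hc : Continuous fun t => Real.cos t * Real.sin t := by fun_prop
  have : IsFiniteMeasure Q := isFiniteMeasure_weighted _ _ hc
  have : IsFiniteMeasure arc := isFiniteMeasure_weighted _ _ continuous_const
  have e1 : ∫ ω, F (hopf ω) ∂(Q.prod (arc.prod arc)) =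
      ∫ ω, G (ω.1, ω.2.1) ∂(Q.prod (arc.prod arc)) := by
    refine integral_congr_ae ?_
    filter_upwards [Measure.quasiMeasurePreserving_fst.ae
      (ae_weighted_mem 0 (Real.pi / 2) hc)] with p hp
    exact h p.1 hp p.2.1 p.2.2
  have e2 : ∫ ω, G (ω.1, ω.2.1) ∂(Q.prod (arc.prod arc)) =
      ∫ z, G z.1 * (1 : ℝ) ∂((Q.prod arc).prod arc) := by
    rw [← (measurePreserving_prodAssoc Q arc arc).map_eq,
      integral_map_equiv]
    simp [MeasurableEquiv.prodAssoc]
  -- Boundedness on a finite measure justifies Fubini. Integrating out the second angle gives `2π`,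
  -- which turns the normalisation `1 / (2π²)` into `1 / π`.
  have hint : Integrable G (Q.prod arc) :=
    Integrable.of_bound hG.aestronglyMeasurable M (Filter.Eventually.of_forall hM)
  rw [e1, e2, integral_prod_mul (f := G) (g := fun _ => (1 : ℝ)), ← real_univ_eq_integral,
    arc_real_univ, integral_prod_symm G hint, integral_arc]
  simp_rw [hQ, integral_quarter]
  have := Real.pi_pos
  field_simp

lemma hopf_zero (α φ ψ : ℝ) : hopf (α, φ, ψ) 0 = Real.cos α * Real.cos φ := rfl
lemma hopf_one (α φ ψ : ℝ) : hopf (α, φ, ψ) 1 = Real.cos α * Real.sin φ := rfl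
lemma hopf_two (α φ ψ : ℝ) : hopf (α, φ, ψ) 2 = Real.sin α * Real.cos ψ := rfl
lemma hopf_three (α φ ψ : ℝ) : hopf (α, φ, ψ) 3 = Real.sin α * Real.sin ψ := rfl

lemma sqrt_hopf_zero_one {α : ℝ} (h : α ∈ Set.Ioo 0 (Real.pi / 2)) (φ ψ : ℝ) :
    √(hopf (α, φ, ψ) 0 ^ 2 + hopf (α, φ, ψ) 1 ^ 2) = Real.cos α := by
  rw [hopf_zero, hopf_one, show (Real.cos α * Real.cos φ) ^ 2 + (Real.cos α * Real.sin φ) ^ 2 =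
    Real.cos α ^ 2 by linear_combination Real.cos α ^ 2 * Real.sin_sq_add_cos_sq φ]
  exact Real.sqrt_sq (Real.cos_pos_of_mem_Ioo ⟨by linarith [h.1, Real.pi_pos], h.2⟩).le

lemma sqrt_hopf_two_three {α : ℝ} (h : α ∈ Set.Ioo 0 (Real.pi / 2)) (φ ψ : ℝ) :
    √(hopf (α, φ, ψ) 2 ^ 2 + hopf (α, φ, ψ) 3 ^ 2) = Real.sin α := by
  rw [hopf_two, hopf_three, show (Real.sin α * Real.cos ψ) ^ 2 + (Real.sin α * Real.sin ψ) ^ 2 =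
    Real.sin α ^ 2 by linear_combination Real.sin α ^ 2 * Real.sin_sq_add_cos_sq ψ]
  exact Real.sqrt_sq (Real.sin_pos_of_mem_Ioo ⟨h.1, by linarith [h.2, Real.pi_pos]⟩).le

lemma sphereMean_sqrt_add_mul_sqrt_add_compl : sphereMean (fun u : EuclideanSpace ℝ (Fin 4) =>
    √(u 0 ^ 2 + u 1 ^ 2) * √(u 2 ^ 2 + u 3 ^ 2)) = Real.pi / 8 := by
  refine (sphereMean_of_hopf (G := fun p => Real.cos p.1 * Real.sin p.1) (M := 1) (by fun_prop)
    (by fun_prop) (fun p => ?_) (fun α hα φ ψ => ?_)).trans ?_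
  · rw [abs_mul]
    exact mul_le_one₀ (Real.abs_cos_le_one _) (abs_nonneg _) (Real.abs_sin_le_one _)
  · rw [sqrt_hopf_zero_one hα, sqrt_hopf_two_three hα]
  · have : ∫ α in (0)..(Real.pi / 2), Real.cos α * Real.sin α * (Real.cos α * Real.sin α) =
        Real.pi / 16 := by
      have e : ∀ α, Real.cos α * Real.sin α * (Real.cos α * Real.sin α) =
        Real.sin α ^ 2 * Real.cos α ^ 2 := fun α => by ring
      simp_rw [e]
      rw [integral_sin_sq_mul_cos_sq, show 4 * (Real.pi / 2) = 2 * Real.pi by ring]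
      simp; ring
    simp only [this, intervalIntegral.integral_const, smul_eq_mul]
    have := Real.pi_pos
    field_simp
    norm_num

lemma sphereMean_sqrt_add_mul_sqrt_one_sub_self :
    sphereMean (fun u : EuclideanSpace ℝ (Fin 4) => √(u 0 ^ 2 + u 1 ^ 2) * √(1 - u 1 ^ 2)) =
      (5 + 2 * catalanConst) / (4 * Real.pi) := by
  refine (sphereMean_of_hopf
    (G := fun p => Real.cos p.1 * √(1 - Real.cos p.1 ^ 2 * Real.sin p.2 ^ 2)) (M := 1)
    (by fun_prop) (by fun_prop) (fun p => ?_) (fun α hα φ ψ => ?_)).trans ?_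
  · rw [abs_mul, abs_of_nonneg (Real.sqrt_nonneg _)]
    refine mul_le_one₀ (Real.abs_cos_le_one _) (Real.sqrt_nonneg _) (Real.sqrt_le_one.2 ?_)
    nlinarith [sq_nonneg (Real.cos p.1 * Real.sin p.2)]
  · rw [sqrt_hopf_zero_one hα, hopf_one, mul_pow]
  · change 1 / Real.pi * ∫ φ in (-Real.pi)..Real.pi, innerIntegral φ = _
    rw [integral_neg_pi_pi_symm continuous_innerIntegral (fun t => by simp [innerIntegral])
      (fun t => by simp [innerIntegral]), integral_innerIntegral]
    have := Real.pi_pos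
    field_simp
    ring

end Hopf

/-! ### One-sided Taylor estimate for the square root -/

section Taylor

/-- Taylor coefficients of `√(1 - a)`. -/
def sqrtCoeff (k : ℕ) : ℚ := ∏ i ∈ Finset.range k, ((2 * i - 1 : ℚ) / (2 * i + 2))

/-- The Taylor polynomial of `√(1 - a)` with ten terms. -/
noncomputable def sqrtTaylor (a : ℝ) : ℝ := ∑ k ∈ Finset.range 10, (sqrtCoeff k : ℝ) * a ^ k

/-- The value of `sqrtTaylor` at `1`. -/
noncomputable def sqrtTail : ℝ := 12155 / 65536

lemma sqrtTaylor_eq (a : ℝ) : sqrtTaylor a = 1 - (1 / 2 * a + 1 / 8 * a ^ 2 + 1 / 16 * a ^ 3 +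
    5 / 128 * a ^ 4 + 7 / 256 * a ^ 5 + 21 / 1024 * a ^ 6 + 33 / 2048 * a ^ 7 +
    429 / 32768 * a ^ 8 + 715 / 65536 * a ^ 9) := by
  simp only [sqrtTaylor, Finset.sum_range_succ, Finset.sum_range_zero, sqrtCoeff,
    Finset.prod_range_succ, Finset.prod_range_zero]
  push_cast
  ring

/-- Squaring the truncation gives `T² = 1 - a + a¹⁰ P` with `P` having positive coefficients, so `0
≤ P ≤ P(1) = T(1)²` and `√(1 - a) ≤ T`. The upper bound follows by dividing `T² - (1 - a)` by `T +
√(1 - a) ≥ T(1)`. -/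
lemma sqrtTaylor_bounds {a : ℝ} (h0 : 0 ≤ a) (h1 : a ≤ 1) :
    0 ≤ sqrtTaylor a - √(1 - a) ∧ sqrtTaylor a - √(1 - a) ≤ sqrtTail * a ^ 10 := by
  have hp : ∀ k : ℕ, a ^ k ≤ 1 := fun k => pow_le_one₀ h0 h1
  have hT : sqrtTail ≤ sqrtTaylor a := by
    rw [sqrtTaylor_eq, sqrtTail]
    linarith [hp 2, hp 3, hp 4, hp 5, hp 6, hp 7, hp 8, hp 9]
  have hpos : 0 < sqrtTail := by norm_num [sqrtTail]
  set P := 2431 / 131072 + 221 / 32768 * a + 7735 / 2097152 * a ^ 2 + 4675 / 2097152 * a ^ 3 +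
    23375 / 16777216 * a ^ 4 + 7293 / 8388608 * a ^ 5 + 561561 / 1073741824 * a ^ 6 +
    306735 / 1073741824 * a ^ 7 + 511225 / 4294967296 * a ^ 8 with hP
  have hid : sqrtTaylor a ^ 2 = 1 - a + a ^ 10 * P := by
    rw [sqrtTaylor_eq, hP]; ring
  have hP0 : 0 ≤ P := by positivity
  have hP1 : P ≤ sqrtTail ^ 2 := by
    rw [hP, sqrtTail]
    linarith [hp 2, hp 3, hp 4, hp 5, hp 6, hp 7, hp 8]
  have hs := Real.sqrt_nonneg (1 - a)
  have hs2 := Real.sq_sqrt (sub_nonneg.2 h1)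
  have h10 : 0 ≤ a ^ 10 := by positivity
  have hle : √(1 - a) ≤ sqrtTaylor a := by
    rw [Real.sqrt_le_left (by linarith), hid]
    nlinarith
  refine ⟨sub_nonneg.2 hle, ?_⟩
  have hmul : (sqrtTaylor a - √(1 - a)) * (sqrtTaylor a + √(1 - a)) = a ^ 10 * P := by
    linear_combination hid - hs2
  have h3 : (sqrtTaylor a - √(1 - a)) * sqrtTail ≤ (sqrtTail * a ^ 10) * sqrtTail :=
    calc (sqrtTaylor a - √(1 - a)) * sqrtTail
        ≤ (sqrtTaylor a - √(1 - a)) * (sqrtTaylor a + √(1 - a)) :=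
          mul_le_mul_of_nonneg_left (by linarith) (sub_nonneg.2 hle)
      _ = a ^ 10 * P := hmul
      _ ≤ a ^ 10 * sqrtTail ^ 2 := mul_le_mul_of_nonneg_left hP1 h10
      _ = _ := by ring
  exact le_of_mul_le_mul_right h3 hpos

end Taylor

/-! ### Linearity and monotonicity of sphere means; the Taylor enclosure -/

section Mean

lemma integrable_sphere {n : ℕ} {F : EuclideanSpace ℝ (Fin (n + 1)) → ℝ} (hF : Continuous F) :
    Integrable (fun v : Metric.sphere (0 : EuclideanSpace ℝ (Fin (n + 1))) 1 =>
      F (v : EuclideanSpace ℝ (Fin (n + 1)))) (uniformSphere _) :=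
  (hF.comp continuous_subtype_val).integrable_of_hasCompactSupport
    (HasCompactSupport.of_compactSpace _)

variable {n : ℕ}

lemma sphereMean_add {F G : EuclideanSpace ℝ (Fin (n + 1)) → ℝ} (hF : Continuous F)
    (hG : Continuous G) : sphereMean (fun u => F u + G u) = sphereMean F + sphereMean G :=
  integral_add (integrable_sphere hF) (integrable_sphere hG)

lemma sphereMean_sub {F G : EuclideanSpace ℝ (Fin (n + 1)) → ℝ} (hF : Continuous F)
    (hG : Continuous G) : sphereMean (fun u => F u - G u) = sphereMean F - sphereMean G :=
  integral_sub (integrable_sphere hF) (integrable_sphere hG)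

lemma sphereMean_const_mul (c : ℝ) (F : EuclideanSpace ℝ (Fin (n + 1)) → ℝ) :
    sphereMean (fun u => c * F u) = c * sphereMean F :=
  integral_const_mul _ _

lemma sphereMean_sum {ι : Type*} (s : Finset ι) {F : ι → EuclideanSpace ℝ (Fin (n + 1)) → ℝ}
    (hF : ∀ i, Continuous (F i)) :
    sphereMean (fun u => ∑ i ∈ s, F i u) = ∑ i ∈ s, sphereMean (F i) :=
  integral_finsetSum s fun i _ => integrable_sphere (hF i)

lemma sphereMean_mono {F G : EuclideanSpace ℝ (Fin (n + 1)) → ℝ} (hF : Continuous F)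
    (hG : Continuous G) (h : ∀ u, ‖u‖ = 1 → F u ≤ G u) : sphereMean F ≤ sphereMean G :=
  integral_mono (integrable_sphere hF) (integrable_sphere hG) fun v => h v (by simp)

lemma sq_apply_le_one {u : EuclideanSpace ℝ (Fin (n + 1))} (hu : ‖u‖ = 1) (i : Fin (n + 1)) :
    u i ^ 2 ≤ 1 := by
  have h := PiLp.norm_apply_le u i
  rw [hu, Real.norm_eq_abs] at h
  exact (sq_le_one_iff_abs_le_one _).2 h

/-- Enclosure of the mean of `√(1 - u₀²) √(1 - u₁²)` in terms of simpler moments. -/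
theorem sphereMean_sqrt_mul_sqrt_mem {p : ℕ → ℝ} {q : ℕ → ℕ → ℝ}
    (hp : ∀ k, sphereMean (fun u : EuclideanSpace ℝ (Fin (n + 2)) =>
      √(1 - u 0 ^ 2) * u 1 ^ (2 * k)) = p k)
    (hq : ∀ k l, sphereMean (fun u : EuclideanSpace ℝ (Fin (n + 2)) =>
      u 0 ^ (2 * k) * u 1 ^ (2 * l)) = q k l) :
    sphereMean (fun u : EuclideanSpace ℝ (Fin (n + 2)) => √(1 - u 0 ^ 2) * √(1 - u 1 ^ 2)) ∈
      Set.Icc (2 * ∑ k ∈ Finset.range 10, (sqrtCoeff k : ℝ) * p k -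
        ∑ k ∈ Finset.range 10, ∑ l ∈ Finset.range 10, (sqrtCoeff k * sqrtCoeff l : ℝ) * q k l)
      (2 * ∑ k ∈ Finset.range 10, (sqrtCoeff k : ℝ) * p k -
        ∑ k ∈ Finset.range 10, ∑ l ∈ Finset.range 10, (sqrtCoeff k * sqrtCoeff l : ℝ) * q k l +
        sqrtTail ^ 2 * q 10 10) := by
  have hTc : Continuous sqrtTaylor := by unfold sqrtTaylor; fun_prop
  set F1 : EuclideanSpace ℝ (Fin (n + 2)) → ℝ := fun u => √(1 - u 0 ^ 2) * sqrtTaylor (u 1 ^ 2)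
    with hF1
  set F2 : EuclideanSpace ℝ (Fin (n + 2)) → ℝ := fun u => √(1 - u 1 ^ 2) * sqrtTaylor (u 0 ^ 2)
    with hF2
  set F3 : EuclideanSpace ℝ (Fin (n + 2)) → ℝ := fun u => sqrtTaylor (u 0 ^ 2) * sqrtTaylor (u 1 ^ 2)
    with hF3
  set R : EuclideanSpace ℝ (Fin (n + 2)) → ℝ := fun u =>
    sqrtTail ^ 2 * (u 0 ^ (2 * 10) * u 1 ^ (2 * 10)) with hR
  have c1 : Continuous F1 := by fun_prop
  have c2 : Continuous F2 := by fun_prop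
  have c3 : Continuous F3 := by fun_prop
  have cR : Continuous R := by fun_prop
  have e1 : sphereMean F1 = ∑ k ∈ Finset.range 10, (sqrtCoeff k : ℝ) * p k := by
    have : F1 = fun u => ∑ k ∈ Finset.range 10, (sqrtCoeff k : ℝ) *
        (√(1 - u 0 ^ 2) * u 1 ^ (2 * k)) := by
      ext u
      simp only [hF1, sqrtTaylor, Finset.mul_sum, pow_mul]
      exact Finset.sum_congr rfl fun k _ => by ring
    rw [this, sphereMean_sum _ (fun k => by fun_prop)]
    simp only [sphereMean_const_mul, hp]
  have e2 : sphereMean F2 = sphereMean F1 := by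
    rw [← sphereMean_perm (Equiv.swap 0 1) c1.measurable]
    simp [hF1, hF2]
  have e3 : sphereMean F3 = ∑ k ∈ Finset.range 10, ∑ l ∈ Finset.range 10,
      (sqrtCoeff k * sqrtCoeff l : ℝ) * q k l := by
    have : F3 = fun u => ∑ k ∈ Finset.range 10, ∑ l ∈ Finset.range 10,
        (sqrtCoeff k * sqrtCoeff l : ℝ) * (u 0 ^ (2 * k) * u 1 ^ (2 * l)) := by
      ext u
      simp only [hF3, sqrtTaylor, Finset.sum_mul_sum, pow_mul]
      exact Finset.sum_congr rfl fun k _ => Finset.sum_congr rfl fun l _ => by ring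
    rw [this, sphereMean_sum _ (fun k => by fun_prop)]
    refine Finset.sum_congr rfl fun k _ => ?_
    rw [sphereMean_sum _ (fun k => by fun_prop)]
    simp only [sphereMean_const_mul, hq]
  have e4 : sphereMean (fun u => F1 u + F2 u - F3 u) =
      2 * ∑ k ∈ Finset.range 10, (sqrtCoeff k : ℝ) * p k -
        ∑ k ∈ Finset.range 10, ∑ l ∈ Finset.range 10, (sqrtCoeff k * sqrtCoeff l : ℝ) * q k l := by
    rw [sphereMean_sub (F := fun u => F1 u + F2 u) (c1.add c2) c3, sphereMean_add c1 c2, e2, e1, e3]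
    ring
  have e5 : sphereMean R = sqrtTail ^ 2 * q 10 10 := by
    rw [hR, sphereMean_const_mul, hq]
  have key : ∀ u : EuclideanSpace ℝ (Fin (n + 2)), ‖u‖ = 1 →
      F1 u + F2 u - F3 u ≤ √(1 - u 0 ^ 2) * √(1 - u 1 ^ 2) ∧
      √(1 - u 0 ^ 2) * √(1 - u 1 ^ 2) ≤ (F1 u + F2 u - F3 u) + R u := by
    intro u hu
    obtain ⟨a1, a2⟩ := sqrtTaylor_bounds (sq_nonneg (u 0)) (sq_apply_le_one hu 0)
    obtain ⟨b1, b2⟩ := sqrtTaylor_bounds (sq_nonneg (u 1)) (sq_apply_le_one hu 1)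
    -- Only the product of the two Taylor errors is left over. Both are nonnegative, so the
    -- approximation is a lower bound, and the error is of order 20 in each coordinate.
    have e : √(1 - u 0 ^ 2) * √(1 - u 1 ^ 2) = (F1 u + F2 u - F3 u) +
        (sqrtTaylor (u 0 ^ 2) - √(1 - u 0 ^ 2)) * (sqrtTaylor (u 1 ^ 2) - √(1 - u 1 ^ 2)) := by
      simp only [hF1, hF2, hF3]; ring
    have h2 := mul_le_mul a2 b2 b1 (a1.trans a2)
    have h0 := mul_nonneg a1 b1
    have eR : R u = sqrtTail * (u 0 ^ 2) ^ 10 * (sqrtTail * (u 1 ^ 2) ^ 10) := by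
      simp only [hR, pow_mul]; ring
    rw [e, eR]
    exact ⟨by linarith, by linarith⟩
  constructor
  · rw [← e4]
    exact sphereMean_mono (by fun_prop) (by fun_prop) fun u hu => (key u hu).1
  · rw [← e4, ← e5, ← sphereMean_add (by fun_prop) cR]
    exact sphereMean_mono (by fun_prop) (by fun_prop) fun u hu => (key u hu).2

end Mean

/-! ### Certified numerical values of the two moments without closed form -/

section Numerics

/-- Twice the rational coefficient of `1 / π` in the enclosure for `ℝ⁴`. -/
def sphere4Linear : ℚ :=
  ∑ k ∈ Finset.range 10, sqrtCoeff k * (oddMoment (k + 1) 0 * (2 / (2 * k + 1)))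

def sphere4Square : ℚ :=
  ∑ k ∈ Finset.range 10, ∑ l ∈ Finset.range 10,
    sqrtCoeff k * sqrtCoeff l * (evenMoment (l + 1) k * (2 / (2 * l + 1)))

def sphere3Linear : ℚ :=
  ∑ k ∈ Finset.range 10, sqrtCoeff k * (evenMoment (k + 1) 0 * evenMoment 0 k / 2)

def sphere3Square : ℚ :=
  ∑ k ∈ Finset.range 10, ∑ l ∈ Finset.range 10,
    sqrtCoeff k * sqrtCoeff l * (oddMoment l k * evenMoment 0 l / 2)

/-- The coefficients and moments are computable rationals, so the kernel evaluates these finite sums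
exactly; the bounds keep twelve decimals. -/
lemma sphere4Linear_mem : sphere4Linear ∈ Set.Icc (2236290233427 / 1000000000000 : ℚ) (2236290233428 / 1000000000000) := by
  constructor <;> decide +kernel

lemma sphere4Square_mem : sphere4Square ∈ Set.Icc (712657611471 / 1000000000000 : ℚ) (712657611472 / 1000000000000) := by
  constructor <;> decide +kernel

lemma sphere3Linear_mem : sphere3Linear ∈ Set.Icc (189824561654 / 1000000000000 : ℚ) (189824561655 / 1000000000000) := by
  constructor <;> decide +kernel

lemma sphere3Square_mem : sphere3Square ∈ Set.Icc (599489670342 / 1000000000000 : ℚ) (599489670343 / 1000000000000) := by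
  constructor <;> decide +kernel

lemma sphereMean_sqrt_mul_sqrt_four_mem :
    sphereMean (fun u : EuclideanSpace ℝ (Fin 4) => √(1 - u 0 ^ 2) * √(1 - u 1 ^ 2)) ∈
      Set.Icc (0.711008967 : ℝ) 0.711008969 := by
  obtain ⟨h1, h2⟩ := sphereMean_sqrt_mul_sqrt_mem (n := 2) sphereMean_sqrt_one_sub_mul_even
    sphereMean_even_mul_even
  have eA : ∑ k ∈ Finset.range 10, (sqrtCoeff k : ℝ) *
      ((oddMoment (k + 1) 0 * (2 / (2 * k + 1)) : ℚ) / Real.pi) = (sphere4Linear : ℝ) / Real.pi := by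
    rw [sphere4Linear]
    push_cast
    rw [Finset.sum_div]
    exact Finset.sum_congr rfl fun k _ => by ring
  have eB : ∑ k ∈ Finset.range 10, ∑ l ∈ Finset.range 10, (sqrtCoeff k * sqrtCoeff l : ℝ) *
      ((evenMoment (l + 1) k * (2 / (2 * l + 1)) : ℚ) : ℝ) = (sphere4Square : ℝ) := by
    rw [sphere4Square]
    push_cast
    rfl
  have eR : sqrtTail ^ 2 * ((evenMoment (10 + 1) 10 * (2 / (2 * (10 : ℕ) + 1)) : ℚ) : ℝ) ≤
      (0.0000000003 : ℝ) := by
    -- Dividing the target by `sqrtTail ^ 2` leaves a purely rational inequality for the kernel.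
    have : evenMoment (10 + 1) 10 * (2 / (2 * (10 : ℕ) + 1)) ≤ (3 / 10000000000 : ℚ) / (12155 / 65536) ^ 2 := by
      decide +kernel
    have h : ((evenMoment (10 + 1) 10 * (2 / (2 * (10 : ℕ) + 1)) : ℚ) : ℝ) ≤
        (3 / 10000000000 : ℝ) / (12155 / 65536) ^ 2 :=
      ((Rat.cast_le (K := ℝ)).2 this).trans (le_of_eq (by norm_num))
    rw [le_div_iff₀ (by norm_num)] at h
    rw [sqrtTail]
    linarith
  rw [eA, eB] at h1 h2
  obtain ⟨a1, a2⟩ := sphere4Linear_mem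
  obtain ⟨b1, b2⟩ := sphere4Square_mem
  have a1' : (2236290233427 / 1000000000000 : ℝ) ≤ sphere4Linear :=
    (le_of_eq (by norm_num)).trans ((Rat.cast_le (K := ℝ)).2 a1)
  have a2' : (sphere4Linear : ℝ) ≤ (2236290233428 / 1000000000000 : ℝ) :=
    ((Rat.cast_le (K := ℝ)).2 a2).trans (le_of_eq (by norm_num))
  have b1' : (712657611471 / 1000000000000 : ℝ) ≤ sphere4Square :=
    (le_of_eq (by norm_num)).trans ((Rat.cast_le (K := ℝ)).2 b1)
  have b2' : (sphere4Square : ℝ) ≤ (712657611472 / 1000000000000 : ℝ) :=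
    ((Rat.cast_le (K := ℝ)).2 b2).trans (le_of_eq (by norm_num))
  have p1 := Real.pi_gt_d20
  have p2 := Real.pi_lt_d20
  have c1 : (0.71183328967 : ℝ) ≤ sphere4Linear / Real.pi := by
    rw [le_div_iff₀ Real.pi_pos]; linarith
  have c2 : sphere4Linear / Real.pi ≤ (0.71183328969 : ℝ) := by
    rw [div_le_iff₀ Real.pi_pos]; linarith
  exact ⟨by linarith, by linarith⟩

lemma sphereMean_sqrt_mul_sqrt_three_mem :
    sphereMean (fun u : EuclideanSpace ℝ (Fin 3) => √(1 - u 0 ^ 2) * √(1 - u 1 ^ 2)) ∈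
      Set.Icc (0.59321322637 : ℝ) 0.59321322785 := by
  obtain ⟨h1, h2⟩ := sphereMean_sqrt_mul_sqrt_mem (n := 1) sphereMean3_sqrt_one_sub_mul_even
    sphereMean3_even_mul_even
  have eA : ∑ k ∈ Finset.range 10, (sqrtCoeff k : ℝ) *
      ((evenMoment (k + 1) 0 * evenMoment 0 k / 2 : ℚ) * Real.pi) =
      (sphere3Linear : ℝ) * Real.pi := by
    rw [sphere3Linear]
    push_cast
    rw [Finset.sum_mul]
    exact Finset.sum_congr rfl fun k _ => by ring
  have eB : ∑ k ∈ Finset.range 10, ∑ l ∈ Finset.range 10, (sqrtCoeff k * sqrtCoeff l : ℝ) *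
      ((oddMoment l k * evenMoment 0 l / 2 : ℚ) : ℝ) = (sphere3Square : ℝ) := by
    rw [sphere3Square]
    push_cast
    rfl
  have eR : sqrtTail ^ 2 * ((oddMoment 10 10 * evenMoment 0 10 / 2 : ℚ) : ℝ) ≤
      (0.0000000012 : ℝ) := by
    have : oddMoment 10 10 * evenMoment 0 10 / 2 ≤ (12 / 10000000000 : ℚ) / (12155 / 65536) ^ 2 := by
      decide +kernel
    have h : ((oddMoment 10 10 * evenMoment 0 10 / 2 : ℚ) : ℝ) ≤
        (12 / 10000000000 : ℝ) / (12155 / 65536) ^ 2 :=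
      ((Rat.cast_le (K := ℝ)).2 this).trans (le_of_eq (by norm_num))
    rw [le_div_iff₀ (by norm_num)] at h
    rw [sqrtTail]
    linarith
  rw [eA, eB] at h1 h2
  obtain ⟨a1, a2⟩ := sphere3Linear_mem
  obtain ⟨b1, b2⟩ := sphere3Square_mem
  have a1' : (189824561654 / 1000000000000 : ℝ) ≤ sphere3Linear :=
    (le_of_eq (by norm_num)).trans ((Rat.cast_le (K := ℝ)).2 a1)
  have a2' : (sphere3Linear : ℝ) ≤ (189824561655 / 1000000000000 : ℝ) :=
    ((Rat.cast_le (K := ℝ)).2 a2).trans (le_of_eq (by norm_num))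
  have b1' : (599489670342 / 1000000000000 : ℝ) ≤ sphere3Square :=
    (le_of_eq (by norm_num)).trans ((Rat.cast_le (K := ℝ)).2 b1)
  have b2' : (sphere3Square : ℝ) ≤ (599489670343 / 1000000000000 : ℝ) :=
    ((Rat.cast_le (K := ℝ)).2 b2).trans (le_of_eq (by norm_num))
  have p1 := Real.pi_gt_d20
  have p2 := Real.pi_lt_d20
  have c1 : (189824561654 / 1000000000000 : ℝ) * 3.14159265358979 ≤ sphere3Linear * Real.pi :=
    mul_le_mul a1' (by linarith) (by norm_num) (by linarith)
  have c2 : sphere3Linear * Real.pi ≤ (189824561655 / 1000000000000 : ℝ) * 3.1415926535898 :=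
    mul_le_mul a2' (by linarith) Real.pi_pos.le (by norm_num)
  norm_num at c1 c2
  exact ⟨by linarith, by linarith⟩

/-- Neither root involves `u 0`. With `u = (cos χ, sin χ • ω)` each root equals `sin χ` times `√(1 -
ω i ^ 2)`, so the mean is `(2 / π) ∫ sin⁴ = 3 / 4` times the mean on the 2-sphere. -/
lemma sphereMean_sqrt_add_mul_sqrt_add_mem :
    sphereMean (fun u : EuclideanSpace ℝ (Fin 4) =>
      √(u 2 ^ 2 + u 3 ^ 2) * √(u 1 ^ 2 + u 3 ^ 2)) ∈ Set.Icc (0.444909919 : ℝ) 0.444909922 := by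
  have h := integral_sphere4_of_sphere3
    (F := fun u => √(u 2 ^ 2 + u 3 ^ 2) * √(u 1 ^ 2 + u 3 ^ 2)) (A := fun t => Real.sin t ^ 2)
    (G := fun u => √(1 - u 0 ^ 2) * √(1 - u 1 ^ 2)) (by fun_prop) (by fun_prop) (by
      rintro χ hχ ⟨θ, φ⟩
      have hs := (Real.sin_pos_of_mem_Ioo hχ).le
      rw [spherical4_one, spherical4_two, spherical4_three, spherical3_zero, spherical3_one]
      have e1 : (Real.sin χ * (Real.sin θ * Real.cos φ)) ^ 2 +
          (Real.sin χ * (Real.sin θ * Real.sin φ)) ^ 2 =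
          Real.sin χ ^ 2 * (1 - Real.cos θ ^ 2) := by
        linear_combination Real.sin χ ^ 2 * Real.sin θ ^ 2 * Real.sin_sq_add_cos_sq φ +
          Real.sin χ ^ 2 * Real.sin_sq_add_cos_sq θ
      have e2 : (Real.sin χ * Real.cos θ) ^ 2 + (Real.sin χ * (Real.sin θ * Real.sin φ)) ^ 2 =
          Real.sin χ ^ 2 * (1 - (Real.sin θ * Real.cos φ) ^ 2) := by
        linear_combination Real.sin χ ^ 2 * Real.sin θ ^ 2 * Real.sin_sq_add_cos_sq φ +
          Real.sin χ ^ 2 * Real.sin_sq_add_cos_sq θ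
      rw [e1, e2, Real.sqrt_mul (sq_nonneg _), Real.sqrt_mul (sq_nonneg _), Real.sqrt_sq hs]
      ring)
  have h4 : 2 / Real.pi * ((∫ χ in (0)..Real.pi, Real.sin χ ^ 2 * Real.sin χ ^ 2) *
      sphereMean (fun u : EuclideanSpace ℝ (Fin 3) => √(1 - u 0 ^ 2) * √(1 - u 1 ^ 2))) =
      3 / 4 * sphereMean (fun u : EuclideanSpace ℝ (Fin 3) =>
        √(1 - u 0 ^ 2) * √(1 - u 1 ^ 2)) := by
    simp only [← pow_add, Nat.reduceAdd, integral_sin_pow_four]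
    have := Real.pi_pos
    field_simp
    ring
  rw [h, h4]
  obtain ⟨h1, h2⟩ := sphereMean_sqrt_mul_sqrt_three_mem
  exact ⟨by linarith, by linarith⟩

end Numerics

/-! ### Rational bounds for Catalan's constant -/

section CatalanBounds

lemma sum_catalan_pair (m : ℕ) (f : ℕ → ℝ) :
    ∑ k ∈ Finset.range (2 * (m + 1)), f k =
      ∑ k ∈ Finset.range (2 * m), f k + (f (2 * m) + f (2 * m + 1)) := by
  rw [show 2 * (m + 1) = 2 * m + 1 + 1 by ring, Finset.sum_range_succ, Finset.sum_range_succ]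
  ring

lemma tendsto_catalan_partial :
    Filter.Tendsto (fun m : ℕ => ∑ k ∈ Finset.range (2 * (m + 10)),
      (-1 : ℝ) ^ k / (2 * (k : ℝ) + 1) ^ 2) Filter.atTop (nhds catalanConst) := by
  have hs : Summable fun k : ℕ => (-1 : ℝ) ^ k / (2 * (k : ℝ) + 1) ^ 2 := by
    refine Summable.of_norm (summable_one_div_odd_sq.congr fun k => ?_)
    rw [norm_div, norm_pow, norm_neg, norm_one, one_pow, Real.norm_of_nonneg (by positivity)]
  refine hs.hasSum.tendsto_sum_nat.comp (Filter.tendsto_atTop_mono (fun m => ?_) Filter.tendsto_id)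
  simp only [id]; omega

/-- Truncated Euler expansion of the tail of the series for Catalan's constant. -/
noncomputable def catalanTail (c z : ℝ) : ℝ := (1 / z ^ 2 - 3 / z ^ 4 + c / z ^ 6) / 2

/-- The tail should satisfy `h z - h (z + 4) = 1 / (z + 1)² - 1 / (z + 3)²`, whose formal solution
starts `(1 / z² - 3 / z⁴ + 25 / z⁶) / 2`. Stopping at `c = 25` overestimates each pair and at `c =
0` underestimates it; after clearing denominators only positive coefficients in `t` remain. The
shift `40` corresponds to twenty terms already summed. -/
lemma catalan_pair_le {t : ℝ} (ht : 0 ≤ t) :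
    1 / (t + 41) ^ 2 - 1 / (t + 43) ^ 2 ≤ catalanTail 25 (t + 40) - catalanTail 25 (t + 44) := by
  unfold catalanTail
  rw [← sub_nonneg]
  have : (1 / (t + 40) ^ 2 - 3 / (t + 40) ^ 4 + 25 / (t + 40) ^ 6) / 2 -
      (1 / (t + 44) ^ 2 - 3 / (t + 44) ^ 4 + 25 / (t + 44) ^ 6) / 2 -
      (1 / (t + 41) ^ 2 - 1 / (t + 43) ^ 2) =
      (3145645678694400 + 524485751408640 * t + 37475862052608 * t ^ 2 + 1487537350400 * t ^ 3 +
        35424700080 * t ^ 4 + 506135192 * t ^ 5 + 4017216 * t ^ 6 + 13664 * t ^ 7) /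
      (2 * (t + 40) ^ 6 * (t + 44) ^ 6 * (t + 41) ^ 2 * (t + 43) ^ 2) := by
    field_simp
    ring
  rw [this]
  positivity

lemma le_catalan_pair {t : ℝ} (ht : 0 ≤ t) :
    catalanTail 0 (t + 40) - catalanTail 0 (t + 44) ≤ 1 / (t + 41) ^ 2 - 1 / (t + 43) ^ 2 := by
  unfold catalanTail
  rw [← sub_nonneg]
  have : (1 / (t + 41) ^ 2 - 1 / (t + 43) ^ 2) -
      ((1 / (t + 40) ^ 2 - 3 / (t + 40) ^ 4 + 0 / (t + 40) ^ 6) / 2 -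
      (1 / (t + 44) ^ 2 - 3 / (t + 44) ^ 4 + 0 / (t + 44) ^ 6) / 2) =
      (78261910272 + 9324167424 * t + 444267936 * t ^ 2 + 10581936 * t ^ 3 + 126000 * t ^ 4 +
        600 * t ^ 5) / (2 * (t + 40) ^ 4 * (t + 44) ^ 4 * (t + 41) ^ 2 * (t + 43) ^ 2) := by
    field_simp
    ring
  rw [this]
  positivity

/-- The pair estimates telescope: the partial sum plus `catalanTail 25` decreases with `m`, and the
partial sum plus `catalanTail 0` increases. -/
lemma catalan_partial_bounds (m : ℕ) :
    (∑ k ∈ Finset.range (2 * (m + 10)), (-1 : ℝ) ^ k / (2 * (k : ℝ) + 1) ^ 2) +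
        catalanTail 25 (4 * m + 40) ≤
      (∑ k ∈ Finset.range (2 * 10), (-1 : ℝ) ^ k / (2 * (k : ℝ) + 1) ^ 2) + catalanTail 25 40 ∧
    (∑ k ∈ Finset.range (2 * 10), (-1 : ℝ) ^ k / (2 * (k : ℝ) + 1) ^ 2) + catalanTail 0 40 ≤
      (∑ k ∈ Finset.range (2 * (m + 10)), (-1 : ℝ) ^ k / (2 * (k : ℝ) + 1) ^ 2) +
        catalanTail 0 (4 * m + 40) := by
  induction m with
  | zero => simp
  | succ m ih =>
    have e : (-1 : ℝ) ^ (2 * (m + 10)) / (2 * ((2 * (m + 10) : ℕ) : ℝ) + 1) ^ 2 +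
        (-1 : ℝ) ^ (2 * (m + 10) + 1) / (2 * ((2 * (m + 10) + 1 : ℕ) : ℝ) + 1) ^ 2 =
        1 / (4 * (m : ℝ) + 41) ^ 2 - 1 / (4 * (m : ℝ) + 43) ^ 2 := by
      rw [Even.neg_one_pow ⟨m + 10, by ring⟩, Odd.neg_one_pow ⟨m + 10, by ring⟩]
      push_cast
      rw [neg_div, ← sub_eq_add_neg, show 2 * (2 * ((m : ℝ) + 10)) + 1 = 4 * m + 41 by ring,
        show 2 * (2 * ((m : ℝ) + 10) + 1) + 1 = 4 * m + 43 by ring]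
    have h4 : (0 : ℝ) ≤ 4 * m := by positivity
    have hu := catalan_pair_le h4
    have hl := le_catalan_pair h4
    rw [show m + 1 + 10 = (m + 10) + 1 by ring, sum_catalan_pair, e]
    push_cast
    rw [show 4 * ((m : ℝ) + 1) + 40 = 4 * m + 44 by ring]
    exact ⟨by linarith [ih.1], by linarith [ih.2]⟩

lemma catalanConst_mem : catalanConst ∈ Set.Icc (0.91596559 : ℝ) 0.9159655943 := by
  have hsum : (∑ k ∈ Finset.range (2 * 10), (-1 : ℝ) ^ k / (2 * (k : ℝ) + 1) ^ 2) ∈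
      Set.Icc (0.9156536770 : ℝ) 0.91565367710 := by
    norm_num [Finset.sum_range_succ]
  have ht0 : Filter.Tendsto (fun m : ℕ => catalanTail 0 (4 * m + 40)) Filter.atTop (nhds 0) := by
    have h : Filter.Tendsto (fun m : ℕ => 4 * (m : ℝ) + 40) Filter.atTop Filter.atTop :=
      Filter.tendsto_atTop_add_const_right _ _
        (tendsto_natCast_atTop_atTop.const_mul_atTop (by norm_num))
    have hp : ∀ n : ℕ, n ≠ 0 → ∀ c : ℝ,
        Filter.Tendsto (fun m : ℕ => c / (4 * (m : ℝ) + 40) ^ n) Filter.atTop (nhds 0) :=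
      fun n hn c => tendsto_const_nhds.div_atTop ((Filter.tendsto_pow_atTop hn).comp h)
    simpa [catalanTail] using
      (((hp 2 (by norm_num) 1).sub (hp 4 (by norm_num) 3)).add (hp 6 (by norm_num) 0)).div_const 2
  constructor
  · have h := ge_of_tendsto (tendsto_catalan_partial.add ht0)
      (Filter.Eventually.of_forall fun m => (catalan_partial_bounds m).2)
    refine le_trans ?_ (h.trans (add_zero _).le)
    have : (0.00031191406 : ℝ) ≤ catalanTail 0 40 := by norm_num [catalanTail]
    linarith [hsum.1]
  · have h := le_of_tendsto tendsto_catalan_partial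
      (Filter.Eventually.of_forall fun m => show _ ≤ (∑ k ∈ Finset.range (2 * 10),
        (-1 : ℝ) ^ k / (2 * (k : ℝ) + 1) ^ 2) + catalanTail 25 40 from by
        have hm := (catalan_partial_bounds m).1
        have : 0 ≤ catalanTail 25 (4 * m + 40) := by
          unfold catalanTail
          have hz : (40 : ℝ) ≤ 4 * m + 40 := by linarith [(Nat.cast_nonneg m : (0 : ℝ) ≤ m)]
          have : 3 / (4 * (m : ℝ) + 40) ^ 4 ≤ 1 / (4 * (m : ℝ) + 40) ^ 2 := by
            rw [div_le_div_iff₀ (by positivity) (by positivity)]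
            have h3 : (3 : ℝ) ≤ (4 * m + 40) ^ 2 := by nlinarith
            calc _ ≤ (4 * (m : ℝ) + 40) ^ 2 * (4 * m + 40) ^ 2 := by gcongr
              _ = _ := by ring
          have : 0 ≤ 25 / (4 * (m : ℝ) + 40) ^ 6 := by positivity
          linarith
        linarith)
    have : catalanTail 25 40 ≤ (0.00031191712 : ℝ) := by norm_num [catalanTail]
    linarith [hsum.2]

end CatalanBounds

local notation "E4" => EuclideanSpace ℝ (Fin 4)

/-! ### The orthogonal projection along a unit vector -/

section Projection

/-- The orthogonal projection along `u`. -/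
noncomputable abbrev proj (u : E4) : E4 →L[ℝ] (Submodule.span ℝ {u})ᗮ :=
  (Submodule.span ℝ {u})ᗮ.orthogonalProjectionOnto

lemma shadow_eq (u : E4) : shadow u = proj u '' cube := rfl

lemma proj_surjective (u : E4) : Function.Surjective (proj u) := fun w =>
  ⟨w, Submodule.orthogonalProjectionOnto_mem_subspace_eq_self w⟩

lemma proj_eq_iff {u x y : E4} : proj u x = proj u y ↔ ∃ t : ℝ, y = x + t • u := by
  rw [eq_comm, ← sub_eq_zero, ← map_sub, Submodule.orthogonalProjectionOnto_eq_zero_iff,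
    Submodule.orthogonal_orthogonal, Submodule.mem_span_singleton]
  exact exists_congr fun t => by rw [eq_sub_iff_add_eq', eq_comm]

lemma inner_proj_proj {u : E4} (hu : ‖u‖ = 1) (x y : E4) :
    inner ℝ (proj u x) (proj u y) = inner ℝ x y - inner ℝ u x * inner ℝ u y := by
  rw [Submodule.inner_orthogonalProjectionOnto_eq_of_mem_right,
    Submodule.orthogonalProjectionOnto_orthogonal]
  simp only [Submodule.starProjection_unit_singleton ℝ hu, inner_sub_right, inner_smul_right]
  rw [real_inner_comm u x]
  ring

lemma sum_sq_eq_one {u : E4} (hu : ‖u‖ = 1) : ∑ i, u i ^ 2 = 1 := by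
  have h := EuclideanSpace.norm_sq_eq u
  rw [hu] at h
  simpa using h.symm

end Projection

/-! ### Hausdorff measures of projected faces -/

section Faces

/-- The face of the cube on which the coordinates in `s` agree with those of `c`. -/
def face (s : Finset (Fin 4)) (c : Fin 4 → ℝ) : Set E4 :=
  {x | x ∈ cube ∧ ∀ i ∈ s, x i = c i}

/-- Extension of a vector by the prescribed coordinates `c` on `s`. -/
noncomputable def extend (s : Finset (Fin 4)) (c : Fin 4 → ℝ)
    (y : EuclideanSpace ℝ {i // i ∉ s}) : E4 :=
  WithLp.toLp 2 fun i => if h : i ∈ s then c i else y ⟨i, h⟩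

/-- Extension by zero, as a linear map. -/
noncomputable def extendZero (s : Finset (Fin 4)) : EuclideanSpace ℝ {i // i ∉ s} →ₗ[ℝ] E4 where
  toFun := extend s 0
  map_add' x y := by ext i; by_cases h : i ∈ s <;> simp [extend, h]
  map_smul' r x := by ext i; by_cases h : i ∈ s <;> simp [extend, h]

lemma extend_eq (s : Finset (Fin 4)) (c : Fin 4 → ℝ) (y : EuclideanSpace ℝ {i // i ∉ s}) :
    extend s c y = extend s c 0 + extendZero s y := by
  ext i; by_cases h : i ∈ s <;> simp [extend, extendZero, h]

/-- The unit box in the free coordinates. -/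
def box (ι : Type*) [Fintype ι] : Set (EuclideanSpace ℝ ι) := {y | ∀ i, |y i| ≤ 1 / 2}

lemma volume_box (ι : Type*) [Fintype ι] : volume (box ι) = 1 := by
  have h := (EuclideanSpace.volume_preserving_symm_measurableEquiv_toLp ι).measure_preimage
    (s := Set.Icc (fun _ => -(1 / 2)) (fun _ => (1 / 2))) measurableSet_Icc.nullMeasurableSet
  rw [Real.volume_Icc_pi] at h
  have e : box ι = (MeasurableEquiv.toLp 2 (ι → ℝ)).symm ⁻¹'
      Set.Icc (fun _ => -(1 / 2)) (fun _ => (1 / 2)) := by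
    ext y
    simp only [box, abs_le, Set.mem_preimage, Set.mem_Icc, Pi.le_def, Set.mem_ofPred_eq,
      forall_and]
    rfl
  rw [e, h]
  norm_num

lemma volume_coordinate_hyperplane {ι : Type*} [Fintype ι] (i : ι) (a : ℝ) :
    volume {y : EuclideanSpace ℝ ι | y i = a} = 0 := by
  have hm : MeasurableSet {f : ι → ℝ | f i = a} := measurableSet_eq_fun (measurable_pi_apply i)
    measurable_const
  have h := (EuclideanSpace.volume_preserving_symm_measurableEquiv_toLp ι).measure_preimage
    hm.nullMeasurableSet
  exact h.trans (volume_pi (ι := ι) (α := fun _ => ℝ) ▸ Measure.pi_hyperplane (fun _ : ι => (volume : Measure ℝ)) i a)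

lemma face_eq_image {s : Finset (Fin 4)} {c : Fin 4 → ℝ} (hc : ∀ i ∈ s, |c i| ≤ 1 / 2) :
    face s c = extend s c '' box {i // i ∉ s} := by
  ext x
  constructor
  · rintro ⟨h1, h2⟩
    refine ⟨WithLp.toLp 2 fun i => x i, fun i => h1 i, ?_⟩
    ext i
    by_cases h : i ∈ s <;> simp [extend, h, h2]
  · rintro ⟨y, hy, rfl⟩
    refine ⟨fun i => ?_, fun i hi => by simp [extend, hi]⟩
    by_cases h : i ∈ s
    · simpa [extend, h] using hc i h
    · simpa [extend, h] using hy ⟨i, h⟩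

/-- The Gram matrix of the projected free basis vectors is the rank-one perturbation `1 - u uᵀ` on
the indices outside `s`. Its determinant is `1 - ∑ i ∉ s, u i ^ 2`, which is the sum over `s`
because `u` is a unit vector. -/
lemma normDet_proj_extendZero {u : E4} (hu : ‖u‖ = 1) (s : Finset (Fin 4)) :
    ((proj u).toLinearMap ∘ₗ extendZero s).normDet = √(∑ i ∈ s, u i ^ 2) := by
  have hb : ∀ i, extendZero s (EuclideanSpace.basisFun {i // i ∉ s} ℝ i) =
      EuclideanSpace.single (i : Fin 4) 1 := by
    intro i
    ext j
    by_cases h : j ∈ s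
    · have : j ≠ i := fun e => i.2 (e ▸ h)
      simp [extendZero, extend, h, this]
    · simp [extendZero, extend, h, Subtype.ext_iff]
  have h := LinearMap.normDet_sq_eq_det_gram ((proj u).toLinearMap ∘ₗ extendZero s)
    (EuclideanSpace.basisFun {i // i ∉ s} ℝ)
  have hG : (Matrix.gram ℝ fun i => ((proj u).toLinearMap ∘ₗ extendZero s)
      (EuclideanSpace.basisFun {i // i ∉ s} ℝ i)) =
      1 + Matrix.replicateCol Unit (fun i : {i // i ∉ s} => -u i) *
        Matrix.replicateRow Unit (fun i : {i // i ∉ s} => u i) := by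
    ext i j
    simp only [Matrix.gram_apply, LinearMap.comp_apply, hb, ContinuousLinearMap.coe_coe,
      inner_proj_proj hu]
    simp [Matrix.one_apply, Matrix.mul_apply, EuclideanSpace.inner_single_right,
      Subtype.ext_iff]
    by_cases e : (i : Fin 4) = j
    · simp [e, sub_eq_add_neg]
    · simp [e, Ne.symm e]
  rw [hG, Matrix.det_one_add_replicateCol_mul_replicateRow] at h
  have hsum : 1 + (fun i : {i // i ∉ s} => u i) ⬝ᵥ (fun i : {i // i ∉ s} => -u i) =
      ∑ i ∈ s, u i ^ 2 := by
    rw [← sum_sq_eq_one hu, ← Finset.sum_add_sum_compl s, dotProduct]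
    have : ∑ i : {i // i ∉ s}, u i * -u i = -∑ i ∈ sᶜ, u i ^ 2 := by
      rw [← Finset.sum_neg_distrib, Finset.sum_subtype (p := fun i => i ∉ s) sᶜ (by simp)]
      exact Finset.sum_congr rfl fun i _ => by ring
    rw [this]; ring
  rw [hsum] at h
  rw [← h]
  simp [Real.sqrt_sq (LinearMap.normDet_nonneg _)]

/-- Fixing coordinates only translates the linear image, so the measure is scaled by the volume
factor just computed. -/
lemma measure_proj_extend {u : E4} (hu : ‖u‖ = 1) {s : Finset (Fin 4)} {d : ℕ}
    (hd : s.card + d = 4) (c : Fin 4 → ℝ) (A : Set (EuclideanSpace ℝ {i // i ∉ s})) :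
    μHE[d] (proj u '' (extend s c '' A)) = ENNReal.ofReal √(∑ i ∈ s, u i ^ 2) * volume A := by
  have hf : Module.finrank ℝ (EuclideanSpace ℝ {i // i ∉ s}) = d := by
    rw [finrank_euclideanSpace, Fintype.card_subtype_compl]
    simp; omega
  have h := ((proj u).toLinearMap ∘ₗ extendZero s).euclideanHausdorffMeasure_image_eq_normDet_mul_volume A
  rw [hf, normDet_proj_extendZero hu] at h
  rw [← h, Set.image_image]
  have e : (fun y => proj u (extend s c y)) '' A = (fun w => proj u (extend s c 0) + w) ''
      (((proj u).toLinearMap ∘ₗ extendZero s) '' A) := by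
    rw [Set.image_image]
    refine Set.image_congr fun y _ => ?_
    rw [extend_eq s c y, map_add]
    rfl
  rw [e, Set.image_add_left, measure_preimage_add]

theorem measure_proj_face {u : E4} (hu : ‖u‖ = 1) {s : Finset (Fin 4)} {d : ℕ}
    (hd : s.card + d = 4) {c : Fin 4 → ℝ} (hc : ∀ i ∈ s, |c i| ≤ 1 / 2) :
    μHE[d] (proj u '' face s c) = ENNReal.ofReal √(∑ i ∈ s, u i ^ 2) := by
  rw [face_eq_image hc, measure_proj_extend hu hd, volume_box, mul_one]

/-- In the free coordinates this is part of a hyperplane, hence null; overlaps of projected faces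
are discarded through it. -/
theorem measure_proj_face_boundary {u : E4} (hu : ‖u‖ = 1) {s : Finset (Fin 4)} {d : ℕ}
    (hd : s.card + d = 4) {c : Fin 4 → ℝ} {j : Fin 4} (hj : j ∉ s) (a : ℝ) :
    μHE[d] (proj u '' {x ∈ face s c | x j = a}) = 0 := by
  refine measure_mono_null (Set.image_mono (t := extend s c '' {y | y ⟨j, hj⟩ = a}) ?_) ?_
  · rintro x ⟨⟨_, h2⟩, h3⟩
    refine ⟨WithLp.toLp 2 fun i => x i, h3, ?_⟩
    ext i
    by_cases h : i ∈ s <;> simp [extend, h, h2]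
  · rw [measure_proj_extend hu hd, volume_coordinate_hyperplane, mul_zero]

lemma isCompact_cube : IsCompact cube := by
  refine Metric.isCompact_of_isClosed_isBounded ?_ ?_
  · simp only [cube, Set.ofPred_forall]
    exact isClosed_iInter fun i => isClosed_le (by fun_prop) continuous_const
  · refine (Metric.isBounded_closedBall (x := (0 : E4)) (r := 1)).subset fun x hx => ?_
    rw [mem_closedBall_zero_iff, EuclideanSpace.norm_eq, Real.sqrt_le_one]
    have : ∀ i, ‖x i‖ ^ 2 ≤ 1 / 4 := fun i => by
      rw [Real.norm_eq_abs]
      have := hx i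
      nlinarith [abs_nonneg (x i)]
    calc _ ≤ ∑ _i : Fin 4, (1 / 4 : ℝ) := Finset.sum_le_sum fun i _ => this i
      _ = 1 := by simp

lemma isCompact_face (s : Finset (Fin 4)) (c : Fin 4 → ℝ) : IsCompact (face s c) := by
  refine isCompact_cube.of_isClosed_subset ?_ fun x hx => hx.1
  refine isCompact_cube.isClosed.inter ?_
  have : {x : E4 | ∀ i ∈ s, x i = c i} = ⋂ i ∈ s, {x | x i = c i} := by ext; simp
  change IsClosed {x : E4 | ∀ i ∈ s, x i = c i}
  rw [this]
  exact isClosed_biInter fun i _ => isClosed_eq (by fun_prop) continuous_const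

/-- The measure of a union of projected faces, any two of which meet only in relative boundary
points. -/
theorem measure_iUnion_proj_face {u : E4} (hu : ‖u‖ = 1) {ι : Type*} [Fintype ι] {d : ℕ}
    {s : ι → Finset (Fin 4)} (hd : ∀ p, (s p).card + d = 4) {c : ι → Fin 4 → ℝ}
    (hc : ∀ p, ∀ i ∈ s p, |c p i| ≤ 1 / 2)
    (h : ∀ p q, p ≠ q → ∀ x ∈ face (s p) (c p), ∀ y ∈ face (s q) (c q), proj u x = proj u y →
      ∃ j, j ∉ s p ∧ |x j| = 1 / 2) :
    (μHE[d] : Measure (Submodule.span ℝ {u})ᗮ).real (⋃ p, proj u '' face (s p) (c p)) =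
      ∑ p, √(∑ i ∈ s p, u i ^ 2) := by
  rw [Measure.real, measure_iUnion₀]
  · simp_rw [measure_proj_face hu (hd _) (hc _)]
    rw [tsum_fintype, ENNReal.toReal_sum (by simp)]
    simp
  -- It suffices that every overlap point comes from the relative boundary of the first face, where
  -- some free coordinate is `±1/2`.
  · intro p q hpq
    refine measure_mono_null (t := ⋃ j, ⋃ (hj : j ∉ s p),
      (proj u '' {x ∈ face (s p) (c p) | x j = 1 / 2} ∪
        proj u '' {x ∈ face (s p) (c p) | x j = -(1 / 2)})) ?_ ?_
    · rintro _ ⟨⟨x, hx, rfl⟩, ⟨y, hy, hxy⟩⟩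
      obtain ⟨j, hj, hx'⟩ := h p q hpq x hx y hy hxy.symm
      simp only [Set.mem_iUnion]
      refine ⟨j, hj, ?_⟩
      rcases eq_or_eq_neg_of_abs_eq hx' with e | e
      · exact Or.inl ⟨x, ⟨hx, e⟩, rfl⟩
      · exact Or.inr ⟨x, ⟨hx, e⟩, rfl⟩
    · simp only [measure_iUnion_null_iff]
      intro j hj
      exact measure_union_null (measure_proj_face_boundary hu (hd p) hj _)
        (measure_proj_face_boundary hu (hd p) hj _)
  · intro p
    exact ((isCompact_face _ _).image (proj u).continuous).measurableSet.nullMeasurableSet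

end Faces

/-! ### Volume and surface area of the shadow -/

section Shadow

/-- The vertex of the cube in the closed orthant of `u`. -/
noncomputable def corner (u : E4) (i : Fin 4) : ℝ := if 0 < u i then 1 / 2 else -(1 / 2)

lemma abs_corner (u : E4) (i : Fin 4) : |corner u i| = 1 / 2 := by
  unfold corner; split_ifs <;> norm_num [abs_of_pos]

lemma corner_mul_self (u : E4) (i : Fin 4) : corner u i * corner u i = 1 / 4 := by
  unfold corner; split_ifs <;> norm_num

lemma corner_mul (u : E4) (i : Fin 4) : corner u i * u i = |u i| / 2 := by
  unfold corner; split_ifs with h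
  · rw [abs_of_pos h]; ring
  · rw [abs_of_nonpos (not_lt.1 h)]; ring

lemma corner_neg {u : E4} {i : Fin 4} (h : u i ≠ 0) : corner (-u) i = -corner u i := by
  rcases lt_or_gt_of_ne h with h | h <;> simp [corner, h, h.not_gt]

/-- Multiplying by `corner u` normalises signs: the exit facets sit at `1/4` and the entry facets at
`-1/4` in every coordinate. -/
lemma mem_cube_iff (u x : E4) : x ∈ cube ↔ ∀ i, |corner u i * x i| ≤ 1 / 4 := by
  refine forall_congr' fun i => ?_
  rw [abs_mul, abs_corner]
  constructor <;> intro h <;> linarith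

lemma mem_interior_cube (u x : E4) (h : ∀ i, |corner u i * x i| < 1 / 4) : x ∈ interior cube := by
  have ho : IsOpen {x : E4 | ∀ i, |corner u i * x i| < 1 / 4} := by
    simp only [Set.ofPred_forall]
    exact isOpen_iInter_of_finite fun i => isOpen_lt (by fun_prop) continuous_const
  exact interior_maximal (fun y hy => (mem_cube_iff u y).2 fun i => (hy i).le) ho h

/-- All sign-normalised coordinates grow along the line, at rate `|u i| / 2`. Hence no point on an
exit facet can be moved forward inside the cube, and none on an entry facet backward. -/
lemma corner_mul_line (u x : E4) (t : ℝ) (i : Fin 4) :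
    corner u i * (x + t • u) i = corner u i * x i + t * |u i| / 2 := by
  simp only [PiLp.add_apply, PiLp.smul_apply, smul_eq_mul]
  linear_combination t * corner_mul u i

lemma nonpos_of_eq_corner {u x : E4} {t : ℝ} {i : Fin 4} (h0 : u i ≠ 0)
    (h : x + t • u ∈ cube) (hx : x i = corner u i) : t ≤ 0 := by
  have h1 := abs_le.1 ((mem_cube_iff u _).1 h i)
  rw [corner_mul_line, hx, corner_mul_self] at h1
  have := abs_pos.2 h0
  by_contra! ht
  nlinarith [mul_pos ht this]

lemma nonneg_of_eq_neg_corner {u x : E4} {t : ℝ} {i : Fin 4} (h0 : u i ≠ 0)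
    (h : x + t • u ∈ cube) (hx : x i = -corner u i) : 0 ≤ t := by
  have h1 := abs_le.1 ((mem_cube_iff u _).1 h i)
  rw [corner_mul_line, hx, mul_neg, corner_mul_self] at h1
  have := abs_pos.2 h0
  by_contra! ht
  nlinarith [mul_neg_of_neg_of_pos ht this]

lemma exists_exit {u x : E4} (h0 : ∀ i, u i ≠ 0) (hx : x ∈ cube) :
    ∃ t : ℝ, 0 ≤ t ∧ x + t • u ∈ cube ∧ ∃ i, (x + t • u) i = corner u i := by
  have hpos : ∀ i, 0 < |u i| := fun i => abs_pos.2 (h0 i)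
  have hc := fun i => abs_le.1 ((mem_cube_iff u x).1 hx i)
  -- The exit time is the smallest of the times at which the individual coordinates reach their exit
  -- facets.
  obtain ⟨k, -, hk⟩ := Finset.exists_min_image Finset.univ
    (fun i => (1 / 4 - corner u i * x i) / (|u i| / 2)) Finset.univ_nonempty
  set t := (1 / 4 - corner u k * x k) / (|u k| / 2) with ht
  have ht0 : 0 ≤ t := div_nonneg (by linarith [hc k]) (by linarith [hpos k])
  refine ⟨t, ht0, (mem_cube_iff u _).2 fun i => ?_, k, ?_⟩
  · have h1 := hk i (Finset.mem_univ i)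
    rw [le_div_iff₀ (by linarith [hpos i])] at h1
    have h2 := mul_nonneg ht0 (hpos i).le
    rw [corner_mul_line, abs_le]
    constructor <;> linarith [hc i]
  · have h1 : corner u k * (x + t • u) k = corner u k * corner u k := by
      rw [corner_mul_line, corner_mul_self, ht]
      have := (hpos k).ne'
      field_simp
      ring
    exact mul_left_cancel₀ (fun h => by simpa [h] using corner_mul_self u k) h1

lemma exists_entry {u x : E4} (h0 : ∀ i, u i ≠ 0) (hx : x ∈ cube) :
    ∃ t : ℝ, x + t • u ∈ cube ∧ ∃ i, (x + t • u) i = -corner u i := by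
  obtain ⟨t, -, h1, i, h2⟩ := exists_exit (u := -u) (x := x) (fun i => by simpa using h0 i) hx
  refine ⟨-t, by simpa using h1, i, ?_⟩
  rw [← corner_neg (h0 i), ← h2]
  simp

lemma shadow_eq_iUnion {u : E4} (h0 : ∀ i, u i ≠ 0) :
    shadow u = ⋃ i, proj u '' face {i} (corner u) := by
  rw [shadow_eq, ← Set.image_iUnion]
  refine Set.Subset.antisymm ?_ (Set.image_mono (Set.iUnion_subset fun i x hx => hx.1))
  rintro _ ⟨x, hx, rfl⟩
  obtain ⟨t, -, h1, i, h2⟩ := exists_exit h0 hx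
  refine ⟨x + t • u, Set.mem_iUnion.2 ⟨i, h1, by simpa using h2⟩, (proj_eq_iff.2 ⟨t, rfl⟩).symm⟩

lemma finrank_orthogonal {u : E4} (hu : ‖u‖ = 1) :
    Module.finrank ℝ (Submodule.span ℝ {u})ᗮ = 3 := by
  have : Fact (Module.finrank ℝ E4 = 3 + 1) := ⟨by simp⟩
  exact Submodule.finrank_orthogonal_span_singleton (by rintro rfl; simp at hu)

/-- If points of two exit facets lie on one line, neither can precede the other, so they coincide.
The common point then has the other facet's coordinate equal to `±1/2`, so the overlap is null. -/
theorem vl_eq {u : E4} (hu : ‖u‖ = 1) (h0 : ∀ i, u i ≠ 0) : vl u = ∑ i, |u i| := by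
  have h := measure_iUnion_proj_face hu (ι := Fin 4) (d := 3) (s := fun i => {i}) (fun p => rfl)
    (c := fun _ => corner u) (fun p i _ => (abs_corner u i).le) ?_
  · rw [← shadow_eq_iUnion h0] at h
    rw [vl, vol, ← InnerProductSpace.euclideanHausdorffMeasure_eq_volume, finrank_orthogonal hu, h]
    simp [Real.sqrt_sq_eq_abs]
  · intro p q hpq x hx y hy hxy
    obtain ⟨t, rfl⟩ := proj_eq_iff.1 hxy
    have hy2 : (x + t • u) q = corner u q := hy.2 q (by simp)
    have h1 : t ≤ 0 := nonpos_of_eq_corner (h0 p) hy.1 (hx.2 p (by simp))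
    have h2 : -t ≤ 0 := nonpos_of_eq_corner (h0 q) (x := x + t • u) (by simpa using hx.1) hy2
    obtain rfl : t = 0 := by linarith
    refine ⟨q, by simpa using Ne.symm hpq, ?_⟩
    rw [← abs_corner u q, ← hy2]
    simp

/-- The vertex of the cube with the coordinates of `corner u` at `k` and of `-corner u`
elsewhere. -/
noncomputable def mixedCorner (u : E4) (k i : Fin 4) : ℝ :=
  if i = k then corner u i else -corner u i

lemma frontier_shadow {u : E4} (h0 : ∀ i, u i ≠ 0) :
    frontier (shadow u) = ⋃ p : {p : Fin 4 × Fin 4 // p.1 ≠ p.2},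
      proj u '' face {p.1.1, p.1.2} (mixedCorner u p.1.1) := by
  have hcl : IsClosed (shadow u) := (isCompact_cube.image (proj u).continuous).isClosed
  have hne : ∀ i, corner u i ≠ -corner u i := fun i h => by
    have := corner_mul_self u i
    rw [show corner u i = 0 by linarith] at this
    norm_num at this
  rw [hcl.frontier_eq]
  ext w
  simp only [Set.mem_sdiff, Set.mem_iUnion]
  constructor
  · rintro ⟨⟨x₀, hx₀, rfl⟩, hw⟩
    obtain ⟨t₀, hx, l, hl⟩ := exists_entry h0 hx₀
    rw [show (Submodule.span ℝ {u})ᗮ.orthogonalProjectionOnto x₀ = proj u (x₀ + t₀ • u) from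
      proj_eq_iff.2 ⟨t₀, rfl⟩] at hw ⊢
    generalize x₀ + t₀ • u = x at hx hl hw
    -- Time `t` runs from an entry point to an exit point. If `t = 0` the point lies on both kinds
    -- of facet; if `t > 0` the midpoint is interior to the cube, and the projection is open.
    obtain ⟨t, ht, hy, k, hk⟩ := exists_exit h0 hx
    rcases ht.eq_or_lt with rfl | ht
    · rw [zero_smul, add_zero] at hk
      have hkl : k ≠ l := by
        rintro rfl
        exact hne _ (hk.symm.trans hl)
      refine ⟨⟨(k, l), hkl⟩, x, ⟨hx, ?_⟩, rfl⟩
      intro i hi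
      simp only [Finset.mem_insert, Finset.mem_singleton] at hi
      rcases hi with rfl | rfl
      · simpa [mixedCorner] using hk
      · simpa [mixedCorner, hkl.symm] using hl
    · refine absurd ?_ hw
      have hm : x + (t / 2) • u ∈ interior cube := by
        refine mem_interior_cube u _ fun i => ?_
        have h1 := abs_le.1 ((mem_cube_iff u _).1 hx i)
        have h2 := abs_le.1 ((mem_cube_iff u _).1 hy i)
        have h3 := mul_pos ht (abs_pos.2 (h0 i))
        rw [corner_mul_line] at h2
        rw [corner_mul_line, abs_lt]
        constructor <;> linarith
      rw [show proj u x = proj u (x + (t / 2) • u) from proj_eq_iff.2 ⟨t / 2, rfl⟩]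
      have ho : IsOpenMap (proj u) := (proj u).isOpenMap (proj_surjective u)
      exact interior_maximal (Set.image_mono interior_subset) (ho _ isOpen_interior)
        (Set.mem_image_of_mem _ hm)
  · rintro ⟨⟨⟨k, l⟩, hkl⟩, x, hx, rfl⟩
    refine ⟨⟨x, hx.1, rfl⟩, fun hi => ?_⟩
    have hxk : x k = corner u k := by simpa [mixedCorner] using hx.2 k (by simp)
    have hxl : x l = -corner u l := by
      simpa [mixedCorner, Ne.symm hkl] using hx.2 l (by simp)
    -- The perturbation `n` pushes coordinates `k` and `l` outward. Returning to the cube along `u`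
    -- would need `t < 0` for `k` and `t > 0` for `l`, so the perturbed point leaves the shadow.
    set n : E4 := EuclideanSpace.single k (corner u k) - EuclideanSpace.single l (corner u l)
      with hn
    have hnk : n k = corner u k := by simp [hn, hkl]
    have hnl : n l = -corner u l := by simp [hn, Ne.symm hkl]
    have hcont : Continuous fun ε : ℝ => proj u (x + ε • n) := by fun_prop
    have hev : ∀ᶠ ε in nhdsWithin (0 : ℝ) (Set.Ioi 0), proj u (x + ε • n) ∈ interior (shadow u) := by
      refine Filter.Eventually.filter_mono nhdsWithin_le_nhds ?_
      exact hcont.continuousAt.eventually_mem (isOpen_interior.mem_nhds (by simpa using hi))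
    obtain ⟨ε, hε, hε0⟩ := (hev.and self_mem_nhdsWithin).exists
    replace hε0 : 0 < ε := hε0
    obtain ⟨y, hy, hxy⟩ := interior_subset hε
    obtain ⟨t, ht⟩ := proj_eq_iff.1 hxy.symm
    rw [ht] at hy
    have h1 := abs_le.1 ((mem_cube_iff u _).1 hy k)
    have h2 := abs_le.1 ((mem_cube_iff u _).1 hy l)
    rw [corner_mul_line, PiLp.add_apply, PiLp.smul_apply, smul_eq_mul, hnk, hxk, mul_add,
      corner_mul_self, mul_left_comm, corner_mul_self] at h1
    rw [corner_mul_line, PiLp.add_apply, PiLp.smul_apply, smul_eq_mul, hnl, hxl, mul_add, mul_neg,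
      corner_mul_self, mul_neg, mul_neg, mul_left_comm, corner_mul_self] at h2
    have hk := abs_pos.2 (h0 k)
    have hl := abs_pos.2 (h0 l)
    rcases le_or_gt t 0 with ht | ht
    · nlinarith [mul_nonneg (neg_nonneg.2 ht) hk.le]
    · nlinarith [mul_pos ht hl]

/-- The index is an ordered pair (exit facet, entry facet), so each unordered pair contributes two
faces. Points of two such faces on one line coincide because `t` is both nonpositive and
nonnegative; distinct pairs then fix an additional coordinate at `±1/2`. -/
theorem ar_eq {u : E4} (hu : ‖u‖ = 1) (h0 : ∀ i, u i ≠ 0) :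
    ar u = ∑ p : {p : Fin 4 × Fin 4 // p.1 ≠ p.2}, √(u p.1.1 ^ 2 + u p.1.2 ^ 2) := by
  have h := measure_iUnion_proj_face hu (ι := {p : Fin 4 × Fin 4 // p.1 ≠ p.2}) (d := 2)
    (s := fun p => {p.1.1, p.1.2}) (fun p => by rw [Finset.card_pair p.2])
    (c := fun p => mixedCorner u p.1.1)
    (fun p i _ => by unfold mixedCorner; split_ifs <;> simp [abs_corner]) ?_
  · rw [ar, surfaceArea, frontier_shadow h0, h]
    exact Finset.sum_congr rfl fun p _ => by rw [Finset.sum_pair p.2]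
  · rintro ⟨⟨k, l⟩, hkl⟩ ⟨⟨k', l'⟩, hkl'⟩ hpq x hx y hy hxy
    obtain ⟨t, rfl⟩ := proj_eq_iff.1 hxy
    have key : ∀ {z : E4} {k l : Fin 4}, k ≠ l → z ∈ face {k, l} (mixedCorner u k) →
        z k = corner u k ∧ z l = -corner u l := fun {z k l} hkl hz =>
      ⟨by simpa [mixedCorner] using hz.2 k (by simp),
        by simpa [mixedCorner, Ne.symm hkl] using hz.2 l (by simp)⟩
    obtain ⟨hk, hl⟩ := key hkl hx
    obtain rfl : t = 0 := le_antisymm (nonpos_of_eq_corner (h0 k) hy.1 hk)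
      (nonneg_of_eq_neg_corner (h0 l) hy.1 hl)
    obtain ⟨hk', hl'⟩ := key hkl' hy
    rw [zero_smul, add_zero] at hk' hl'
    have hne : ∀ i, corner u i ≠ -corner u i := fun i h => by
      have := corner_mul_self u i
      rw [show corner u i = 0 by linarith] at this
      norm_num at this
    by_cases h1 : k' = k
    · refine ⟨l', ?_, by rw [hl', abs_neg, abs_corner]⟩
      subst h1
      simp only [Finset.mem_insert, Finset.mem_singleton, not_or]
      exact ⟨Ne.symm hkl', fun h => hpq (by simp [h])⟩
    · refine ⟨k', ?_, by rw [hk', abs_corner]⟩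
      simp only [Finset.mem_insert, Finset.mem_singleton, not_or]
      refine ⟨h1, ?_⟩
      rintro rfl
      exact hne _ (hk'.symm.trans hl)

end Shadow

/-! ### Mean width of the shadow and generic directions -/

section MeanWidth

lemma sphereMean_abs_three : sphereMean (fun u : EuclideanSpace ℝ (Fin 3) => |u 0|) = 1 / 2 := by
  rw [integral_sphere3_of_prod (B := fun θ => |Real.cos θ|) (C := fun _ => 1)
    (by fun_prop) (fun θ _ φ => by simp [spherical3_zero])]
  have h := integral_sin_pow_mul_abs_cos 1
  rw [h, integral_one_arc]
  field_simp
  norm_num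

/-- The mean of `|⟨v, w⟩|` over the unit sphere of a three-dimensional space. -/
lemma integral_abs_inner {W : Type*} [NormedAddCommGroup W] [InnerProductSpace ℝ W]
    [FiniteDimensional ℝ W] [MeasurableSpace W] [BorelSpace W] (hW : Module.finrank ℝ W = 3)
    (w : W) : ∫ v, |inner ℝ (v : W) w| ∂uniformSphere W = ‖w‖ / 2 := by
  rcases eq_or_ne w 0 with rfl | hw
  · simp
  have hw' : ‖w‖ ≠ 0 := norm_ne_zero_iff.2 hw
  -- An orthonormal basis starting with `w / ‖w‖` turns the integrand into `‖w‖ * |v 0|` on the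
  -- standard sphere.
  obtain ⟨b, hb⟩ := Orthonormal.exists_orthonormalBasis_extension_of_card_eq (𝕜 := ℝ) (E := W)
    (ι := Fin 3) (by simp [hW]) (v := fun _ => ‖w‖⁻¹ • w) (s := {0}) (by
      rw [orthonormal_iff_ite]
      rintro ⟨i, hi⟩ ⟨j, hj⟩
      obtain rfl : i = 0 := hi
      obtain rfl : j = 0 := hj
      change inner ℝ (‖w‖⁻¹ • w) (‖w‖⁻¹ • w) = _
      rw [inner_smul_left, inner_smul_right, real_inner_self_eq_norm_sq]
      simp
      field_simp)
  have hb0 : b 0 = ‖w‖⁻¹ • w := hb 0 rfl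
  have h := integral_uniformSphere_comp b.repr
    (F := fun v : EuclideanSpace ℝ (Fin 3) => ‖w‖ * |v 0|) (by fun_prop)
  have e : ∀ v : W, ‖w‖ * |b.repr v 0| = |inner ℝ v w| := by
    intro v
    rw [OrthonormalBasis.repr_apply_apply, hb0, inner_smul_left, real_inner_comm, abs_mul]
    simp
    field_simp
  simp only [e] at h
  rw [h, integral_const_mul]
  change ‖w‖ * sphereMean (fun u : EuclideanSpace ℝ (Fin 3) => |u 0|) = _
  rw [sphereMean_abs_three]
  ring

lemma inner_proj_right (u x : E4) (v : (Submodule.span ℝ {u})ᗮ) :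
    inner ℝ v (proj u x) = ∑ i, (v : E4) i * x i := by
  rw [Submodule.inner_orthogonalProjectionOnto_eq_of_mem_left, PiLp.inner_apply]
  exact Finset.sum_congr rfl fun i _ => mul_comm _ _

/-- Since `v ⊥ u`, projecting does not change the inner product with `v`. The linear form is
extremal on the cube at the vertices `± corner v`. -/
lemma width_shadow (u : E4) (v : (Submodule.span ℝ {u})ᗮ) :
    width (shadow u) v = ∑ i, |(v : E4) i| := by
  have hb : ∀ x ∈ cube, |∑ i, (v : E4) i * x i| ≤ (∑ i, |(v : E4) i|) / 2 := by
    intro x hx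
    refine (Finset.abs_sum_le_sum_abs _ _).trans ?_
    rw [Finset.sum_div]
    refine Finset.sum_le_sum fun i _ => ?_
    rw [abs_mul]
    nlinarith [hx i, abs_nonneg ((v : E4) i)]
  have hc : ∀ ε : ℝ, |ε| = 1 → (WithLp.toLp 2 fun i => ε * corner (v : E4) i : E4) ∈ cube := by
    intro ε hε i
    change |ε * corner (v : E4) i| ≤ 1 / 2
    rw [abs_mul, hε, abs_corner, one_mul]
  have hv : ∀ ε : ℝ, inner ℝ v (proj u (WithLp.toLp 2 fun i => ε * corner (v : E4) i)) =
      ε * ((∑ i, |(v : E4) i|) / 2) := by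
    intro ε
    rw [inner_proj_right, Finset.sum_div, Finset.mul_sum]
    refine Finset.sum_congr rfl fun i _ => ?_
    change (v : E4) i * (ε * corner (v : E4) i) = _
    rw [← corner_mul]; ring
  have h1 : IsGreatest ((fun p => inner ℝ v p) '' shadow u) ((∑ i, |(v : E4) i|) / 2) := by
    refine ⟨⟨_, ⟨_, hc 1 (by simp), rfl⟩, (hv 1).trans (one_mul _)⟩, ?_⟩
    rintro _ ⟨_, ⟨x, hx, rfl⟩, rfl⟩
    exact (inner_proj_right u x v).trans_le (abs_le.1 (hb x hx)).2
  have h2 : IsLeast ((fun p => inner ℝ v p) '' shadow u) (-((∑ i, |(v : E4) i|) / 2)) := by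
    refine ⟨⟨_, ⟨_, hc (-1) (by simp), rfl⟩, (hv (-1)).trans (by ring)⟩, ?_⟩
    rintro _ ⟨_, ⟨x, hx, rfl⟩, rfl⟩
    exact (abs_le.1 (hb x hx)).1.trans_eq (inner_proj_right u x v).symm
  rw [width, h1.csSup_eq, h2.csInf_eq]
  ring

/-- Each `|v i|` is `|⟨v, proj e_i⟩|`, whose mean is half of `‖proj e_i‖ = √(1 - u i ^ 2)`. -/
theorem mw_eq {u : E4} (hu : ‖u‖ = 1) : mw u = ∑ i, √(1 - u i ^ 2) / 2 := by
  have hW := finrank_orthogonal hu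
  have : Nontrivial (Submodule.span ℝ {u})ᗮ := Module.nontrivial_of_finrank_pos (R := ℝ) (by omega)
  have e : ∀ (v : (Submodule.span ℝ {u})ᗮ) (i : Fin 4),
      |(v : E4) i| = |inner ℝ v (proj u (EuclideanSpace.single i 1))| := by
    intro v i
    rw [inner_proj_right]
    simp
  rw [mw, meanWidth]
  simp only [width_shadow, e]
  rw [integral_finsetSum]
  · refine Finset.sum_congr rfl fun i _ => ?_
    rw [integral_abs_inner hW, norm_eq_sqrt_real_inner, inner_proj_proj hu]
    simp [pow_two, EuclideanSpace.inner_single_right]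
  · intro i _
    refine Integrable.of_bound (C := ‖proj u (EuclideanSpace.single i 1)‖) (by fun_prop)
      (Filter.Eventually.of_forall fun v => ?_)
    rw [Real.norm_eq_abs, abs_abs]
    simpa using abs_real_inner_le_norm (v : (Submodule.span ℝ {u})ᗮ) (proj u (EuclideanSpace.single i 1))

/-- Almost every direction has no vanishing coordinate. -/
lemma ae_apply_ne_zero : ∀ᵐ v : Metric.sphere (0 : E4) 1 ∂uniformSphere E4,
    ∀ i, (v : E4) i ≠ 0 := by
  rw [ae_all_iff]
  intro i
  have hs : MeasurableSet {x : E4 | x i = 0} := measurableSet_eq_fun (by fun_prop) measurable_const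
  have h := map_coe_toSphere_apply (E := E4) hs
  rw [Measure.map_apply measurable_subtype_coe hs] at h
  have h0 : volume {x : E4 | 0 < ‖x‖ ∧ ‖x‖ < 1 ∧ ‖x‖⁻¹ • x ∈ {x : E4 | x i = 0}} = 0 := by
    refine measure_mono_null ?_ (volume_coordinate_hyperplane i 0)
    rintro x ⟨h1, -, h3⟩
    simpa [h1.ne', norm_pos_iff.1 h1] using h3
  rw [h0, mul_zero] at h
  rw [ae_iff, uniformSphere, Measure.smul_apply]
  simp only [not_not]
  exact (congrArg _ h).trans (mul_zero _)

end MeanWidth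

/-! ### First and second moments of the three symmetric sums -/

section Moments

/-- The volume of the shadow as a function of the direction. -/
noncomputable def absSum (u : E4) : ℝ := ∑ i, |u i|

/-- The surface area of the shadow as a function of the direction. -/
noncomputable def pairSum (u : E4) : ℝ := ∑ k, ∑ l, if k = l then 0 else √(u k ^ 2 + u l ^ 2)

/-- The mean width of the shadow as a function of the direction. -/
noncomputable def coSum (u : E4) : ℝ := ∑ i, √(1 - u i ^ 2) / 2

@[fun_prop]
lemma continuous_absSum : Continuous absSum := by unfold absSum; fun_prop

@[fun_prop]
lemma continuous_pairSum : Continuous pairSum := by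
  refine continuous_finsetSum _ fun k _ => continuous_finsetSum _ fun l _ => ?_
  split_ifs <;> fun_prop

@[fun_prop]
lemma continuous_coSum : Continuous coSum := by unfold coSum; fun_prop

lemma pairSum_eq (u : E4) : pairSum u = ∑ p : {p : Fin 4 × Fin 4 // p.1 ≠ p.2},
    √(u p.1.1 ^ 2 + u p.1.2 ^ 2) := by
  rw [pairSum, ← Fintype.sum_prod_type' (f := fun k l => if k = l then 0 else √(u k ^ 2 + u l ^ 2)),
    ← Finset.sum_subtype (Finset.univ.filter fun p : Fin 4 × Fin 4 => p.1 ≠ p.2) (by simp)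
      (fun p => √(u p.1 ^ 2 + u p.2 ^ 2)), Finset.sum_filter]
  exact Finset.sum_congr rfl fun p _ => by by_cases h : p.1 = p.2 <;> simp [h]

/-- Invariance under permutations of the coordinates. -/
def IsSymm (F : E4 → ℝ) : Prop :=
  ∀ (σ : Equiv.Perm (Fin 4)) (u : E4), F (WithLp.toLp 2 fun i => u (σ i)) = F u

lemma isSymm_const (c : ℝ) : IsSymm fun _ => c := fun _ _ => rfl

lemma isSymm_absSum : IsSymm absSum := fun σ u => Equiv.sum_comp σ fun i => |u i|

lemma isSymm_pairSum : IsSymm pairSum := fun σ u => by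
  have h : ∀ k l, (if k = l then 0 else √(u (σ k) ^ 2 + u (σ l) ^ 2)) =
      if σ k = σ l then 0 else √(u (σ k) ^ 2 + u (σ l) ^ 2) := fun k l => by
    simp only [σ.injective.eq_iff]
  simp only [pairSum, h]
  rw [Equiv.sum_comp σ fun k => ∑ l, if k = σ l then 0 else √(u k ^ 2 + u (σ l) ^ 2)]
  exact Finset.sum_congr rfl fun k _ =>
    Equiv.sum_comp σ fun l => if k = l then 0 else √(u k ^ 2 + u l ^ 2)

lemma isSymm_coSum : IsSymm coSum := fun σ u => Equiv.sum_comp σ fun i => √(1 - u i ^ 2) / 2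

lemma sphereMean_reindex (f : Fin 4 → Fin 4) (hf : Function.Injective f) {F : E4 → ℝ}
    (hF : Continuous F) :
    sphereMean (fun u => F (WithLp.toLp 2 fun i => u (f i))) = sphereMean F :=
  sphereMean_perm (Equiv.ofBijective f (Finite.injective_iff_bijective.1 hf)) hF.measurable

/-- Transport of a mean value along a permutation of the coordinates, given as a list. -/
lemma sphereMean_eq_of_reindex {F G : E4 → ℝ} {c : ℝ} (h : sphereMean F = c)
    (f : Fin 4 → Fin 4) (hf : Function.Injective f) (hF : Continuous F)
    (hG : ∀ u, G u = F (WithLp.toLp 2 fun i => u (f i))) : sphereMean G = c := by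
  rw [← h, ← sphereMean_reindex f hf hF]
  exact congrArg _ (funext hG)

lemma sphereMean_congr {F G : E4 → ℝ} (h : ∀ u, ‖u‖ = 1 → F u = G u) :
    sphereMean F = sphereMean G :=
  integral_congr_ae (Filter.Eventually.of_forall fun v => h v (by simp))

lemma sphereMean_const (c : ℝ) : sphereMean (fun _ : E4 => c) = c := by
  simp [sphereMean]

/-- Against a symmetric factor all terms of the other sum have equal mean. One representative then
suffices, with multiplicity 4 for `absSum`, 12 for `pairSum`, and 4 times one half for `coSum`. -/
lemma IsSymm.sphereMean_mul_perm {F G : E4 → ℝ} (hs : IsSymm F) (hF : Continuous F)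
    (hG : Continuous G) (σ : Equiv.Perm (Fin 4)) :
    sphereMean (fun u => G (WithLp.toLp 2 fun i => u (σ i)) * F u) =
      sphereMean (fun u => G u * F u) := by
  rw [← sphereMean_perm σ (F := fun u => G u * F u) (hG.mul hF).measurable]
  simp only [hs σ]

lemma IsSymm.sphereMean_absSum_mul {F : E4 → ℝ} (hs : IsSymm F) (hF : Continuous F) :
    sphereMean (fun u => absSum u * F u) = 4 * sphereMean (fun u => |u 0| * F u) := by
  simp only [absSum, Finset.sum_mul]
  rw [sphereMean_sum _ fun i => by fun_prop]
  have h : ∀ i : Fin 4, sphereMean (fun u => |u i| * F u) = sphereMean (fun u => |u 0| * F u) :=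
    fun i => by
      rw [← hs.sphereMean_mul_perm hF (G := fun u => |u 0|) (by fun_prop) (Equiv.swap 0 i)]
      simp
  simp [h]

lemma IsSymm.sphereMean_coSum_mul {F : E4 → ℝ} (hs : IsSymm F) (hF : Continuous F) :
    sphereMean (fun u => coSum u * F u) = 2 * sphereMean (fun u => √(1 - u 0 ^ 2) * F u) := by
  simp only [coSum, Finset.sum_mul]
  rw [sphereMean_sum _ fun i => by fun_prop]
  have h : ∀ i : Fin 4, sphereMean (fun u => √(1 - u i ^ 2) / 2 * F u) =
      1 / 2 * sphereMean (fun u => √(1 - u 0 ^ 2) * F u) := fun i => by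
    rw [← hs.sphereMean_mul_perm hF (G := fun u => √(1 - u 0 ^ 2)) (by fun_prop) (Equiv.swap 0 i),
      ← sphereMean_const_mul]
    simp only [Equiv.swap_apply_left]
    exact congrArg _ (funext fun u => by ring)
  simp only [h, Finset.sum_const, Finset.card_univ, Fintype.card_fin, nsmul_eq_mul]
  push_cast
  ring

lemma IsSymm.sphereMean_pairSum_mul {F : E4 → ℝ} (hs : IsSymm F) (hF : Continuous F) :
    sphereMean (fun u => pairSum u * F u) =
      12 * sphereMean (fun u => √(u 2 ^ 2 + u 3 ^ 2) * F u) := by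
  simp only [pairSum_eq, Finset.sum_mul]
  rw [sphereMean_sum _ fun i => by fun_prop]
  have hperm : ∀ k l : Fin 4, k ≠ l → ∃ σ : Equiv.Perm (Fin 4), σ 2 = k ∧ σ 3 = l := by decide
  have h : ∀ p : {p : Fin 4 × Fin 4 // p.1 ≠ p.2},
      sphereMean (fun u => √(u p.1.1 ^ 2 + u p.1.2 ^ 2) * F u) =
      sphereMean (fun u => √(u 2 ^ 2 + u 3 ^ 2) * F u) := fun p => by
    obtain ⟨σ, h2, h3⟩ := hperm _ _ p.2
    rw [← hs.sphereMean_mul_perm hF (G := fun u => √(u 2 ^ 2 + u 3 ^ 2)) (by fun_prop) σ, ← h2, ← h3]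
  have hc : Fintype.card {p : Fin 4 × Fin 4 // p.1 ≠ p.2} = 12 := by decide
  simp only [h, Finset.sum_const, Finset.card_univ, hc, nsmul_eq_mul]
  norm_num

lemma sphereMean_mul_absSum {G : E4 → ℝ} (hG : Continuous G) :
    sphereMean (fun u => G u * absSum u) = sphereMean (fun u => G u * |u 0|) +
      sphereMean (fun u => G u * |u 1|) + sphereMean (fun u => G u * |u 2|) +
      sphereMean (fun u => G u * |u 3|) := by
  simp only [absSum, Finset.mul_sum]
  rw [sphereMean_sum _ fun i => by fun_prop, Fin.sum_univ_four]

lemma sphereMean_mul_coSum {G : E4 → ℝ} (hG : Continuous G) :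
    sphereMean (fun u => G u * coSum u) = (sphereMean (fun u => G u * √(1 - u 0 ^ 2)) +
      sphereMean (fun u => G u * √(1 - u 1 ^ 2)) + sphereMean (fun u => G u * √(1 - u 2 ^ 2)) +
      sphereMean (fun u => G u * √(1 - u 3 ^ 2))) / 2 := by
  simp only [coSum, Finset.mul_sum]
  rw [sphereMean_sum _ fun i => by fun_prop, Fin.sum_univ_four]
  have h : ∀ i : Fin 4, sphereMean (fun u => G u * (√(1 - u i ^ 2) / 2)) =
      1 / 2 * sphereMean (fun u => G u * √(1 - u i ^ 2)) := fun i => by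
    rw [← sphereMean_const_mul]
    exact congrArg _ (funext fun u => by ring)
  rw [h, h, h, h]
  ring

lemma sphereMean_mul_pairSum {G : E4 → ℝ} (hG : Continuous G) :
    sphereMean (fun u => G u * pairSum u) =
      2 * (sphereMean (fun u => G u * √(u 0 ^ 2 + u 1 ^ 2)) +
        sphereMean (fun u => G u * √(u 0 ^ 2 + u 2 ^ 2)) +
        sphereMean (fun u => G u * √(u 0 ^ 2 + u 3 ^ 2)) +
        sphereMean (fun u => G u * √(u 1 ^ 2 + u 2 ^ 2)) +
        sphereMean (fun u => G u * √(u 1 ^ 2 + u 3 ^ 2)) +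
        sphereMean (fun u => G u * √(u 2 ^ 2 + u 3 ^ 2))) := by
  have h : (fun u => G u * pairSum u) = fun u => 2 * (G u * √(u 0 ^ 2 + u 1 ^ 2) +
      G u * √(u 0 ^ 2 + u 2 ^ 2) + G u * √(u 0 ^ 2 + u 3 ^ 2) + G u * √(u 1 ^ 2 + u 2 ^ 2) +
      G u * √(u 1 ^ 2 + u 3 ^ 2) + G u * √(u 2 ^ 2 + u 3 ^ 2)) := by
    ext u
    have h1 := add_comm (u 1 ^ 2) (u 0 ^ 2)
    have h2 := add_comm (u 2 ^ 2) (u 0 ^ 2)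
    have h3 := add_comm (u 3 ^ 2) (u 0 ^ 2)
    have h4 := add_comm (u 2 ^ 2) (u 1 ^ 2)
    have h5 := add_comm (u 3 ^ 2) (u 1 ^ 2)
    have h6 := add_comm (u 3 ^ 2) (u 2 ^ 2)
    simp [pairSum, Fin.sum_univ_four, h1, h2, h3, h4, h5, h6]
    ring
  rw [h, sphereMean_const_mul, sphereMean_add (by fun_prop) (by fun_prop),
    sphereMean_add (by fun_prop) (by fun_prop), sphereMean_add (by fun_prop) (by fun_prop),
    sphereMean_add (by fun_prop) (by fun_prop), sphereMean_add (by fun_prop) (by fun_prop)]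

lemma sphereMean_sq : sphereMean (fun u : E4 => u 0 ^ 2) = 1 / 4 := by
  have h := sphereMean_even_mul_even 1 0
  simp only [mul_one, mul_zero, pow_zero] at h
  rw [h]
  norm_num [evenMoment, Finset.prod_range_succ]

theorem sphereMean_absSum : sphereMean absSum = 16 / (3 * Real.pi) := by
  -- First moments are the case of the constant symmetric factor `1`.
  have h := (isSymm_const 1).sphereMean_absSum_mul continuous_const
  simp only [mul_one, sphereMean_abs] at h
  rw [show sphereMean absSum = _ from h]
  ring

theorem sphereMean_pairSum : sphereMean pairSum = 8 := by
  have h := (isSymm_const 1).sphereMean_pairSum_mul continuous_const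
  simp only [mul_one, sphereMean_sqrt_add] at h
  rw [show sphereMean pairSum = _ from h]
  norm_num

theorem sphereMean_coSum : sphereMean coSum = 16 / (3 * Real.pi) := by
  have h := (isSymm_const 1).sphereMean_coSum_mul continuous_const
  simp only [mul_one, sphereMean_sqrt_one_sub] at h
  rw [show sphereMean coSum = _ from h]
  ring

theorem sphereMean_absSum_mul_absSum :
    sphereMean (fun u => absSum u * absSum u) = 1 + 6 / Real.pi := by
  have h0 : sphereMean (fun u : E4 => |u 0| * |u 0|) = 1 / 4 := by
    simpa only [abs_mul_abs_self, pow_two] using sphereMean_sq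
  rw [isSymm_absSum.sphereMean_absSum_mul continuous_absSum, sphereMean_mul_absSum (by fun_prop),
    h0, sphereMean_abs_mul_abs,
    sphereMean_eq_of_reindex sphereMean_abs_mul_abs ![0, 2, 1, 3] (by decide) (by fun_prop)
      (G := fun u => |u 0| * |u 2|) fun u => rfl,
    sphereMean_eq_of_reindex sphereMean_abs_mul_abs ![0, 3, 1, 2] (by decide) (by fun_prop)
      (G := fun u => |u 0| * |u 3|) fun u => rfl]
  ring

theorem sphereMean_absSum_mul_pairSum :
    sphereMean (fun u => absSum u * pairSum u) = 6 * (1 + 4 / Real.pi) := by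
  have hs := sphereMean_abs_mul_sqrt_add_self
  have ht := sphereMean_abs_mul_sqrt_add
  rw [isSymm_pairSum.sphereMean_absSum_mul continuous_pairSum, sphereMean_mul_pairSum (by fun_prop),
    sphereMean_eq_of_reindex hs ![2, 3, 0, 1] (by decide) (by fun_prop)
      (G := fun u => |u 0| * √(u 0 ^ 2 + u 1 ^ 2)) fun u => rfl,
    sphereMean_eq_of_reindex hs ![1, 3, 0, 2] (by decide) (by fun_prop)
      (G := fun u => |u 0| * √(u 0 ^ 2 + u 2 ^ 2)) fun u => rfl,
    sphereMean_eq_of_reindex hs ![1, 2, 0, 3] (by decide) (by fun_prop)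
      (G := fun u => |u 0| * √(u 0 ^ 2 + u 3 ^ 2)) fun u => rfl,
    sphereMean_eq_of_reindex ht ![0, 3, 1, 2] (by decide) (by fun_prop)
      (G := fun u => |u 0| * √(u 1 ^ 2 + u 2 ^ 2)) fun u => rfl,
    sphereMean_eq_of_reindex ht ![0, 2, 1, 3] (by decide) (by fun_prop)
      (G := fun u => |u 0| * √(u 1 ^ 2 + u 3 ^ 2)) fun u => rfl, ht]
  ring

theorem sphereMean_absSum_mul_coSum :
    sphereMean (fun u => absSum u * coSum u) = 9 / 4 + 2 / Real.pi := by
  have ht := sphereMean_abs_mul_sqrt_one_sub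
  rw [isSymm_coSum.sphereMean_absSum_mul continuous_coSum, sphereMean_mul_coSum (by fun_prop),
    sphereMean_abs_mul_sqrt_one_sub_self,
    sphereMean_eq_of_reindex ht ![1, 0, 2, 3] (by decide) (by fun_prop)
      (G := fun u => |u 0| * √(1 - u 1 ^ 2)) fun u => rfl,
    sphereMean_eq_of_reindex ht ![2, 0, 1, 3] (by decide) (by fun_prop)
      (G := fun u => |u 0| * √(1 - u 2 ^ 2)) fun u => rfl,
    sphereMean_eq_of_reindex ht ![3, 0, 1, 2] (by decide) (by fun_prop)
      (G := fun u => |u 0| * √(1 - u 3 ^ 2)) fun u => rfl]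
  ring

/-- Fix the pair `{2, 3}`. The indices `0` and `1` outside it give the separated moment `3π / 16`,
and those inside it give the Catalan moment. -/
theorem sphereMean_pairSum_mul_coSum : sphereMean (fun u => pairSum u * coSum u) =
    3 * (5 + 2 * catalanConst) / Real.pi + 9 * Real.pi / 4 := by
  have hs := sphereMean_sqrt_add_mul_sqrt_one_sub_self
  have ht := sphereMean_sqrt_add_mul_sqrt_one_sub
  rw [isSymm_coSum.sphereMean_pairSum_mul continuous_coSum, sphereMean_mul_coSum (by fun_prop), ht,
    sphereMean_eq_of_reindex ht ![1, 0, 2, 3] (by decide) (by fun_prop)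
      (G := fun u => √(u 2 ^ 2 + u 3 ^ 2) * √(1 - u 1 ^ 2)) fun u => rfl,
    sphereMean_eq_of_reindex hs ![3, 2, 0, 1] (by decide) (by fun_prop)
      (G := fun u => √(u 2 ^ 2 + u 3 ^ 2) * √(1 - u 2 ^ 2))
      fun u => by rw [add_comm (u 2 ^ 2)]; rfl,
    sphereMean_eq_of_reindex hs ![2, 3, 0, 1] (by decide) (by fun_prop)
      (G := fun u => √(u 2 ^ 2 + u 3 ^ 2) * √(1 - u 3 ^ 2)) fun u => rfl]
  ring

/-- Relative to `{2, 3}` there are three kinds of pairs: itself, the complementary pair, and four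
pairs sharing one index. Only the last kind has no closed form here. -/
theorem sphereMean_pairSum_mul_pairSum : sphereMean (fun u => pairSum u * pairSum u) =
    12 + 3 * Real.pi + 96 * sphereMean (fun u : E4 => √(u 2 ^ 2 + u 3 ^ 2) * √(u 1 ^ 2 + u 3 ^ 2)) := by
  have hs := sphereMean_sqrt_add_mul_sqrt_add_compl
  have h0 : sphereMean (fun u : E4 => √(u 2 ^ 2 + u 3 ^ 2) * √(u 2 ^ 2 + u 3 ^ 2)) = 1 / 2 := by
    have e : (fun u : E4 => √(u 2 ^ 2 + u 3 ^ 2) * √(u 2 ^ 2 + u 3 ^ 2)) =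
        fun u => u 2 ^ 2 + u 3 ^ 2 := funext fun u => Real.mul_self_sqrt (by positivity)
    rw [e, sphereMean_add (by fun_prop) (by fun_prop),
      sphereMean_eq_of_reindex sphereMean_sq ![2, 0, 1, 3] (by decide) (by fun_prop)
        (G := fun u => u 2 ^ 2) fun u => rfl,
      sphereMean_eq_of_reindex sphereMean_sq ![3, 0, 1, 2] (by decide) (by fun_prop)
        (G := fun u => u 3 ^ 2) fun u => rfl]
    norm_num
  have hK := Eq.refl (sphereMean (fun u : E4 => √(u 2 ^ 2 + u 3 ^ 2) * √(u 1 ^ 2 + u 3 ^ 2)))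
  rw [isSymm_pairSum.sphereMean_pairSum_mul continuous_pairSum, sphereMean_mul_pairSum (by fun_prop),
    h0,
    sphereMean_eq_of_reindex hs ![2, 3, 0, 1] (by decide) (by fun_prop)
      (G := fun u => √(u 2 ^ 2 + u 3 ^ 2) * √(u 0 ^ 2 + u 1 ^ 2)) fun u => rfl,
    sphereMean_eq_of_reindex hK ![1, 0, 3, 2] (by decide) (by fun_prop)
      (G := fun u => √(u 2 ^ 2 + u 3 ^ 2) * √(u 0 ^ 2 + u 2 ^ 2))
      fun u => by rw [add_comm (u 2 ^ 2)]; rfl,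
    sphereMean_eq_of_reindex hK ![1, 0, 2, 3] (by decide) (by fun_prop)
      (G := fun u => √(u 2 ^ 2 + u 3 ^ 2) * √(u 0 ^ 2 + u 3 ^ 2)) fun u => rfl,
    sphereMean_eq_of_reindex hK ![0, 1, 3, 2] (by decide) (by fun_prop)
      (G := fun u => √(u 2 ^ 2 + u 3 ^ 2) * √(u 1 ^ 2 + u 2 ^ 2))
      fun u => by rw [add_comm (u 2 ^ 2)]; rfl]
  ring

theorem sphereMean_coSum_mul_coSum : sphereMean (fun u => coSum u * coSum u) =
    3 / 4 + 3 * sphereMean (fun u : E4 => √(1 - u 0 ^ 2) * √(1 - u 1 ^ 2)) := by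
  have h0 : sphereMean (fun u : E4 => √(1 - u 0 ^ 2) * √(1 - u 0 ^ 2)) = 3 / 4 := by
    rw [sphereMean_congr (G := fun u => 1 - u 0 ^ 2)
      fun u hu => Real.mul_self_sqrt (sub_nonneg.2 (sq_apply_le_one hu 0)),
      sphereMean_sub (by fun_prop) (by fun_prop), sphereMean_const, sphereMean_sq]
    norm_num
  have hJ := Eq.refl (sphereMean (fun u : E4 => √(1 - u 0 ^ 2) * √(1 - u 1 ^ 2)))
  rw [isSymm_coSum.sphereMean_coSum_mul continuous_coSum, sphereMean_mul_coSum (by fun_prop), h0,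
    sphereMean_eq_of_reindex hJ ![0, 2, 1, 3] (by decide) (by fun_prop)
      (G := fun u => √(1 - u 0 ^ 2) * √(1 - u 2 ^ 2)) fun u => rfl,
    sphereMean_eq_of_reindex hJ ![0, 3, 1, 2] (by decide) (by fun_prop)
      (G := fun u => √(1 - u 0 ^ 2) * √(1 - u 3 ^ 2)) fun u => rfl]
  ring

end Moments

/-! ### Transfer to the random direction, and interval estimates -/

section Law

variable {Ω : Type*} [MeasurableSpace Ω] {P : Measure Ω}
  {U : Ω → Metric.sphere (0 : E4) 1}

/-- No measurability of `X` is needed: almost sure agreement with a continuous function of the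
direction is enough, which is how the geometric characteristics enter. -/
lemma integral_law (hU : HasLaw U (uniformSphere E4) P) {X F : E4 → ℝ} (hF : Continuous F)
    (h : (fun ω => X (U ω)) =ᵐ[P] fun ω => F (U ω)) : ∫ ω, X (U ω) ∂P = sphereMean F := by
  rw [integral_congr_ae h]
  exact hU.integral_comp (f := fun v => F (v : E4)) (integrable_sphere hF).aestronglyMeasurable

lemma memLp_law [IsProbabilityMeasure P] (hU : HasLaw U (uniformSphere E4) P) {X F : E4 → ℝ} (hF : Continuous F)
    (h : (fun ω => X (U ω)) =ᵐ[P] fun ω => F (U ω)) : MemLp (fun ω => X (U ω)) 2 P := by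
  rw [memLp_congr_ae h]
  have hc : Continuous fun v : Metric.sphere (0 : E4) 1 => F v := hF.comp continuous_subtype_val
  obtain ⟨C, hC⟩ := (isCompact_range hc).isBounded.exists_norm_le
  exact MemLp.of_bound (hc.measurable.comp_aemeasurable hU.aemeasurable).aestronglyMeasurable C
    (Filter.Eventually.of_forall fun ω => hC _ ⟨U ω, rfl⟩)

lemma ae_law (hU : HasLaw U (uniformSphere E4) P) {X F : E4 → ℝ}
    (h : ∀ u : E4, ‖u‖ = 1 → (∀ i, u i ≠ 0) → X u = F u) :
    (fun ω => X (U ω)) =ᵐ[P] fun ω => F (U ω) := by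
  have h0 : ∀ᵐ ω ∂P, ∀ i, (U ω : E4) i ≠ 0 :=
    ae_of_ae_map hU.aemeasurable (hU.map_eq ▸ ae_apply_ne_zero)
  filter_upwards [h0] with ω hω
  exact h _ (by simp) hω

lemma covariance_law [IsProbabilityMeasure P] (hU : HasLaw U (uniformSphere E4) P) {X Y F G : E4 → ℝ} (hF : Continuous F)
    (hG : Continuous G) (hX : (fun ω => X (U ω)) =ᵐ[P] fun ω => F (U ω))
    (hY : (fun ω => Y (U ω)) =ᵐ[P] fun ω => G (U ω)) :
    cov[fun ω => X (U ω), fun ω => Y (U ω); P] =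
      sphereMean (fun u => F u * G u) - sphereMean F * sphereMean G := by
  rw [covariance_eq_sub (memLp_law hU hF hX) (memLp_law hU hG hY), integral_law hU hF hX,
    integral_law hU hG hY]
  congr 1
  exact integral_law hU (X := fun u => X u * Y u) (hF.mul hG) (hX.mul hY)

lemma variance_law [IsProbabilityMeasure P] (hU : HasLaw U (uniformSphere E4) P) {X F : E4 → ℝ} (hF : Continuous F)
    (hX : (fun ω => X (U ω)) =ᵐ[P] fun ω => F (U ω)) :
    Var[fun ω => X (U ω); P] = sphereMean (fun u => F u * F u) - sphereMean F * sphereMean F := by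
  rw [← covariance_self (memLp_law hU hF hX).aemeasurable, covariance_law hU hF hF hX hX]

/-- Comparing squares at the unfavourable endpoints of the enclosures removes the roots and leaves
two rational inequalities. -/
lemma div_sqrt_mul_sqrt_mem_Ico {a b c c₁ c₂ v v₁ v₂ w w₁ w₂ : ℝ} (hb : 0 ≤ b)
    (hc₁ : 0 ≤ c₁) (hv₁ : 0 < v₁) (hw₁ : 0 < w₁) (hc : c ∈ Set.Icc c₁ c₂) (hv : v ∈ Set.Icc v₁ v₂)
    (hw : w ∈ Set.Icc w₁ w₂) (h₁ : a ^ 2 * (v₂ * w₂) ≤ c₁ ^ 2) (h₂ : c₂ ^ 2 < b ^ 2 * (v₁ * w₁)) :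
    c / (√v * √w) ∈ Set.Ico a b := by
  have hv0 : 0 < v := hv₁.trans_le hv.1
  have hw0 : 0 < w := hw₁.trans_le hw.1
  have hpos : 0 < √v * √w := mul_pos (Real.sqrt_pos.2 hv0) (Real.sqrt_pos.2 hw0)
  have hsq : (√v * √w) ^ 2 = v * w := by
    rw [mul_pow, Real.sq_sqrt hv0.le, Real.sq_sqrt hw0.le]
  have hc0 : 0 ≤ c := hc₁.trans hc.1
  constructor
  · rw [le_div_iff₀ hpos]
    refine le_of_sq_le_sq ?_ hc0
    rw [mul_pow, hsq]
    calc a ^ 2 * (v * w) ≤ a ^ 2 * (v₂ * w₂) := by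
          gcongr
          exacts [hv0.le.trans hv.2, hv.2, hw.2]
      _ ≤ c₁ ^ 2 := h₁
      _ ≤ c ^ 2 := pow_le_pow_left₀ hc₁ hc.1 2
  · rw [div_lt_iff₀ hpos]
    refine lt_of_pow_lt_pow_left₀ 2 (by positivity) ?_
    rw [mul_pow, hsq]
    calc c ^ 2 ≤ c₂ ^ 2 := pow_le_pow_left₀ hc0 hc.2 2
      _ < b ^ 2 * (v₁ * w₁) := h₂
      _ ≤ b ^ 2 * (v * w) := by
          gcongr
          exacts [hv.1, hw.1]

lemma inv_pi_mem : 1 / Real.pi ∈ Set.Icc (0.31830988618379 : ℝ) 0.318309886183791 := by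
  have h1 := Real.pi_gt_d20
  have h2 := Real.pi_lt_d20
  constructor
  · rw [le_div_iff₀ Real.pi_pos]; linarith
  · rw [div_le_iff₀ Real.pi_pos]; linarith

lemma inv_pi_sq_mem : (1 / Real.pi) ^ 2 ∈ Set.Icc (0.101321183642337 : ℝ) 0.101321183642338 := by
  obtain ⟨h1, h2⟩ := inv_pi_mem
  constructor
  · exact (by norm_num : (0.101321183642337 : ℝ) ≤ 0.31830988618379 ^ 2).trans
      (pow_le_pow_left₀ (by norm_num) h1 2)
  · refine (pow_le_pow_left₀ (by positivity) h2 2).trans (by norm_num)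

lemma var_vl_mem : 1 + 6 / Real.pi - 16 / (3 * Real.pi) * (16 / (3 * Real.pi)) ∈
    Set.Icc (0.0278345379 : ℝ) 0.027834538 := by
  obtain ⟨h1, h2⟩ := inv_pi_mem
  obtain ⟨h3, h4⟩ := inv_pi_sq_mem
  rw [show 1 + 6 / Real.pi - 16 / (3 * Real.pi) * (16 / (3 * Real.pi)) =
    1 + 6 * (1 / Real.pi) - 256 / 9 * (1 / Real.pi) ^ 2 by ring]
  constructor <;> linarith

lemma var_ar_mem {K : ℝ} (hK : K ∈ Set.Icc (0.444909919 : ℝ) 0.444909922) :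
    12 + 3 * Real.pi + 96 * K - 8 * 8 ∈ Set.Icc (0.136130184 : ℝ) 0.136130473 := by
  have h1 := Real.pi_gt_d20
  have h2 := Real.pi_lt_d20
  constructor <;> linarith [hK.1, hK.2]

lemma var_mw_mem {J : ℝ} (hJ : J ∈ Set.Icc (0.711008967 : ℝ) 0.711008969) :
    3 / 4 + 3 * J - 16 / (3 * Real.pi) * (16 / (3 * Real.pi)) ∈
      Set.Icc (0.00100212184 : ℝ) 0.00100212785 := by
  obtain ⟨h3, h4⟩ := inv_pi_sq_mem
  rw [show 3 / 4 + 3 * J - 16 / (3 * Real.pi) * (16 / (3 * Real.pi)) =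
    3 / 4 + 3 * J - 256 / 9 * (1 / Real.pi) ^ 2 by ring]
  constructor <;> linarith [hJ.1, hJ.2]

lemma cov_vl_ar_mem : 6 * (1 + 4 / Real.pi) - 16 / (3 * Real.pi) * 8 ∈
    Set.Icc (0.0582154579 : ℝ) 0.058215458 := by
  obtain ⟨h1, h2⟩ := inv_pi_mem
  rw [show 6 * (1 + 4 / Real.pi) - 16 / (3 * Real.pi) * 8 = 6 - 56 / 3 * (1 / Real.pi) by ring]
  constructor <;> linarith

lemma cov_vl_mw_mem : 9 / 4 + 2 / Real.pi - 16 / (3 * Real.pi) * (16 / (3 * Real.pi)) ∈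
    Set.Icc (0.0045949932 : ℝ) 0.00459499321 := by
  obtain ⟨h1, h2⟩ := inv_pi_mem
  obtain ⟨h3, h4⟩ := inv_pi_sq_mem
  rw [show 9 / 4 + 2 / Real.pi - 16 / (3 * Real.pi) * (16 / (3 * Real.pi)) =
    9 / 4 + 2 * (1 / Real.pi) - 256 / 9 * (1 / Real.pi) ^ 2 by ring]
  constructor <;> linarith

lemma cov_ar_mw_mem : 3 * (5 + 2 * catalanConst) / Real.pi + 9 * Real.pi / 4 -
    8 * (16 / (3 * Real.pi)) ∈ Set.Icc (0.011375369 : ℝ) 0.011375378 := by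
  obtain ⟨h1, h2⟩ := inv_pi_mem
  obtain ⟨h3, h4⟩ := catalanConst_mem
  have h5 := Real.pi_gt_d20
  have h6 := Real.pi_lt_d20
  rw [show 3 * (5 + 2 * catalanConst) / Real.pi + 9 * Real.pi / 4 - 8 * (16 / (3 * Real.pi)) =
    9 * Real.pi / 4 - (83 / 3 - 6 * catalanConst) * (1 / Real.pi) by ring]
  -- The coefficient collects `15 - 128/3 = -83/3` and `6 G` over `π`; it is positive, so both
  -- factors are bounded monotonically.
  have hl : (83 / 3 - 6 * catalanConst) * (1 / Real.pi) ≤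
      (83 / 3 - 6 * 0.91596559) * 0.318309886183791 :=
    mul_le_mul (by linarith) h2 (by positivity) (by norm_num)
  have hu : (83 / 3 - 6 * 0.9159655943) * 0.31830988618379 ≤
      (83 / 3 - 6 * catalanConst) * (1 / Real.pi) :=
    mul_le_mul (by linarith) h1 (by norm_num) (by linarith)
  constructor <;> linarith

end Law

end CubeShadow

/-! ### Moments and correlations of the projected cube -/

theorem mainTheorem4 {Ω : Type*} [MeasurableSpace Ω] (P : Measure Ω) [IsProbabilityMeasure P]
    (U : Ω → Metric.sphere (0 : EuclideanSpace ℝ (Fin 4)) 1)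
    (hU : HasLaw U (CubeShadow.uniformSphere (EuclideanSpace ℝ (Fin 4))) P) :
    -- the three characteristics are square integrable
    MemLp (fun ω => CubeShadow.vl (U ω)) 2 P ∧
    MemLp (fun ω => CubeShadow.ar (U ω)) 2 P ∧
    MemLp (fun ω => CubeShadow.mw (U ω)) 2 P ∧
    -- the joint moments
    ∫ ω, CubeShadow.vl (U ω) * CubeShadow.ar (U ω) ∂P = 6 * (1 + 4 / Real.pi) ∧
    ∫ ω, CubeShadow.vl (U ω) * CubeShadow.mw (U ω) ∂P = 9 / 4 + 2 / Real.pi ∧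
    ∫ ω, CubeShadow.ar (U ω) * CubeShadow.mw (U ω) ∂P =
      3 * (5 + 2 * CubeShadow.catalanConst) / Real.pi + 9 * Real.pi / 4 ∧
    -- the correlations, to the three decimal places given
    CubeShadow.correlation (fun ω => CubeShadow.vl (U ω)) (fun ω => CubeShadow.ar (U ω)) P
      ∈ Set.Ico (0.945 : ℝ) 0.946 ∧
    CubeShadow.correlation (fun ω => CubeShadow.vl (U ω)) (fun ω => CubeShadow.mw (U ω)) P
      ∈ Set.Ico (0.870 : ℝ) 0.871 ∧
    CubeShadow.correlation (fun ω => CubeShadow.ar (U ω)) (fun ω => CubeShadow.mw (U ω)) P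
      ∈ Set.Ico (0.973 : ℝ) 0.974 := by
  open CubeShadow in
  have cv := continuous_absSum
  have ca := continuous_pairSum
  have cm := continuous_coSum
  have ev := ae_law hU (X := vl) (F := absSum) fun u hu h0 => vl_eq hu h0
  have ea := ae_law hU (X := ar) (F := pairSum) fun u hu h0 =>
    (ar_eq hu h0).trans (pairSum_eq u).symm
  have em := ae_law hU (X := mw) (F := coSum) fun u hu _ => mw_eq hu
  have vv := variance_law hU cv ev
  have va := variance_law hU ca ea
  have vm := variance_law hU cm em
  have kva := covariance_law hU cv ca ev ea
  have kvm := covariance_law hU cv cm ev em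
  have kam := covariance_law hU ca cm ea em
  rw [sphereMean_absSum, sphereMean_absSum_mul_absSum] at vv
  rw [sphereMean_pairSum, sphereMean_pairSum_mul_pairSum] at va
  rw [sphereMean_coSum, sphereMean_coSum_mul_coSum] at vm
  rw [sphereMean_absSum, sphereMean_pairSum, sphereMean_absSum_mul_pairSum] at kva
  rw [sphereMean_absSum, sphereMean_coSum, sphereMean_absSum_mul_coSum] at kvm
  rw [sphereMean_pairSum, sphereMean_coSum, sphereMean_pairSum_mul_coSum] at kam
  have iv := vv ▸ var_vl_mem
  have ia := va ▸ var_ar_mem sphereMean_sqrt_add_mul_sqrt_add_mem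
  have im := vm ▸ var_mw_mem sphereMean_sqrt_mul_sqrt_four_mem
  refine ⟨memLp_law hU cv ev, memLp_law hU ca ea, memLp_law hU cm em, ?_, ?_, ?_, ?_, ?_, ?_⟩
  · rw [← sphereMean_absSum_mul_pairSum]
    exact integral_law hU (X := fun u => vl u * ar u) (cv.mul ca) (ev.mul ea)
  · rw [← sphereMean_absSum_mul_coSum]
    exact integral_law hU (X := fun u => vl u * mw u) (cv.mul cm) (ev.mul em)
  · rw [← sphereMean_pairSum_mul_coSum]
    exact integral_law hU (X := fun u => ar u * mw u) (ca.mul cm) (ea.mul em)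
  · exact div_sqrt_mul_sqrt_mem_Ico (by norm_num) (by norm_num) (by norm_num)
      (by norm_num) (kva ▸ cov_vl_ar_mem) iv ia (by norm_num) (by norm_num)
  -- This is the tightest case: the correlation is about `0.87002`, only some `2.4e-5` above the
  -- endpoint, while the variance of `mw` is about `0.001`. Hence the many digits required of the
  -- second moment of `mw`.
  · exact div_sqrt_mul_sqrt_mem_Ico (by norm_num) (by norm_num) (by norm_num)
      (by norm_num) (kvm ▸ cov_vl_mw_mem) iv im (by norm_num) (by norm_num)
  · exact div_sqrt_mul_sqrt_mem_Ico (by norm_num) (by norm_num) (by norm_num)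
      (by norm_num) (kam ▸ cov_ar_mw_mem) ia im (by norm_num) (by norm_num)
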